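/- **Setting.** A *planar lattice graph* is a connected, locally finite graph $\mathcal G$ (loops and parallel edges allowed) embedded in $\mathbb R^2$ and invariant under a lattice of translations $\Lambda\cong\mathbb Z^2$, such that the quotient $G=\mathcal G/\Lambda$ is a finite graph with at least one edge, embedded in the torus $\mathbb R^2/\Lambda$ with all faces discs. Let $G^*$ be the dual graph of $G$ on the torus, let $VG,EG,FG$ be the sets of vertices, edges and faces of $G$, and let $|f|$ and $|v|$ be the degrees of a face $f$ and of a vertex $v$ (so $|v|$ is the degree of the face of $G^*$ dual to $v$). For $n\ge 1$ let $$\mathrm{vol}(B_n)=2n\,L(\pi/n),\qquad L(\theta)=-\int_0^\theta\log|2\sin t|\,dt,$$ which for $n\ge 3$ is the hyperbolic volume of the regular ideal $n$-bipyramid, and let $v_{\rm oct}=\mathrm{vol}(B_4)$ be the volume of the regular ideal octahedron. Put $$\mathrm{vol}^{\lozenge}(G)=\sum_{f\in FG}\mathrm{vol}(B_{|f|}),\qquad \nu^{\lozenge}(\mathcal G)=\frac{\mathrm{vol}^{\lozenge}(G)+\mathrm{vol}^{\lozenge}(G^*)}{|VG|},\qquad \overline{\nu}(\mathcal G)=\frac{|EG|\,v_{\rm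 oct}}{|VG|}.$$ Choose a basis of $\Lambda$ and a set of vertices of $\mathcal G$ that contains exactly one vertex of each $\Lambda$-orbit (a fundamental domain), and let $\Gamma_n$ be the finite subgraph of $\mathcal G$ induced on the $n\times n$ block of translates of this set, the blocks being nested and exhausting $\mathcal G$. The choice is *admissible* if $\Gamma_n$ is connected for every $n\ge 1$. The *spanning tree entropy* of $\mathcal G$ is $$z_{\mathcal G}=\lim_{n\to\infty}\frac{\log\tau(\Gamma_n)}{|V\Gamma_n|},$$ where $\tau(\Gamma_n)$ is the number of spanning trees of $\Gamma_n$. More precisely, a real number $z$ is the spanning tree entropy of $\mathcal G$ if there is an admissible choice, and for every admissible choice this limit exists and equals $z$. If $\mathcal G$ is $3$-regular, its *truncation* $\mathcal G'$ is the planar lattice graph obtained by replacing every vertex of $\mathcal G$ by a triangle $K_3$ and preserving each edge of $\mathcal G$ (the three edges at a vertex are attached, in their cyclic order, to the three vertices of the triangle). **Theorem.** Let $\mathcal G$ be a $3$-regular planar lattice graph with spanning tree entropy $z_{\mathcal G}$. If $$\nu^{\lozenge}(\mathcal G)\ \le\ 2\pi\,z_{\mathcal G}\ \le\ \overline{\nu}(\mathcal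 G),$$ then the truncation $\mathcal G'$ has a spanning tree entropy $z_{\mathcal G'}$, and $$\nu^{\lozenge}(\mathcal G')\ <\ 2\pi\,z_{\mathcal G'}\ <\ \overline{\nu}(\mathcal G').$$ -/

import Mathlib

open Filter Topology

/-! ### Finite spanning trees of multigraphs -/

section Multigraphs

variable {V E : Type*}

/-- Two vertices of a multigraph are joined by a walk. -/
def Graph.Joined (H : Graph V E) : V → V → Prop :=
  Relation.ReflTransGen (fun u v => ∃ e, H.IsLink e u v)

/-- A multigraph is connected: it has a vertex, and any two vertices are joined by a walk. -/
def Graph.IsConn (H : Graph V E) : Prop :=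
  H.vertexSet.Nonempty ∧ ∀ u ∈ H.vertexSet, ∀ v ∈ H.vertexSet, H.Joined u v

/-- A multigraph is acyclic if no edge lies on a cycle, that is, if deleting any edge separates
the two ends of that edge. (Loops and pairs of parallel edges are thus excluded.) -/
def Graph.IsAcyc (H : Graph V E) : Prop :=
  ∀ e u v, H.IsLink e u v → ¬ (H.deleteEdges {e}).Joined u v

/-- A tree is a connected acyclic multigraph. -/
def Graph.IsATree (H : Graph V E) : Prop := H.IsConn ∧ H.IsAcyc

/-- The number `τ(H)` of spanning trees of a (finite) multigraph `H`. -/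
noncomputable def Graph.numSpanningTrees (H : Graph V E) : ℕ :=
  {T : Graph V E | T.IsSpanningSubgraph H ∧ T.IsATree}.ncard

end Multigraphs

/-! ### Cycles of a permutation -/

/-- The set of cycles (orbits, fixed points included) of a permutation. -/
def PermCycle {D : Type*} (p : Equiv.Perm D) : Type _ := Quotient (Equiv.Perm.SameCycle.setoid p)

/-- The cycle through a point. -/
def PermCycle.of {D : Type*} (p : Equiv.Perm D) (d : D) : PermCycle p :=
  Quotient.mk (Equiv.Perm.SameCycle.setoid p) d

/-- The number of points on a cycle. -/
noncomputable def PermCycle.length {D : Type*} {p : Equiv.Perm D} (c : PermCycle p) : ℕ :=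
  Nat.card {d : D // PermCycle.of p d = c}

/-! ### Graphs embedded in oriented surfaces -/

/-- A graph cellularly embedded in an oriented surface, given by its rotation system. The elements
of `D` are the darts (oriented edges), each of which starts at some vertex; `rot` sends a dart to
the next dart, in counterclockwise order, that starts at the same vertex, and `rev` reverses a
dart. Loops and parallel edges are allowed. -/
structure SurfaceGraph (D : Type*) where
  rot : Equiv.Perm D
  rev : Equiv.Perm D
  rev_rev : ∀ d, rev (rev d) = d
  rev_ne : ∀ d, rev d ≠ d

namespace SurfaceGraph

variable {D : Type*}

/-- Vertices are the cycles of `rot`. -/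
abbrev Vertex (M : SurfaceGraph D) : Type _ := PermCycle M.rot

/-- Edges are the cycles of `rev`, i.e. the pairs of opposite darts. -/
abbrev Edge (M : SurfaceGraph D) : Type _ := PermCycle M.rev

/-- The permutation that sends a dart to the next one along the face lying to its right. -/
def facePerm (M : SurfaceGraph D) : Equiv.Perm D := M.rot * M.rev

/-- Faces are the cycles of `facePerm`: each is a disc bounded by the closed walk traced by
that cycle. -/
abbrev Face (M : SurfaceGraph D) : Type _ := PermCycle M.facePerm

/-- The vertex at which a dart starts. -/
def start (M : SurfaceGraph D) (d : D) : M.Vertex := PermCycle.of M.rot d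

/-- The edge underlying a dart. -/
def edge (M : SurfaceGraph D) (d : D) : M.Edge := PermCycle.of M.rev d

lemma edge_eq_iff (M : SurfaceGraph D) (d d' : D) :
    M.edge d = M.edge d' ↔ d' = d ∨ d' = M.rev d := by
  have h2 : M.rev * M.rev = 1 := Equiv.ext fun x => M.rev_rev x
  constructor
  · intro h
    obtain ⟨k, hk⟩ : M.rev.SameCycle d d' := Quotient.exact h
    rcases Int.even_or_odd' k with ⟨m, rfl | rfl⟩
    · left
      rw [zpow_mul, zpow_ofNat, pow_two, h2, one_zpow] at hk
      exact hk.symm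
    · right
      rw [zpow_add, zpow_mul, zpow_ofNat, pow_two, h2, one_zpow, one_mul, zpow_one] at hk
      exact hk.symm
  · rintro (rfl | rfl)
    · rfl
    · exact Quotient.sound (s := Equiv.Perm.SameCycle.setoid M.rev) ⟨1, by simp⟩

/-- The underlying abstract multigraph. -/
def graph (M : SurfaceGraph D) : Graph M.Vertex M.Edge where
  vertexSet := Set.univ
  IsLink e u v := ∃ d, M.edge d = e ∧ M.start d = u ∧ M.start (M.rev d) = v
  isLink_symm e _ := ⟨by
    rintro u v ⟨d, rfl, rfl, rfl⟩
    exact ⟨M.rev d, (M.edge_eq_iff _ _).2 (Or.inr (M.rev_rev d).symm), rfl, by rw [M.rev_rev]⟩⟩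
  eq_or_eq_of_isLink_of_isLink := by
    rintro e x y v w ⟨d, rfl, rfl, rfl⟩ ⟨d', hd', rfl, rfl⟩
    rcases (M.edge_eq_iff d' d).1 hd' with rfl | rfl
    · exact Or.inl rfl
    · exact Or.inr rfl
  left_mem_of_isLink _ _ _ _ := Set.mem_univ _

/-- The dual embedded graph: its vertices are the faces of `M`, and its faces are the vertices
of `M`. -/
def dual (M : SurfaceGraph D) : SurfaceGraph D where
  rot := M.facePerm
  rev := M.rev
  rev_rev := M.rev_rev
  rev_ne := M.rev_ne

end SurfaceGraph

/-! ### Bipyramid volumes -/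

/-- The Lobachevsky function. -/
noncomputable def lobachevsky (θ : ℝ) : ℝ :=
  -∫ t in (0 : ℝ)..θ, Real.log |2 * Real.sin t|

/-- The hyperbolic volume of the regular ideal `n`-bipyramid. -/
noncomputable def volB (n : ℕ) : ℝ := 2 * n * lobachevsky (Real.pi / n)

/-- The volume of the regular ideal octahedron, i.e. of the regular ideal `4`-bipyramid. -/
noncomputable def vOct : ℝ := volB 4

/-- The bipyramid volume of a finite embedded graph: the sum over all faces `f` of the volume of
the regular ideal `|f|`-bipyramid. -/
noncomputable def SurfaceGraph.bipyramidVolume {D : Type*} (M : SurfaceGraph D) : ℝ :=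
  ∑ᶠ f : M.Face, volB f.length

/-! ### Biperiodic graphs -/

/-- An embedded graph with a free action of the lattice `Λ = ℤ²` by orientation preserving
automorphisms. -/
structure BiperiodicGraph (D : Type*) extends SurfaceGraph D where
  trans : ℤ × ℤ → Equiv.Perm D
  trans_add : ∀ x y d, trans (x + y) d = trans x (trans y d)
  trans_rot : ∀ x d, trans x (rot d) = rot (trans x d)
  trans_rev : ∀ x d, trans x (rev d) = rev (trans x d)
  trans_free : ∀ x d, trans x d = d → x = 0

namespace BiperiodicGraph

variable {D : Type*}

lemma trans_zero (P : BiperiodicGraph D) (d : D) : P.trans 0 d = d :=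
  (P.trans 0).injective (by rw [← P.trans_add, add_zero])

/-- Two darts are equivalent if they differ by an element of `Λ`. -/
def dartSetoid (P : BiperiodicGraph D) : Setoid D where
  r d e := ∃ x, P.trans x d = e
  iseqv :=
    { refl := fun d => ⟨0, P.trans_zero d⟩
      symm := by
        rintro d e ⟨x, rfl⟩
        exact ⟨-x, by rw [← P.trans_add, neg_add_cancel, P.trans_zero]⟩
      trans := by
        rintro d e f ⟨x, rfl⟩ ⟨y, rfl⟩
        exact ⟨y + x, P.trans_add y x d⟩ }

/-- The darts of the quotient graph. -/
abbrev QuotDart (P : BiperiodicGraph D) : Type _ := Quotient P.dartSetoid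

/-- The permutation of `D / Λ` induced by a permutation of `D` that commutes with `Λ`. -/
def quotPerm (P : BiperiodicGraph D) (p : Equiv.Perm D)
    (hp : ∀ x d, P.trans x (p d) = p (P.trans x d)) : Equiv.Perm P.QuotDart :=
  Quotient.congr p fun d e => by
    constructor
    · rintro ⟨x, rfl⟩
      exact ⟨x, hp x d⟩
    · rintro ⟨x, hx⟩
      exact ⟨x, p.injective (by rw [← hp, hx])⟩

/-- The quotient graph `G = 𝒢 / Λ`, embedded in the quotient surface. -/
def quot (P : BiperiodicGraph D) : SurfaceGraph P.QuotDart where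
  rot := P.quotPerm P.rot P.trans_rot
  rev := P.quotPerm P.rev P.trans_rev
  rev_rev := by
    rintro ⟨d⟩
    exact congrArg (Quotient.mk P.dartSetoid) (P.rev_rev d)
  rev_ne := by
    rintro ⟨d⟩ h
    obtain ⟨x, hx⟩ : ∃ x, P.trans x (P.rev d) = d := Quotient.exact h
    have h2 : P.trans (x + x) d = d := by
      rw [P.trans_add]
      have : P.trans x d = P.rev d := by
        rw [← P.rev_rev (P.trans x d), ← P.trans_rev, hx]
      rw [this, hx]
    have h0 := P.trans_free _ _ h2
    have hx0 : x = 0 := by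
      have h1 := congrArg Prod.fst h0
      have h3 := congrArg Prod.snd h0
      simp only [Prod.fst_add, Prod.snd_add, Prod.fst_zero, Prod.snd_zero] at h1 h3
      ext
      · simp only [Prod.fst_zero]; omega
      · simp only [Prod.snd_zero]; omega
    rw [hx0, P.trans_zero] at hx
    exact P.rev_ne d hx

/-- `𝒢` is a planar lattice graph: it is (nonempty and) connected, locally finite, its faces are
finite discs, and its quotient `G = 𝒢 / Λ` is a finite graph embedded in the torus. Since `𝒢` is
connected, the quotient surface is connected, closed and oriented, so it is a torus exactly if its
Euler characteristic vanishes; the surface carrying `𝒢` is then the covering of the torus with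
deck group `ℤ²`, that is, the plane, on which `Λ` acts as a lattice of translations. -/
structure IsPlanarLatticeGraph (P : BiperiodicGraph D) : Prop where
  nonempty : Nonempty D
  connected : P.graph.IsConn
  locally_finite : ∀ v : P.Vertex, Finite {d // PermCycle.of P.rot d = v}
  finite_faces : ∀ f : P.Face, Finite {d // PermCycle.of P.facePerm d = f}
  finite_quot : Finite P.QuotDart
  euler : (Nat.card P.quot.Vertex : ℤ) - Nat.card P.quot.Edge + Nat.card P.quot.Face = 0

/-- Every vertex has degree `3`. -/
def IsThreeRegular (P : BiperiodicGraph D) : Prop := ∀ v : P.Vertex, v.length = 3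

/-- The bipyramid volume per vertex
`ν^◊(𝒢) = (vol^◊(G) + vol^◊(G*)) / |VG|`. -/
noncomputable def nuLozenge (P : BiperiodicGraph D) : ℝ :=
  (P.quot.bipyramidVolume + P.quot.dual.bipyramidVolume) / Nat.card P.quot.Vertex

/-- `ν̄(𝒢) = |EG| v_oct / |VG|`. -/
noncomputable def nuBar (P : BiperiodicGraph D) : ℝ :=
  (Nat.card P.quot.Edge * vOct) / Nat.card P.quot.Vertex

/-! ### Spanning tree entropy -/

/-- The action of `Λ` on vertices. -/
def transVertex (P : BiperiodicGraph D) (x : ℤ × ℤ) : P.Vertex → P.Vertex :=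
  Quotient.map (P.trans x) (by
    rintro d e ⟨k, rfl⟩
    have hc : Commute (P.trans x) P.rot := Equiv.ext fun d => P.trans_rot x d
    exact ⟨k, congrArg (fun q : Equiv.Perm D => q d) (hc.zpow_right k).eq.symm⟩)

/-- A fundamental domain for `Λ`: a basis of `Λ ≅ ℤ²` (the images of the two standard basis
vectors under `basis`), and a set of vertices that contains exactly one translate of every
vertex. -/
structure FundamentalDomain (P : BiperiodicGraph D) where
  basis : (ℤ × ℤ) ≃+ (ℤ × ℤ)
  verts : Set P.Vertex
  existsUnique_trans : ∀ v, ∃! x, P.transVertex x v ∈ verts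

namespace FundamentalDomain

variable {P : BiperiodicGraph D}

/-- The vertices of the `n × n` block of copies of the fundamental domain. The blocks are placed
so that they are nested and exhaust `𝒢`. -/
def boxVerts (F : P.FundamentalDomain) (n : ℕ) : Set P.Vertex :=
  {v | ∃ i ∈ Set.Ico (-(n / 2 : ℕ) : ℤ) (n - (n / 2 : ℕ)),
    ∃ j ∈ Set.Ico (-(n / 2 : ℕ) : ℤ) (n - (n / 2 : ℕ)),
    ∃ w ∈ F.verts, v = P.transVertex (F.basis (i, j)) w}

/-- The finite graph `Γ_n`: the subgraph of `𝒢` induced on `n × n` copies of the fundamental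
domain. -/
def box (F : P.FundamentalDomain) (n : ℕ) : Graph P.Vertex P.Edge := P.graph.induce (F.boxVerts n)

/-- All the graphs `Γ_n` are connected. -/
def Admissible (F : P.FundamentalDomain) : Prop := ∀ n, 1 ≤ n → (F.box n).IsConn

end FundamentalDomain

/-- `z` is the spanning tree entropy of `𝒢`: the limit of `log τ(Γ_n) / |VΓ_n|`, where `Γ_n` is
the sequence of finite connected graphs given by `n × n` copies of a fundamental domain. There
must be some fundamental domain for which the graphs `Γ_n` are connected, and for every such
fundamental domain the limit must exist and equal `z`. -/
def IsSpanningTreeEntropy (P : BiperiodicGraph D) (z : ℝ) : Prop :=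
  (∃ F : P.FundamentalDomain, F.Admissible) ∧
  ∀ F : P.FundamentalDomain, F.Admissible →
    Tendsto (fun n => Real.log ((F.box n).numSpanningTrees) / ((F.box n).vertexSet.ncard : ℝ))
      atTop (𝓝 z)

/-! ### Truncation -/

/-- Reversal of darts in the truncated graph, see `truncation`. -/
def truncRev (P : BiperiodicGraph D) : D × Fin 3 → D × Fin 3
  | (d, 0) => (P.rev d, 0)
  | (d, 1) => (P.rot d, 2)
  | (d, 2) => (P.rot.symm d, 1)

lemma truncRev_involutive (P : BiperiodicGraph D) : Function.Involutive P.truncRev := by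
  rintro ⟨d, i⟩
  fin_cases i <;> simp [truncRev, P.rev_rev]

/-- The truncation `𝒢'`. Every dart `d` of `𝒢`, starting at `v` say, gives one vertex of `𝒢'`,
placed on `d` near `v`. In counterclockwise order, the darts starting there are: `(d, 0)`, which
follows the old edge of `d`; `(d, 1)`, which goes to the new vertex on the dart after `d`
around `v`; and `(d, 2)`, which goes to the new vertex on the dart before `d` around `v`. So each
vertex `v` of degree `3` is replaced by a triangle, and each edge of `𝒢` is preserved. -/
def truncation (P : BiperiodicGraph D) : BiperiodicGraph (D × Fin 3) where
  rot := (Equiv.refl D).prodCongr (Equiv.addRight 1)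
  rev := P.truncRev_involutive.toPerm
  rev_rev := P.truncRev_involutive
  rev_ne := by
    rintro ⟨d, i⟩ h
    fin_cases i
    · exact P.rev_ne d (congrArg Prod.fst h)
    · exact absurd (congrArg Prod.snd h) (by decide : ¬ (2 : Fin 3) = 1)
    · exact absurd (congrArg Prod.snd h) (by decide : ¬ (1 : Fin 3) = 2)
  trans x := (P.trans x).prodCongr (Equiv.refl (Fin 3))
  trans_add x y := by
    rintro ⟨d, i⟩
    exact Prod.ext (P.trans_add x y d) rfl
  trans_rot x := fun _ => rfl
  trans_rev x := by
    have hs : ∀ d, P.trans x (P.rot.symm d) = P.rot.symm (P.trans x d) := fun d => by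
      rw [Equiv.eq_symm_apply, ← P.trans_rot, Equiv.apply_symm_apply]
    rintro ⟨d, i⟩
    fin_cases i
    · exact Prod.ext (P.trans_rev x d) rfl
    · exact Prod.ext (P.trans_rot x d) rfl
    · exact Prod.ext (hs d) rfl
  trans_free x := by
    rintro ⟨d, i⟩ h
    exact P.trans_free x d (congrArg Prod.fst h)

end BiperiodicGraph

/-! Truncating a finite piece of a 3-regular graph multiplies its number of spanning trees by an
explicit factor. Let L be the Laplacian of the piece, J an all-ones matrix, N the incidence matrix
of vertices and darts. The Laplacian of the truncated piece is indexed by darts and equals K - NᵀN,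
where K couples a dart only to its reverse: each inner edge gives a 2 × 2 block with entries 4 and
-1, of determinant 15. Since N K⁻¹ Nᵀ = 1 - L/15, Sylvester's identity gives det(K - NᵀN + J) = det
K · det(L/15 + J) (`det_edgeBlock_sub`). With the matrix tree theorem in the form det(L + J) = n² τ
(`det_orientedLaplacian_add_one`), a piece with n vertices and about 3n/2 edges gains a factor of
about 15^(n/2), up to its boundary (`log_numSpanningTrees_truncation`). The truncation has three
times as many vertices, so z' = (z + log 15 / 2) / 3.

This computes the limit only along truncated fundamental domains, whereas the entropy refers to
every admissible domain of the truncation. Independence of the domain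
(`isSpanningTreeEntropy_of_tendsto`) comes from tiling a large block of one domain by translates of
a block of another. Spanning trees are treated as bases of the graphic matroid over the field with
two elements, so that maximal forests make sense for disconnected pieces. Their number is
multiplicative over disjoint tiles, and adding relatively few edges changes its logarithm by a small
proportion of the total number of edges (`log_numForests_le`).

It remains to compare 2πz' = (2πz + π log 15) / 3 with the volumes. Both graphs are 3-regular, so
both upper bounds equal 3/2 v_oct, and π log 15 < 3 v_oct suffices. For the lower bound, truncation
doubles every face degree and adds a triangle at every vertex. The duplication formula for the
Lobachevsky function gives vol(B_2k) ≤ vol(B_k) + 2π log 2, the torus has |V|/2 faces by Euler's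
formula, and 3 vol(B_3) + π log 2 < π log 15 finishes the proof (`nuLozenge_truncation_lt`). -/

namespace Graph

variable {V E : Type*} {G H T : Graph V E} {S F F' : Set E}

/-! ### Spanning trees and linear algebra over the field with two elements -/

/-- Two vertices are joined by a walk all of whose edges belong to `F`. -/
def JoinedBy (G : Graph V E) (F : Set E) : V → V → Prop :=
  Relation.ReflTransGen (fun u v => ∃ e ∈ F, G.IsLink e u v)

lemma isLink_iff_of_le (h : T ≤ G) {e : E} {u v : V} :
    T.IsLink e u v ↔ e ∈ E(T) ∧ G.IsLink e u v :=
  ⟨fun hl => ⟨hl.edge_mem, hl.mono h⟩, fun hl => (h.isLink_iff hl.1).2 hl.2⟩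

lemma joined_iff_joinedBy (h : T ≤ G) (u v : V) : T.Joined u v ↔ G.JoinedBy E(T) u v := by
  simp only [Joined, JoinedBy, isLink_iff_of_le h]

lemma chain_add_self (x : V →₀ ZMod 2) : x + x = 0 :=
  Finsupp.ext fun _ => CharTwo.add_self_eq_zero _

/-- The boundary of an edge, as a chain with coefficients modulo `2`. -/
noncomputable def bdry (G : Graph V E) (e : E) : V →₀ ZMod 2 :=
  open Classical in
  if h : ∃ p : V × V, G.IsLink e p.1 p.2 then
    Finsupp.single h.choose.1 1 + Finsupp.single h.choose.2 1 else 0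

lemma IsLink.bdry_eq {e : E} {u v : V} (h : G.IsLink e u v) :
    G.bdry e = Finsupp.single u 1 + Finsupp.single v 1 := by
  have hex : ∃ p : V × V, G.IsLink e p.1 p.2 := ⟨(u, v), h⟩
  rw [bdry, dif_pos hex]
  rcases hex.choose_spec.eq_and_eq_or_eq_and_eq h with ⟨h1, h2⟩ | ⟨h1, h2⟩
  · rw [h1, h2]
  · rw [h1, h2, add_comm]

lemma bdry_eq_zero {e : E} (h : ¬ ∃ p : V × V, G.IsLink e p.1 p.2) : G.bdry e = 0 := by
  rw [bdry, dif_neg h]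

/-- The boundaries along a walk telescope modulo 2. Conversely, if `v` cannot be reached from `u`,
the indicator of the component of `u` is a functional that kills every boundary in the span but not
`u + v`. -/
lemma joinedBy_iff (u v : V) : G.JoinedBy F u v ↔
    Finsupp.single u 1 + Finsupp.single v 1 ∈ Submodule.span (ZMod 2) (G.bdry '' F) := by
  classical
  constructor
  · intro h
    induction h with
    | refl =>
      rw [chain_add_self]
      exact Submodule.zero_mem _
    | @tail w x _ hl ih =>
      obtain ⟨e, he, hl⟩ := hl
      have h1 : G.bdry e ∈ Submodule.span (ZMod 2) (G.bdry '' F) :=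
        Submodule.subset_span ⟨e, he, rfl⟩
      rw [hl.bdry_eq] at h1
      have h2 := Submodule.add_mem _ ih h1
      have h3 : (Finsupp.single w 1 : V →₀ ZMod 2) + Finsupp.single w 1 = 0 :=
        chain_add_self _
      have h4 : (Finsupp.single u 1 + Finsupp.single w 1) +
          (Finsupp.single w 1 + Finsupp.single x 1) =
          (Finsupp.single u 1 + Finsupp.single x 1 : V →₀ ZMod 2) := by
        rw [add_assoc, ← add_assoc (Finsupp.single w 1), h3, zero_add]
      rwa [h4] at h2
  · intro h
    by_contra huv
    let φ : (V →₀ ZMod 2) →ₗ[ZMod 2] ZMod 2 :=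
      Finsupp.linearCombination (ZMod 2) (fun w => if G.JoinedBy F u w then 1 else 0)
    have hφ : ∀ w, φ (Finsupp.single w 1) = if G.JoinedBy F u w then 1 else 0 := fun w => by
      simp [φ]
    have hker : Submodule.span (ZMod 2) (G.bdry '' F) ≤ LinearMap.ker φ := by
      rw [Submodule.span_le]
      rintro _ ⟨e, he, rfl⟩
      by_cases hex : ∃ p : V × V, G.IsLink e p.1 p.2
      · obtain ⟨⟨x, y⟩, hl⟩ := hex
        have hiff : G.JoinedBy F u x ↔ G.JoinedBy F u y :=
          ⟨fun h => h.tail ⟨e, he, hl⟩, fun h => h.tail ⟨e, he, hl.symm⟩⟩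
        simp only [SetLike.mem_coe, LinearMap.mem_ker, hl.bdry_eq, map_add, hφ, hiff]
        exact CharTwo.add_self_eq_zero _
      · simp [bdry_eq_zero hex]
    have h0 : φ (Finsupp.single u 1 + Finsupp.single v 1) = 0 := hker h
    have hu : G.JoinedBy F u u := .refl
    rw [map_add, hφ, hφ, if_pos hu, if_neg huv] at h0
    exact absurd h0 (by decide)

/-- A maximal forest inside a set of edges. -/
structure IsMaxForest (G : Graph V E) (S F : Set E) : Prop where
  subset : F ⊆ S
  indep : LinearIndepOn (ZMod 2) G.bdry F
  span : G.bdry '' S ⊆ Submodule.span (ZMod 2) (G.bdry '' F)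

/-- The number of maximal forests inside a set of edges. -/
noncomputable def numForests (G : Graph V E) (S : Set E) : ℕ := {F | G.IsMaxForest S F}.ncard

lemma IsMaxForest.span_eq (h : G.IsMaxForest S F) :
    Submodule.span (ZMod 2) (G.bdry '' F) = Submodule.span (ZMod 2) (G.bdry '' S) :=
  le_antisymm (Submodule.span_mono (Set.image_mono h.subset)) (Submodule.span_le.2 h.span)

lemma IsMaxForest.joinedBy_iff (h : G.IsMaxForest S F) {u v : V} :
    G.JoinedBy F u v ↔ G.JoinedBy S u v := by
  rw [Graph.joinedBy_iff, Graph.joinedBy_iff, h.span_eq]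

/-- An edge lies on a cycle of `F` exactly if its boundary is spanned by those of the other edges.
Elements of `E` that are not edges must be excluded: their boundary is zero, hence dependent,
although the right side says nothing about them. -/
lemma linearIndepOn_bdry_iff (hF : F ⊆ E(G)) : LinearIndepOn (ZMod 2) G.bdry F ↔
    ∀ e ∈ F, ∀ u v, G.IsLink e u v → ¬ G.JoinedBy (F \ {e}) u v := by
  rw [linearIndepOn_iff_notMem_span]
  refine forall₂_congr fun e he => ?_
  constructor
  · intro h u v hl hj
    rw [Graph.joinedBy_iff, ← hl.bdry_eq] at hj
    exact h hj
  · intro h hs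
    obtain ⟨u, v, hl⟩ := exists_isLink_of_mem_edgeSet (hF he)
    rw [hl.bdry_eq, ← Graph.joinedBy_iff] at hs
    exact h u v hl hs

lemma isAcyc_iff (h : T ≤ G) : T.IsAcyc ↔ LinearIndepOn (ZMod 2) G.bdry E(T) := by
  rw [linearIndepOn_bdry_iff h.edgeSet_mono, IsAcyc]
  have hj : ∀ e u v, (T.deleteEdges {e}).Joined u v ↔ G.JoinedBy (E(T) \ {e}) u v := fun e u v => by
    rw [joined_iff_joinedBy (deleteEdges_le.trans h)]
    simp
  constructor
  · intro hT e he u v hl hjb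
    exact hT e u v ((isLink_iff_of_le h).2 ⟨he, hl⟩) ((hj e u v).2 hjb)
  · intro hT e u v hl hjb
    exact hT e hl.edge_mem u v (hl.mono h) ((hj e u v).1 hjb)

/-- Spanning trees are the bases of the graphic matroid. Boundaries are taken in the ambient graph
`G`, so that all its subgraphs share one vector space. -/
lemma numSpanningTrees_eq (hH : H ≤ G) (hc : H.IsConn) :
    H.numSpanningTrees = G.numForests E(H) := by
  have hjH : ∀ u ∈ V(H), ∀ v ∈ V(H), G.JoinedBy E(H) u v := fun u hu v hv =>
    (joined_iff_joinedBy hH u v).1 (hc.2 u hu v hv)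
  have himg : {F | G.IsMaxForest E(H) F} =
      (fun T : Graph V E => E(T)) '' {T : Graph V E | T.IsSpanningSubgraph H ∧ T.IsATree} := by
    ext F
    constructor
    · intro hF
      have hle : H.restrict F ≤ G := restrict_le.trans hH
      have hE : E(H.restrict F) = F := by
        rw [edgeSet_restrict]
        exact Set.inter_eq_right.2 hF.subset
      refine ⟨H.restrict F, ⟨⟨restrict_le, rfl⟩, ⟨hc.1, fun u hu v hv => ?_⟩, ?_⟩, hE⟩
      · rw [joined_iff_joinedBy hle, hE, hF.joinedBy_iff]
        exact hjH u hu v hv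
      · rw [isAcyc_iff hle, hE]
        exact hF.indep
    · rintro ⟨T, ⟨hT, hconn, hac⟩, rfl⟩
      have hle : T ≤ G := hT.le.trans hH
      refine ⟨hT.le.edgeSet_mono, (isAcyc_iff hle).1 hac, ?_⟩
      rintro _ ⟨e, he, rfl⟩
      obtain ⟨u, v, hl⟩ := exists_isLink_of_mem_edgeSet he
      have hl' := hl.mono hH
      rw [hl'.bdry_eq, SetLike.mem_coe, ← Graph.joinedBy_iff, ← joined_iff_joinedBy hle]
      exact hconn.2 u (hT.vertexSet_eq ▸ hl.left_mem) v (hT.vertexSet_eq ▸ hl.right_mem)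
  rw [numForests, himg, Set.InjOn.ncard_image]
  · rfl
  · rintro T₁ ⟨h₁, -⟩ T₂ ⟨h₂, -⟩ (he : E(T₁) = E(T₂))
    exact (Compatible.of_le_le h₁.le h₂.le).ext (h₁.vertexSet_eq.trans h₂.vertexSet_eq.symm) he

/-! ### Comparing the numbers of maximal forests -/

lemma finite_setOf_isMaxForest (hS : S.Finite) : {F | G.IsMaxForest S F}.Finite :=
  hS.finite_subsets.subset fun _ h => h.subset

lemma exists_isMaxForest_of_subset (hF : LinearIndepOn (ZMod 2) G.bdry F) (hFS : F ⊆ S) :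
    ∃ B, G.IsMaxForest S B ∧ F ⊆ B := by
  obtain ⟨B, hBS, hFB, hspan, hind⟩ := exists_linearIndepOn_extension hF hFS
  exact ⟨B, ⟨hBS, hind, hspan⟩, hFB⟩

lemma one_le_numForests (hS : S.Finite) : 1 ≤ G.numForests S := by
  obtain ⟨B, hB, -⟩ := exists_isMaxForest_of_subset (G := G) (S := S)
    (linearIndepOn_empty (ZMod 2) G.bdry) (Set.empty_subset S)
  exact (Set.ncard_pos (finite_setOf_isMaxForest hS)).2 ⟨B, hB⟩

/-- Any further edge of `B` in `N` would already be spanned by `F`. Hence a maximal forest of `N`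
can be recovered from any independent extension. -/
lemma IsMaxForest.inter_eq {N B : Set E} (hF : G.IsMaxForest N F)
    (hB : LinearIndepOn (ZMod 2) G.bdry B) (hFB : F ⊆ B) : B ∩ N = F := by
  refine Set.Subset.antisymm ?_ (Set.subset_inter hFB hF.subset)
  rintro e ⟨heB, heN⟩
  by_contra heF
  refine hB.notMem_span heB (Submodule.span_mono (Set.image_mono ?_) (hF.span ⟨e, heN, rfl⟩))
  exact fun f hf => ⟨hFB hf, fun h => heF (h ▸ hf)⟩

lemma numForests_mono {N : Set E} (hNS : N ⊆ S) (hS : S.Finite) :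
    G.numForests N ≤ G.numForests S := by
  choose! g hg using fun F (hF : G.IsMaxForest N F) =>
    exists_isMaxForest_of_subset hF.indep (hF.subset.trans hNS)
  refine Set.ncard_le_ncard_of_injOn g (fun F hF => (hg F hF).1) ?_ (finite_setOf_isMaxForest hS)
  intro F hF F' hF' h
  rw [← hF.inter_eq (hg F hF).1.indep (hg F hF).2, h,
    hF'.inter_eq (hg F' hF').1.indep (hg F' hF').2]

lemma IsMaxForest.ncard_le {N B B' : Set E} (hB : G.IsMaxForest S B) (hS : S.Finite)
    (hNS : N ⊆ S) (hB' : LinearIndepOn (ZMod 2) G.bdry B') (hB'N : B' ⊆ N) :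
    B'.ncard ≤ B.ncard := by
  have hfB : B.Finite := hS.subset hB.subset
  have hfB' : B'.Finite := hS.subset (hB'N.trans hNS)
  have : Finite B := hfB
  have : Finite B' := hfB'
  have := Fintype.ofFinite B
  have := Fintype.ofFinite B'
  have : Module.Finite (ZMod 2) (Submodule.span (ZMod 2) (G.bdry '' B)) :=
    FiniteDimensional.span_of_finite _ (hfB.image _)
  have h1 := finrank_span_eq_card hB'
  have h2 := finrank_span_eq_card hB.indep
  have h3 : Submodule.span (ZMod 2) (Set.range fun x : B' => G.bdry x) ≤
      Submodule.span (ZMod 2) (Set.range fun x : B => G.bdry x) := by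
    rw [← Set.image_eq_range, ← Set.image_eq_range, hB.span_eq]
    exact Submodule.span_mono (Set.image_mono (hB'N.trans hNS))
  rw [← Set.image_eq_range G.bdry B] at h3 h2
  have h4 := Submodule.finrank_mono h3
  rw [h1, h2] at h4
  rwa [← Nat.card_eq_fintype_card, ← Nat.card_eq_fintype_card, Nat.card_coe_set_eq,
    Nat.card_coe_set_eq] at h4

/-- A maximal forest `B` of `S` is encoded by a maximal forest `g B` of `N` that completes `B ∩ N`,
by the edges of `B` outside `N`, and by the edges `g B \ B` that were added. There are at most `|S \
N|` added edges, because `|g B| ≤ |B|`. -/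
lemma numForests_le_mul {N : Set E} (hNS : N ⊆ S) (hS : S.Finite) :
    G.numForests S ≤ G.numForests N * (2 ^ (S \ N).ncard *
      {Y | Y ⊆ S ∧ Y.ncard ≤ (S \ N).ncard}.ncard) := by
  choose! g hg using fun B (hB : G.IsMaxForest S B) =>
    exists_isMaxForest_of_subset (S := N) (hB.indep.mono Set.inter_subset_left)
      (Set.inter_subset_right : B ∩ N ⊆ N)
  have hfin : ({F | G.IsMaxForest N F} ×ˢ (𝒫 (S \ N) ×ˢ
      {Y | Y ⊆ S ∧ Y.ncard ≤ (S \ N).ncard})).Finite :=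
    (finite_setOf_isMaxForest (hS.subset hNS)).prod
      ((hS.subset Set.sdiff_subset).finite_subsets.prod
        (hS.finite_subsets.subset fun Y hY => hY.1))
  rw [numForests, numForests, ← Set.ncard_powerset _ (hS.subset Set.sdiff_subset),
    ← Set.ncard_prod, ← Set.ncard_prod]
  refine Set.ncard_le_ncard_of_injOn (fun B => (g B, B ∩ (S \ N), g B \ B)) ?_ ?_ hfin
  · intro B hB
    obtain ⟨hg1, hg2⟩ := hg B hB
    refine ⟨hg1, Set.inter_subset_right, (Set.sdiff_subset.trans hg1.subset).trans hNS, ?_⟩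
    have hfB : B.Finite := hS.subset hB.subset
    have hfg : (g B).Finite := hS.subset (hg1.subset.trans hNS)
    have h1 := hB.ncard_le hS hNS hg1.indep hg1.subset
    have h2 : (g B ∩ B).ncard + (g B \ B).ncard = (g B).ncard :=
      Set.ncard_inter_add_ncard_sdiff_eq_ncard _ _ hfg
    have h3 : (B ∩ N).ncard + (B \ N).ncard = B.ncard :=
      Set.ncard_inter_add_ncard_sdiff_eq_ncard _ _ hfB
    have h4 : (B ∩ N).ncard ≤ (g B ∩ B).ncard :=
      Set.ncard_le_ncard (fun e he => ⟨hg2 he, he.1⟩) (hfg.subset Set.inter_subset_left)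
    have h5 : (B \ N).ncard ≤ (S \ N).ncard :=
      Set.ncard_le_ncard (Set.sdiff_subset_sdiff_left hB.subset) (hS.subset Set.sdiff_subset)
    change (g B \ B).ncard ≤ _
    omega
  · intro B hB B' hB' h
    obtain ⟨h1, h2, h3⟩ : g B = g B' ∧ B ∩ (S \ N) = B' ∩ (S \ N) ∧ g B \ B = g B' \ B' := by
      simpa using h
    have key : ∀ B, G.IsMaxForest S B → B = (g B \ (g B \ B)) ∪ B ∩ (S \ N) := by
      intro B hB
      obtain ⟨hg1, hg2⟩ := hg B hB
      ext e
      constructor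
      · intro he
        by_cases heN : e ∈ N
        · exact Or.inl ⟨hg2 ⟨he, heN⟩, fun h => h.2 he⟩
        · exact Or.inr ⟨he, hB.subset he, heN⟩
      · rintro (⟨h, h'⟩ | h)
        · by_contra hne
          exact h' ⟨h, hne⟩
        · exact h.1
    rw [key B hB, key B' hB', h1, h2, ← h3, h1]

/-- Expand the right side as the sum of `t ^ |Y|` over all subsets `Y`; each small subset
contributes at least `t ^ k`, since `t ≤ 1`. -/
lemma ncard_small_subsets_mul_pow_le (hS : S.Finite) (k : ℕ) {t : ℝ} (ht : 0 < t) (ht1 : t ≤ 1) :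
    ({Y | Y ⊆ S ∧ Y.ncard ≤ k}.ncard : ℝ) * t ^ k ≤ (1 + t) ^ S.ncard := by
  classical
  lift S to Finset E using hS
  have hset : {Y : Set E | Y ⊆ ↑S ∧ Y.ncard ≤ k} =
      ((S.powerset.filter fun Y => Y.card ≤ k).map ⟨_, Finset.coe_injective⟩ :
        Finset (Set E)) := by
    ext Y
    simp only [Set.mem_ofPred_eq, Finset.coe_map, Set.mem_image, Finset.mem_coe, Finset.mem_filter,
      Finset.mem_powerset, Function.Embedding.coeFn_mk]
    constructor
    · rintro ⟨hY, hk⟩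
      lift Y to Finset E using S.finite_toSet.subset hY
      exact ⟨Y, ⟨by exact_mod_cast hY, by simpa using hk⟩, rfl⟩
    · rintro ⟨Z, ⟨hZ, hk⟩, rfl⟩
      exact ⟨by exact_mod_cast hZ, by simpa using hk⟩
  rw [hset, Set.ncard_coe_finset, Finset.card_map, Set.ncard_coe_finset, add_comm (1 : ℝ) t,
    ← Finset.sum_pow_mul_eq_add_pow t 1 S, ← nsmul_eq_mul, ← Finset.sum_const]
  calc ∑ _Y ∈ S.powerset.filter fun Y => Y.card ≤ k, t ^ k
      ≤ ∑ Y ∈ S.powerset.filter fun Y => Y.card ≤ k, t ^ Y.card * 1 ^ (S.card - Y.card) := by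
        refine Finset.sum_le_sum fun Y hY => ?_
        rw [one_pow, mul_one]
        exact pow_le_pow_of_le_one ht.le ht1 (Finset.mem_filter.1 hY).2
    _ ≤ _ := Finset.sum_le_sum_of_subset_of_nonneg (Finset.filter_subset _ _)
        fun Y _ _ => by positivity

/-- The parameter `t` trades a cost `log (2 / t)` for each edge outside `N` against a cost `t` for
every edge of `S`. If `S \ N` is a small part of `S`, a small `t` makes the total cost small
relative to `|S|`. -/
lemma log_numForests_le {N : Set E} (hNS : N ⊆ S) (hS : S.Finite) {t : ℝ} (ht : 0 < t)
    (ht1 : t ≤ 1) : Real.log (G.numForests S) ≤ Real.log (G.numForests N) +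
      (S \ N).ncard * (Real.log 2 - Real.log t) + S.ncard * t := by
  set k := (S \ N).ncard
  have hN : (1 : ℝ) ≤ G.numForests N := by exact_mod_cast one_le_numForests (hS.subset hNS)
  have hS1 : (1 : ℝ) ≤ G.numForests S := by exact_mod_cast one_le_numForests hS
  have h1 : (G.numForests S : ℝ) ≤ G.numForests N * (2 ^ k *
      {Y | Y ⊆ S ∧ Y.ncard ≤ k}.ncard) := by exact_mod_cast numForests_le_mul hNS hS
  have h2 := ncard_small_subsets_mul_pow_le hS k ht ht1
  have h3 : (G.numForests S : ℝ) * t ^ k ≤ G.numForests N * 2 ^ k * (1 + t) ^ S.ncard := by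
    calc (G.numForests S : ℝ) * t ^ k
        ≤ (G.numForests N * (2 ^ k * {Y | Y ⊆ S ∧ Y.ncard ≤ k}.ncard)) * t ^ k := by gcongr
      _ = G.numForests N * 2 ^ k * ({Y | Y ⊆ S ∧ Y.ncard ≤ k}.ncard * t ^ k) := by ring
      _ ≤ _ := by gcongr
  have h4 := Real.log_le_log (by positivity) h3
  rw [Real.log_mul (by positivity) (by positivity), Real.log_mul (by positivity) (by positivity),
    Real.log_mul (by positivity) (by positivity), Real.log_pow, Real.log_pow, Real.log_pow] at h4
  have h5 : Real.log (1 + t) ≤ t := by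
    have := Real.log_le_sub_one_of_pos (show 0 < 1 + t by positivity)
    linarith
  have h6 : (S.ncard : ℝ) * Real.log (1 + t) ≤ S.ncard * t := by gcongr
  linarith

/-! ### Disjoint unions and automorphisms -/

/-- When the two spans meet only in zero, the matroid on the union is a direct sum, so independence
and spanning can be tested on each summand. -/
lemma isMaxForest_union_iff {S' : Set E}
    (hspan : Disjoint (Submodule.span (ZMod 2) (G.bdry '' S))
      (Submodule.span (ZMod 2) (G.bdry '' S'))) (hF : F ⊆ S) (hF' : F' ⊆ S') :
    G.IsMaxForest (S ∪ S') (F ∪ F') ↔ G.IsMaxForest S F ∧ G.IsMaxForest S' F' := by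
  have hsF : Submodule.span (ZMod 2) (G.bdry '' F) ≤ Submodule.span (ZMod 2) (G.bdry '' S) :=
    Submodule.span_mono (Set.image_mono hF)
  have hsF' : Submodule.span (ZMod 2) (G.bdry '' F') ≤ Submodule.span (ZMod 2) (G.bdry '' S') :=
    Submodule.span_mono (Set.image_mono hF')
  constructor
  · intro h
    refine ⟨⟨hF, h.indep.mono Set.subset_union_left, ?_⟩,
      ⟨hF', h.indep.mono Set.subset_union_right, ?_⟩⟩
    · rintro x ⟨e, he, rfl⟩
      have h1 := h.span ⟨e, Or.inl he, rfl⟩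
      rw [Set.image_union, Submodule.span_union, SetLike.mem_coe, Submodule.mem_sup] at h1
      obtain ⟨y, hy, z, hz, hyz⟩ := h1
      have hz0 : z = 0 := by
        refine Submodule.disjoint_def.1 hspan z ?_ (hsF' hz)
        rw [show z = G.bdry e - y by rw [← hyz]; abel]
        exact Submodule.sub_mem _ (Submodule.subset_span ⟨e, he, rfl⟩) (hsF hy)
      rw [hz0, add_zero] at hyz
      exact hyz ▸ hy
    · rintro x ⟨e, he, rfl⟩
      have h1 := h.span ⟨e, Or.inr he, rfl⟩
      rw [Set.image_union, Submodule.span_union, SetLike.mem_coe, Submodule.mem_sup] at h1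
      obtain ⟨y, hy, z, hz, hyz⟩ := h1
      have hy0 : y = 0 := by
        refine Submodule.disjoint_def.1 hspan y (hsF hy) ?_
        rw [show y = G.bdry e - z by rw [← hyz]; abel]
        exact Submodule.sub_mem _ (Submodule.subset_span ⟨e, he, rfl⟩) (hsF' hz)
      rw [hy0, zero_add] at hyz
      exact hyz ▸ hz
  · rintro ⟨h, h'⟩
    refine ⟨Set.union_subset_union hF hF', h.indep.union h'.indep (hspan.mono hsF hsF'), ?_⟩
    rw [Set.image_union, Set.image_union, Submodule.span_union]
    rintro x (hx | hx)
    · exact Submodule.mem_sup_left (h.span hx)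
    · exact Submodule.mem_sup_right (h'.span hx)

lemma numForests_union {S' : Set E} (hd : Disjoint S S')
    (hspan : Disjoint (Submodule.span (ZMod 2) (G.bdry '' S))
      (Submodule.span (ZMod 2) (G.bdry '' S'))) :
    G.numForests (S ∪ S') = G.numForests S * G.numForests S' := by
  rw [numForests, numForests, numForests, ← Set.ncard_prod]
  have hdec : ∀ F ⊆ S ∪ S', F = F ∩ S ∪ F ∩ S' := fun F hF => by
    rw [← Set.inter_union_distrib_left, Set.inter_eq_left.2 hF]
  refine Set.ncard_congr (fun F _ => (F ∩ S, F ∩ S')) ?_ ?_ ?_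
  · intro F hF
    have hF' : G.IsMaxForest (S ∪ S') F := hF
    rw [hdec F hF'.subset, isMaxForest_union_iff hspan Set.inter_subset_right
      Set.inter_subset_right] at hF'
    exact hF'
  · intro F F' hF hF' h
    obtain ⟨h1, h2⟩ := Prod.ext_iff.1 h
    dsimp only at h1 h2
    rw [hdec F hF.subset, hdec F' hF'.subset, h1, h2]
  · rintro ⟨F, F'⟩ ⟨hF, hF'⟩
    dsimp only at hF hF'
    refine ⟨F ∪ F', (isMaxForest_union_iff hspan hF.subset hF'.subset).2 ⟨hF, hF'⟩, ?_⟩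
    have h1 : F' ∩ S = ∅ := (hd.symm.mono_left hF'.subset).inter_eq
    have h2 : F ∩ S' = ∅ := (hd.mono_left hF.subset).inter_eq
    simp only [Set.union_inter_distrib_right, h1, h2, Set.inter_eq_left.2 hF.subset,
      Set.inter_eq_left.2 hF'.subset, Set.union_empty, Set.empty_union]

/-- This gives the disjointness of spans needed for `numForests_union`: chains supported on disjoint
vertex sets meet only in zero. -/
lemma span_bdry_induce_le (A : Set V) :
    Submodule.span (ZMod 2) (G.bdry '' E(G.induce A)) ≤ Finsupp.supported (ZMod 2) (ZMod 2) A := by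
  rw [Submodule.span_le]
  rintro _ ⟨e, ⟨u, v, hl, hu, hv⟩, rfl⟩
  rw [hl.bdry_eq]
  exact Submodule.add_mem _ (Finsupp.single_mem_supported _ _ hu)
    (Finsupp.single_mem_supported _ _ hv)

lemma numForests_biUnion {ι : Type*} (I : Finset ι) (A : ι → Set V)
    (hA : (I : Set ι).PairwiseDisjoint A) :
    G.numForests (⋃ i ∈ I, E(G.induce (A i))) = ∏ i ∈ I, G.numForests E(G.induce (A i)) := by
  classical
  induction I using Finset.induction_on with
  | empty =>
    simp only [Finset.notMem_empty, Set.iUnion_of_empty, Set.iUnion_empty, Finset.prod_empty]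
    refine le_antisymm ?_ (one_le_numForests Set.finite_empty)
    calc G.numForests ∅ ≤ ({∅} : Set (Set E)).ncard :=
          Set.ncard_le_ncard (fun F hF => Set.subset_empty_iff.1 hF.subset)
      _ = 1 := Set.ncard_singleton _
  | insert i I hi ih =>
    rw [Finset.coe_insert, Set.pairwiseDisjoint_insert] at hA
    have hdis : Disjoint (A i) (⋃ j ∈ I, A j) := by
      simp only [Set.disjoint_iUnion_right]
      exact fun j hj => hA.2 j hj fun h => hi (h ▸ hj)
    rw [Finset.set_biUnion_insert, Finset.prod_insert hi, numForests_union, ih hA.1]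
    · rw [Set.disjoint_iUnion₂_right]
      intro j hj
      rw [Set.disjoint_left]
      rintro e ⟨u, v, hl, hu, hv⟩ ⟨u', v', hl', hu', hv'⟩
      have h1 : Disjoint (A i) (A j) := hA.2 j hj fun h => hi (h ▸ hj)
      rcases hl.left_eq_or_eq hl' with rfl | rfl
      · exact Set.disjoint_left.1 h1 hu hu'
      · exact Set.disjoint_left.1 h1 hu hv'
    · refine (Finsupp.disjoint_supported_supported hdis).mono (span_bdry_induce_le _)
        ((Submodule.span_mono (Set.image_mono ?_)).trans (span_bdry_induce_le _))
      refine Set.iUnion₂_subset fun j hj => ?_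
      rintro e ⟨u, v, hl, hu, hv⟩
      exact ⟨u, v, hl, Set.mem_biUnion hj hu, Set.mem_biUnion hj hv⟩

lemma numForests_image (σV : Equiv.Perm V) (σE : Equiv.Perm E)
    (hσ : ∀ e u v, G.IsLink (σE e) (σV u) (σV v) ↔ G.IsLink e u v) (S : Set E) :
    G.numForests (σE '' S) = G.numForests S := by
  let φ : (V →₀ ZMod 2) ≃ₗ[ZMod 2] (V →₀ ZMod 2) := Finsupp.domLCongr σV
  have hb : ∀ e, G.bdry (σE e) = φ (G.bdry e) := by
    intro e
    by_cases hex : ∃ p : V × V, G.IsLink e p.1 p.2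
    · obtain ⟨⟨u, v⟩, hl⟩ := hex
      rw [hl.bdry_eq, ((hσ e u v).2 hl).bdry_eq]
      simp only [φ, map_add, Finsupp.domLCongr_single]
    · rw [bdry_eq_zero hex, map_zero, bdry_eq_zero]
      rintro ⟨⟨u, v⟩, hl⟩
      refine hex ⟨(σV.symm u, σV.symm v), (hσ _ _ _).1 ?_⟩
      simpa using hl
  have himg : ∀ F : Set E, G.bdry '' (σE '' F) = φ '' (G.bdry '' F) := fun F => by
    rw [Set.image_image, Set.image_image]
    exact Set.image_congr fun e _ => hb e
  have hind : ∀ F : Set E, LinearIndepOn (ZMod 2) G.bdry (σE '' F) ↔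
      LinearIndepOn (ZMod 2) G.bdry F := fun F => by
    rw [linearIndepOn_iff_notMem_span, linearIndepOn_iff_notMem_span, Set.forall_mem_image]
    refine forall₂_congr fun e _ => ?_
    rw [← Set.image_singleton, ← Set.image_sdiff σE.injective, himg, hb,
      ← LinearEquiv.coe_coe, Submodule.span_image, Submodule.mem_map_equiv]
    simp
  have hiff : ∀ F : Set E, G.IsMaxForest (σE '' S) (σE '' F) ↔ G.IsMaxForest S F := fun F => by
    constructor
    · rintro ⟨h1, h2, h3⟩
      refine ⟨(Set.image_subset_image_iff σE.injective).1 h1, (hind F).1 h2, ?_⟩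
      rw [himg, himg, ← LinearEquiv.coe_coe, Submodule.span_image, Submodule.map_coe] at h3
      exact (Set.image_subset_image_iff φ.injective).1 h3
    · rintro ⟨h1, h2, h3⟩
      refine ⟨Set.image_mono h1, (hind F).2 h2, ?_⟩
      rw [himg, himg, ← LinearEquiv.coe_coe, Submodule.span_image, Submodule.map_coe]
      exact Set.image_mono h3
  have hset : {F | G.IsMaxForest (σE '' S) F} = (Set.image σE) '' {F | G.IsMaxForest S F} := by
    ext F
    constructor
    · intro hF
      refine ⟨σE ⁻¹' F, ?_, Set.image_preimage_eq _ σE.surjective⟩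
      rw [Set.mem_ofPred_eq, ← hiff, Set.image_preimage_eq _ σE.surjective]
      exact hF
    · rintro ⟨F, hF, rfl⟩
      exact (hiff F).2 hF
  rw [numForests, hset, Set.ncard_image_of_injective _ σE.injective.image_injective, numForests]

end Graph

/-! ### The Cauchy–Binet formula -/

section CauchyBinet

variable {m n R : Type*} [Fintype m] [Fintype n] [DecidableEq n] [CommRing R]

/-- Each row of `A * B` is a combination of rows of `B`; expand the determinant by multilinearity in
the rows. -/
lemma Matrix.det_mul_eq_sum_prod_mul_det (A : Matrix n m R) (B : Matrix m n R) :
    (A * B).det = ∑ f : n → m, (∏ i, A i (f i)) * (B.submatrix f id).det := by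
  classical
  have h : (A * B) = Matrix.of fun i => ∑ e, A i e • B e := by
    ext i j
    simp [Matrix.mul_apply, Finset.sum_apply]
  rw [h]
  change Matrix.detRowAlternating.toMultilinearMap (fun i => ∑ e, A i e • B e) = _
  rw [MultilinearMap.map_sum]
  refine Finset.sum_congr rfl fun f _ => ?_
  rw [MultilinearMap.map_smul_univ, smul_eq_mul]
  rfl

/-- The Cauchy–Binet formula, where each minor occurs once for each ordering of its columns. -/
theorem Matrix.sum_det_submatrix_mul_det_submatrix (A : Matrix n m R) (B : Matrix m n R) :
    ∑ f : n → m, (A.submatrix id f).det * (B.submatrix f id).det =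
      (Fintype.card n).factorial * (A * B).det := by
  classical
  -- Reindexing `f` by `σ` permutes the rows of the minor of `B`; the resulting sign cancels the
  -- given one. Each `σ` in the Leibniz expansion of the minor of `A` thus contributes the same
  -- amount, which yields the factorial.
  have h1 : ∀ σ : Equiv.Perm n, ∑ f : n → m, (Equiv.Perm.sign σ : R) * (∏ i, A (σ i) (f i)) *
      (B.submatrix f id).det = (A * B).det := by
    intro σ
    rw [Matrix.det_mul_eq_sum_prod_mul_det]
    refine Fintype.sum_equiv (Equiv.arrowCongr σ (Equiv.refl m)) _ _ fun f => ?_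
    have h2 : (B.submatrix f id).det = Equiv.Perm.sign σ *
        (B.submatrix ((Equiv.arrowCongr σ (Equiv.refl m)) f) id).det := by
      rw [← Matrix.det_permute]
      congr 1
      ext i j
      simp [Equiv.arrowCongr]
    have h3 : ∏ i, A (σ i) (f i) = ∏ i, A i ((Equiv.arrowCongr σ (Equiv.refl m)) f i) :=
      Fintype.prod_equiv σ _ _ fun i => by simp [Equiv.arrowCongr]
    have h4 : ((Equiv.Perm.sign σ : ℤ) : R) * ((Equiv.Perm.sign σ : ℤ) : R) = 1 := by
      rw [← Int.cast_mul, Int.units_coe_mul_self, Int.cast_one]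
    rw [h2, h3]
    linear_combination (∏ i, A i ((Equiv.arrowCongr σ (Equiv.refl m)) f i)) *
      (B.submatrix ((Equiv.arrowCongr σ (Equiv.refl m)) f) id).det * h4
  calc ∑ f : n → m, (A.submatrix id f).det * (B.submatrix f id).det
      = ∑ f : n → m, ∑ σ : Equiv.Perm n, (Equiv.Perm.sign σ : R) * (∏ i, A (σ i) (f i)) *
          (B.submatrix f id).det := by
        refine Finset.sum_congr rfl fun f _ => ?_
        rw [Matrix.det_apply', Finset.sum_mul]
        rfl
    _ = ∑ _σ : Equiv.Perm n, (A * B).det := by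
        rw [Finset.sum_comm]
        exact Finset.sum_congr rfl fun σ _ => h1 σ
    _ = _ := by
        rw [Finset.sum_const, Finset.card_univ, Fintype.card_perm, nsmul_eq_mul]

end CauchyBinet

namespace Graph

/-! ### The matrix tree theorem -/

section Card

variable {α β : Type*} {H : Graph α β} {F : Set β}

/-- The boundaries of the forest together with one vertex `r` form a basis of the chains on `V(H)`.
The sum of coefficients kills boundaries but not `r`, so `r` is independent of them; every other
vertex differs from `r` by the boundary of a walk. -/
lemma IsMaxForest.ncard_add_one (hF : H.IsMaxForest E(H) F) (hc : H.IsConn) (hV : V(H).Finite)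
    (hE : E(H).Finite) : F.ncard + 1 = V(H).ncard := by
  classical
  obtain ⟨r, hr⟩ := hc.1
  have hfin : Finite F := hE.subset hF.subset
  have := Fintype.ofFinite F
  have : Finite V(H) := hV
  have := Fintype.ofFinite V(H)
  let v : Option F → (α →₀ ZMod 2) := fun o => o.elim (Finsupp.single r 1) fun e => H.bdry e
  have hrange : Set.range (v ∘ some) = H.bdry '' F := by
    rw [Set.image_eq_range]
    rfl
  have hli : LinearIndependent (ZMod 2) v := by
    rw [linearIndependent_option]
    refine ⟨hF.indep, ?_⟩
    rw [hrange]
    intro hmem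
    let φ : (α →₀ ZMod 2) →ₗ[ZMod 2] ZMod 2 := Finsupp.linearCombination (ZMod 2) fun _ => 1
    have hker : Submodule.span (ZMod 2) (H.bdry '' F) ≤ LinearMap.ker φ := by
      rw [Submodule.span_le]
      rintro _ ⟨e, he, rfl⟩
      obtain ⟨x, y, hl⟩ := exists_isLink_of_mem_edgeSet (hF.subset he)
      rw [SetLike.mem_coe, LinearMap.mem_ker, hl.bdry_eq]
      simp only [φ, map_add, Finsupp.linearCombination_single, smul_eq_mul, mul_one]
      decide
    have h0 : φ (Finsupp.single r 1) = 0 := hker hmem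
    simp [φ] at h0
  have hspan : Submodule.span (ZMod 2) (Set.range v) =
      Finsupp.supported (ZMod 2) (ZMod 2) V(H) := by
    apply le_antisymm
    · rw [Submodule.span_le]
      rintro _ ⟨o, rfl⟩
      rcases o with _ | e
      · exact Finsupp.single_mem_supported _ _ hr
      · obtain ⟨x, y, hl⟩ := exists_isLink_of_mem_edgeSet (hF.subset e.2)
        simp only [v, Option.elim, SetLike.mem_coe, hl.bdry_eq]
        exact Submodule.add_mem _ (Finsupp.single_mem_supported _ _ hl.left_mem)
          (Finsupp.single_mem_supported _ _ hl.right_mem)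
    · rw [Finsupp.supported_eq_span_single, Submodule.span_le]
      rintro _ ⟨x, hx, rfl⟩
      have h1 : H.JoinedBy F r x := by
        rw [hF.joinedBy_iff]
        exact (joined_iff_joinedBy le_rfl r x).1 (hc.2 r hr x hx)
      rw [Graph.joinedBy_iff, ← hrange] at h1
      have h2 : (Finsupp.single r 1 + Finsupp.single x 1 : α →₀ ZMod 2) ∈
          Submodule.span (ZMod 2) (Set.range v) :=
        Submodule.span_mono (Set.range_comp_subset_range _ _) h1
      have h3 : (Finsupp.single r 1 : α →₀ ZMod 2) ∈ Submodule.span (ZMod 2) (Set.range v) :=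
        Submodule.subset_span ⟨none, rfl⟩
      have h4 := Submodule.sub_mem _ h2 h3
      simpa using h4
  have h1 := finrank_span_eq_card hli
  rw [hspan, (Finsupp.supportedEquivFinsupp (M := ZMod 2) (R := ZMod 2) V(H)).finrank_eq,
    Module.finrank_finsupp_self, Fintype.card_option] at h1
  rw [← Nat.card_coe_set_eq, ← Nat.card_coe_set_eq, Nat.card_eq_fintype_card,
    Nat.card_eq_fintype_card, h1]

/-- A connecting set contains a maximal forest, which already has the full number of edges and
therefore exhausts the set. -/
lemma isMaxForest_iff_ncard (hc : H.IsConn) (hV : V(H).Finite) (hE : E(H).Finite)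
    (hF : F ⊆ E(H)) : H.IsMaxForest E(H) F ↔
      F.ncard + 1 = V(H).ncard ∧ ∀ u ∈ V(H), ∀ v ∈ V(H), H.JoinedBy F u v := by
  constructor
  · intro h
    refine ⟨h.ncard_add_one hc hV hE, fun u hu v hv => ?_⟩
    rw [h.joinedBy_iff]
    exact (joined_iff_joinedBy le_rfl u v).1 (hc.2 u hu v hv)
  · rintro ⟨h1, h2⟩
    obtain ⟨B, hB, -⟩ := exists_isMaxForest_of_subset (G := H) (S := F)
      (linearIndepOn_empty (ZMod 2) H.bdry) (Set.empty_subset F)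
    have hB' : H.IsMaxForest E(H) B := by
      refine ⟨hB.subset.trans hF, hB.indep, ?_⟩
      rintro _ ⟨e, he, rfl⟩
      obtain ⟨u, v, hl⟩ := exists_isLink_of_mem_edgeSet he
      rw [hl.bdry_eq, SetLike.mem_coe, ← joinedBy_iff, hB.joinedBy_iff]
      exact h2 u hl.left_mem v hl.right_mem
    have h3 := hB'.ncard_add_one hc hV hE
    have h4 : B = F := Set.eq_of_subset_of_ncard_le hB.subset (by omega) (hE.subset hF)
    exact h4 ▸ hB'

end Card

section MatrixTree

variable {α β V E : Type*}

/-- The boundary matrix of a graph whose edges have been oriented, with an additional column of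
ones. -/
def augIncidence [DecidableEq V] (s t : E → V) : Matrix V (Option E) ℤ :=
  Matrix.of fun v o => o.elim 1 fun e => (if s e = v then 1 else 0) - (if t e = v then 1 else 0)

/-- The Laplacian matrix of a graph whose edges have been oriented. -/
def orientedLaplacian [Fintype E] [DecidableEq V] (s t : E → V) : Matrix V V ℤ :=
  Matrix.of fun u v => ∑ e, ((if s e = u then 1 else 0) - (if t e = u then 1 else 0)) *
    ((if s e = v then 1 else 0) - (if t e = v then 1 else 0))

lemma augIncidence_mul_transpose [Fintype E] [DecidableEq V] (s t : E → V) :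
    augIncidence s t * (augIncidence s t).transpose =
      orientedLaplacian s t + Matrix.of fun _ _ => 1 := by
  ext u v
  simp [augIncidence, orientedLaplacian, Matrix.mul_apply, Fintype.sum_option, add_comm]

variable {H : Graph α β} {s t : E → V} {ι : V → α} {ε : E → β}

lemma eq_of_joinedBy {M : Type*} (hι : Function.Injective ι)
    (hl : ∀ e, H.IsLink (ε e) (ι (s e)) (ι (t e))) {F : Set E}
    (x : V → M) (hx : ∀ e ∈ F, x (s e) = x (t e)) {u v : V}
    (h : H.JoinedBy (ε '' F) (ι u) (ι v)) : x u = x v := by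
  have key : ∀ y, H.JoinedBy (ε '' F) (ι u) y → ∃ w, ι w = y ∧ x u = x w := by
    intro y hy
    induction hy with
    | refl => exact ⟨u, rfl, rfl⟩
    | tail _ hstep ih =>
      obtain ⟨w, rfl, hw⟩ := ih
      obtain ⟨_, ⟨e, he, rfl⟩, hle⟩ := hstep
      rcases (hl e).eq_and_eq_or_eq_and_eq hle with ⟨h1, h2⟩ | ⟨h1, h2⟩
      · exact ⟨t e, h2, by rw [hw, ← hι h1, hx e he]⟩
      · exact ⟨s e, h1, by rw [hw, ← hι h2, hx e he]⟩
  obtain ⟨w, hw, hxw⟩ := key _ h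
  rw [hxw, hι hw]

/-- View the determinant as a linear functional `φ` of the column of ones. It vanishes on the edge
columns, so by connectedness it takes the same value on all unit vectors, and the determinant is
`|V|` times that value. The value is a unit, because the edge columns and one unit vector generate
the integer lattice. -/
lemma det_augIncidence_sq_of_joinedBy [Fintype V] [DecidableEq V] (hι : Function.Injective ι)
    (hl : ∀ e, H.IsLink (ε e) (ι (s e)) (ι (t e))) {f : V → Option E}
    (hnone : none ∈ Set.range f)
    (hj : ∀ u v, H.JoinedBy (ε '' {e | some e ∈ Set.range f}) (ι u) (ι v)) :
    ((augIncidence s t).submatrix id f).det ^ 2 = (Fintype.card V : ℤ) ^ 2 := by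
  obtain ⟨r, hr⟩ := hnone
  set C := (augIncidence s t).submatrix id f with hC
  let φ : (V → ℤ) →ₗ[ℤ] ℤ :=
    { toFun := fun u => (C.updateCol r u).det
      map_add' := fun u v => Matrix.det_updateCol_add C r u v
      map_smul' := fun c u => Matrix.det_updateCol_smul C r c u }
  have hcol : ∀ w, w ≠ r → φ (fun v => C v w) = 0 := fun w hw => by
    change (C.updateCol r (C.col w)).det = 0
    exact Matrix.det_updateCol_eq_zero hw
  have hφe : ∀ e ∈ {e | some e ∈ Set.range f}, φ (Pi.single (s e) 1) = φ (Pi.single (t e) 1) := by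
    rintro e ⟨w, hw⟩
    have hwr : w ≠ r := by
      rintro rfl
      rw [hw] at hr
      exact Option.some_ne_none e hr
    have h1 := hcol w hwr
    have h2 : (fun v => C v w) = Pi.single (s e) 1 - Pi.single (t e) 1 := by
      ext v
      simp [hC, augIncidence, hw, Pi.single_apply, eq_comm]
    rw [h2, map_sub] at h1
    exact sub_eq_zero.1 h1
  have hφ : ∀ u v, φ (Pi.single u 1) = φ (Pi.single v 1) := fun u v =>
    eq_of_joinedBy hι hl (fun w => φ (Pi.single w 1)) hφe (hj u v)
  have hφone : φ (fun _ => 1) = Fintype.card V * φ (Pi.single r 1) := by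
    have h1 : (fun _ => 1 : V → ℤ) = ∑ v, Pi.single v 1 := by
      ext w
      simp [Finset.sum_apply, Pi.single_apply]
    rw [h1, map_sum, Finset.sum_congr rfl fun v _ => hφ v r, Finset.sum_const, Finset.card_univ,
      nsmul_eq_mul]
  have hdet : C.det = φ (fun _ => 1) := by
    change _ = (C.updateCol r _).det
    congr 1
    ext u v
    rw [Matrix.updateCol_apply]
    split_ifs with h
    · rw [hC, h]
      simp [augIncidence, hr]
    · rfl
  have hunit : IsUnit (φ (Pi.single r 1)) := by
    have hspan : ∀ v, Pi.single v 1 ∈ LinearMap.range (C.updateCol r (Pi.single r 1)).mulVecLin := by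
      set R := LinearMap.range (C.updateCol r (Pi.single r 1)).mulVecLin
      have hmem : ∀ w, (fun v => C.updateCol r (Pi.single r 1) v w) ∈ R := fun w =>
        ⟨Pi.single w 1, by ext v; simp⟩
      have hr' : (Pi.single r 1 : V → ℤ) ∈ R := by
        have := hmem r
        simpa using this
      have hx : ∀ e ∈ {e | some e ∈ Set.range f},
          R.mkQ (Pi.single (s e) 1) = R.mkQ (Pi.single (t e) 1) := by
        rintro e ⟨w, hw⟩
        have hwr : w ≠ r := by
          rintro rfl
          rw [hw] at hr
          exact Option.some_ne_none e hr
        rw [← sub_eq_zero, ← map_sub, ← LinearMap.mem_ker, Submodule.ker_mkQ]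
        convert! hmem w using 1
        ext v
        simp [hC, augIncidence, hw, Pi.single_apply, eq_comm, hwr.symm]
      intro v
      have hq := eq_of_joinedBy hι hl (fun w => R.mkQ (Pi.single w 1)) hx (hj r v)
      rw [← Submodule.ker_mkQ R, LinearMap.mem_ker, ← hq, ← LinearMap.mem_ker,
        Submodule.ker_mkQ]
      exact hr'
    choose q hq using hspan
    have hmul : C.updateCol r (Pi.single r 1) * (Matrix.of q).transpose = 1 := by
      ext u v
      have := congrFun (hq v) u
      rw [Matrix.mulVecLin_apply, Matrix.mulVec, dotProduct] at this
      rw [Matrix.mul_apply, Matrix.one_apply]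
      simpa [Pi.single_apply] using this
    refine IsUnit.of_mul_eq_one (Matrix.of q).transpose.det ?_
    change (C.updateCol r (Pi.single r 1)).det * _ = 1
    rw [← Matrix.det_mul, hmul, Matrix.det_one]
  rw [hdet, hφone, mul_pow]
  rcases Int.isUnit_iff.1 hunit with h | h <;> rw [h] <;> ring

/-- For a component `C` that misses some vertex, the vector equal to `|Cᶜ|` on `C` and to `-|C|`
elsewhere is nonzero and orthogonal to all columns: it is constant along the chosen edges and has
total zero. -/
lemma det_augIncidence_eq_zero [Fintype V] [DecidableEq V]
    (hl : ∀ e, H.IsLink (ε e) (ι (s e)) (ι (t e))) {f : V → Option E}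
    (hj : ¬ ∀ u v, H.JoinedBy (ε '' {e | some e ∈ Set.range f}) (ι u) (ι v)) :
    ((augIncidence s t).submatrix id f).det = 0 := by
  classical
  push Not at hj
  obtain ⟨a, b, hab⟩ := hj
  set F := {e | some e ∈ Set.range f}
  let C : Finset V := Finset.univ.filter fun v => H.JoinedBy (ε '' F) (ι a) (ι v)
  have ha : a ∈ C := Finset.mem_filter.2 ⟨Finset.mem_univ a, Relation.ReflTransGen.refl⟩
  have hb : b ∈ Cᶜ := by simpa [C] using hab
  have hiff : ∀ e ∈ F, (s e ∈ C ↔ t e ∈ C) := by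
    intro e he
    simp only [C, Finset.mem_filter, Finset.mem_univ, true_and]
    exact ⟨fun h => h.tail ⟨ε e, ⟨e, he, rfl⟩, hl e⟩,
      fun h => h.tail ⟨ε e, ⟨e, he, rfl⟩, (hl e).symm⟩⟩
  rw [← Matrix.exists_vecMul_eq_zero_iff]
  refine ⟨fun v => if v ∈ C then (Cᶜ.card : ℤ) else -C.card, fun h => ?_, ?_⟩
  · have := congrFun h a
    simp only [ha, if_true, Pi.zero_apply, Nat.cast_eq_zero, Finset.card_eq_zero] at this
    rw [this] at hb
    exact absurd hb (Finset.notMem_empty b)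
  · ext w
    simp only [Matrix.vecMul, dotProduct, Matrix.submatrix_apply, id, Pi.zero_apply]
    rcases hw : f w with _ | e
    · have h1 : ∑ v, (if v ∈ C then (Cᶜ.card : ℤ) else -C.card) = 0 := by
        rw [← Finset.sum_add_sum_compl C, Finset.sum_congr rfl fun v hv => if_pos hv,
          Finset.sum_congr (s₁ := Cᶜ) rfl fun v hv => if_neg (Finset.mem_compl.1 hv),
          Finset.sum_const, Finset.sum_const, nsmul_eq_mul, nsmul_eq_mul]
        ring
      simpa [augIncidence] using h1
    · have h1 := hiff e ⟨w, hw⟩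
      simp [augIncidence, mul_sub, Finset.sum_sub_distrib, h1]

lemma card_injective_image_eq [Fintype V] [DecidableEq V] [Fintype E] [DecidableEq (Option E)] (T : Finset (Option E))
    (hT : T.card = Fintype.card V) :
    (Finset.univ.filter fun f : V → Option E =>
      Function.Injective f ∧ Finset.univ.image f = T).card = (Fintype.card V).factorial := by
  have hc : Fintype.card V = Fintype.card T := by rw [Fintype.card_coe, hT]
  rw [← Fintype.card_equiv (Fintype.equivOfCardEq hc), ← Finset.card_univ]
  refine (Finset.card_bij (fun g _ => fun v => (g v : Option E)) ?_ ?_ ?_).symm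
  · intro g _
    simp only [Finset.mem_filter, Finset.mem_univ, true_and]
    refine ⟨Subtype.val_injective.comp g.injective, ?_⟩
    ext o
    simp only [Finset.mem_image, Finset.mem_univ, true_and]
    constructor
    · rintro ⟨v, rfl⟩
      exact (g v).2
    · intro ho
      exact ⟨g.symm ⟨o, ho⟩, by simp⟩
  · intro g _ g' _ h
    exact Equiv.ext fun v => Subtype.ext (congrFun h v)
  · intro f hf
    simp only [Finset.mem_filter, Finset.mem_univ, true_and] at hf
    have hmem : ∀ v, f v ∈ T := fun v => hf.2 ▸ Finset.mem_image_of_mem f (Finset.mem_univ v)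
    refine ⟨Equiv.ofBijective (fun v => (⟨f v, hmem v⟩ : T))
      ((Fintype.bijective_iff_injective_and_card _).2 ⟨fun v w h => hf.1 (by simpa using h), hc⟩),
      Finset.mem_univ _, rfl⟩

/-- The matrix tree theorem. -/
theorem det_orientedLaplacian_add_one [Fintype V] [DecidableEq V] [Fintype E]
    (hι : Function.Injective ι) (hιr : Set.range ι = V(H))
    (hε : Function.Injective ε) (hεr : Set.range ε = E(H))
    (hl : ∀ e, H.IsLink (ε e) (ι (s e)) (ι (t e))) (hc : H.IsConn) :
    (orientedLaplacian s t + Matrix.of fun _ _ => 1).det =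
      (Fintype.card V : ℤ) ^ 2 * H.numSpanningTrees := by
  classical
  have hVfin : V(H).Finite := hιr ▸ Set.finite_range ι
  have hEfin : E(H).Finite := hεr ▸ Set.finite_range ε
  have hVcard : V(H).ncard = Fintype.card V := by
    rw [← hιr, ← Set.image_univ, Set.ncard_image_of_injective _ hι, Set.ncard_univ,
      Nat.card_eq_fintype_card]
  let good : Finset (Option E) → Prop := fun T =>
    none ∈ T ∧ ∀ u v, H.JoinedBy (ε '' {e | some e ∈ T}) (ι u) (ι v)
  let 𝒯 : Finset (Finset (Option E)) :=
    Finset.univ.filter fun T => T.card = Fintype.card V ∧ good T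
  have hrange : ∀ (f : V → Option E) (o : Option E), o ∈ Set.range f ↔ o ∈ Finset.univ.image f :=
    fun f o => by simp
  -- A spanning tree corresponds to the set of columns formed by its edges and the column of ones,
  -- which has exactly `|V|` elements.
  have hcount : H.numSpanningTrees = 𝒯.card := by
    rw [numSpanningTrees_eq le_rfl hc, numForests, ← Set.ncard_coe_finset]
    refine Set.ncard_congr (fun F _ => insert none ((Finset.univ.filter fun e => ε e ∈ F).map
      Function.Embedding.some)) ?_ ?_ ?_
    · intro F hF
      have hF' := (isMaxForest_iff_ncard hc hVfin hEfin hF.subset).1 hF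
      have himg : F = ε '' {e | ε e ∈ F} := by
        rw [show {e | ε e ∈ F} = ε ⁻¹' F from rfl, Set.image_preimage_eq_inter_range, hεr,
          Set.inter_eq_left.2 hF.subset]
      simp only [𝒯, good, Finset.coe_filter, Finset.mem_univ, true_and, Set.mem_ofPred_eq]
      refine ⟨?_, Finset.mem_insert_self _ _, fun u v => ?_⟩
      · rw [Finset.card_insert_of_notMem (by simp), Finset.card_map, ← hVcard, ← hF'.1]
        conv_rhs => rw [himg]
        rw [Set.ncard_image_of_injective _ hε, ← Set.ncard_coe_finset]
        simp
      · have h1 := hF'.2 (ι u) (hιr ▸ ⟨u, rfl⟩) (ι v) (hιr ▸ ⟨v, rfl⟩)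
        rw [himg] at h1
        simpa using h1
    · intro F F' hF hF' h
      have key : ∀ e, ε e ∈ F ↔ ε e ∈ F' := fun e => by
        have := congrArg (fun T => some e ∈ T) h
        simpa using this
      ext x
      constructor
      · intro hx
        obtain ⟨e, rfl⟩ : x ∈ Set.range ε := hεr ▸ hF.subset hx
        exact (key e).1 hx
      · intro hx
        obtain ⟨e, rfl⟩ : x ∈ Set.range ε := hεr ▸ hF'.subset hx
        exact (key e).2 hx
    · intro T hT
      simp only [𝒯, good, Finset.coe_filter, Finset.mem_univ, true_and, Set.mem_ofPred_eq] at hT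
      obtain ⟨h1, h2, h3⟩ := hT
      have hTeq : insert none ((Finset.univ.filter fun e => ε e ∈ ε '' {e | some e ∈ T}).map
          Function.Embedding.some) = T := by
        ext o
        rcases o with _ | e
        · simpa using h2
        · simp [hε.eq_iff]
      refine ⟨ε '' {e | some e ∈ T}, ?_, hTeq⟩
      refine (isMaxForest_iff_ncard hc hVfin hEfin ?_).2 ⟨?_, ?_⟩
      · rintro _ ⟨e, -, rfl⟩
        exact hεr ▸ ⟨e, rfl⟩
      · rw [hVcard, ← h1]
        conv_rhs => rw [← hTeq]
        rw [Finset.card_insert_of_notMem (by simp), Finset.card_map,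
          Set.ncard_image_of_injective _ hε, ← Set.ncard_coe_finset]
        simp [hε.eq_iff]
      · intro u hu v hv
        obtain ⟨u, rfl⟩ : u ∈ Set.range ι := hιr ▸ hu
        obtain ⟨v, rfl⟩ : v ∈ Set.range ι := hιr ▸ hv
        exact h3 u v
  have hterm : ∀ f : V → Option E, ((augIncidence s t).submatrix id f).det *
      ((augIncidence s t).transpose.submatrix f id).det =
      if Function.Injective f ∧ good (Finset.univ.image f) then (Fintype.card V : ℤ) ^ 2
        else 0 := by
    intro f
    rw [← Matrix.transpose_submatrix, Matrix.det_transpose, ← pow_two]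
    split_ifs with h
    · refine det_augIncidence_sq_of_joinedBy hι hl ((hrange f _).2 h.2.1) ?_
      simp only [hrange]
      exact h.2.2
    · rw [sq_eq_zero_iff]
      by_cases hinj : Function.Injective f
      · by_cases hj : ∀ u v, H.JoinedBy (ε '' {e | some e ∈ Set.range f}) (ι u) (ι v)
        · have hnone : none ∉ Finset.univ.image f := fun hn =>
            h ⟨hinj, hn, by simpa only [hrange] using hj⟩
          -- Without the column of ones every column is an edge column with zero sum, so the
          -- all-ones vector is a left null vector.
          rw [← Matrix.exists_vecMul_eq_zero_iff]
          have hne : Nonempty V := by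
            obtain ⟨x, hx⟩ := hc.1
            rw [← hιr] at hx
            exact ⟨hx.choose⟩
          refine ⟨fun _ => 1, fun h0 => ?_, ?_⟩
          · exact one_ne_zero (congrFun h0 (Classical.arbitrary V))
          · ext w
            simp only [Matrix.vecMul, dotProduct, Matrix.submatrix_apply, id, Pi.zero_apply,
              one_mul]
            rcases hw : f w with _ | e
            · exact absurd (Finset.mem_image.2 ⟨w, Finset.mem_univ _, hw⟩) hnone
            · simp [augIncidence]
        · exact det_augIncidence_eq_zero hl hj
      · obtain ⟨u, v, huv, hne⟩ := Function.not_injective_iff.1 hinj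
        exact Matrix.det_zero_of_column_eq hne fun w => by simp [huv]
  -- Every good set of columns arises from `|V|!` orderings, which matches the factorial in the
  -- Cauchy–Binet formula.
  have hfib : (Finset.univ.filter fun f : V → Option E =>
      Function.Injective f ∧ good (Finset.univ.image f)).card =
      (Fintype.card V).factorial * 𝒯.card := by
    rw [Finset.card_eq_sum_card_fiberwise (f := fun f => Finset.univ.image f) (t := 𝒯)]
    · rw [Finset.sum_congr rfl (g := fun _ => (Fintype.card V).factorial), Finset.sum_const,
        smul_eq_mul, mul_comm]
      intro T hT
      simp only [𝒯, Finset.mem_filter, Finset.mem_univ, true_and] at hT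
      rw [← card_injective_image_eq T hT.1, Finset.filter_filter]
      congr 1
      ext f
      simp only [Finset.mem_filter, Finset.mem_univ, true_and]
      constructor
      · rintro ⟨⟨h1, -⟩, h3⟩
        exact ⟨h1, h3⟩
      · rintro ⟨h1, h3⟩
        exact ⟨⟨h1, h3 ▸ hT.2⟩, h3⟩
    · intro f hf
      simp only [Finset.coe_filter, Finset.mem_univ, true_and, Set.mem_ofPred_eq] at hf
      simp only [𝒯, Finset.coe_filter, Finset.mem_univ, true_and, Set.mem_ofPred_eq]
      exact ⟨by rw [Finset.card_image_of_injective _ hf.1, Finset.card_univ], hf.2⟩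
  have hCB := Matrix.sum_det_submatrix_mul_det_submatrix (augIncidence s t)
    (augIncidence s t).transpose
  rw [Finset.sum_congr rfl fun f _ => hterm f, ← Finset.sum_filter, Finset.sum_const, hfib,
    augIncidence_mul_transpose, nsmul_eq_mul] at hCB
  have hne : ((Fintype.card V).factorial : ℤ) ≠ 0 := by
    exact_mod_cast Nat.factorial_ne_zero _
  rw [hcount]
  refine mul_left_cancel₀ hne ?_
  rw [← hCB]
  push_cast
  ring

end MatrixTree

end Graph

/-! ### Laplacians of embedded graphs -/

lemma PermCycle.of_eq_of_iff {D : Type*} {p : Equiv.Perm D} {d d' : D} :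
    PermCycle.of p d = PermCycle.of p d' ↔ p.SameCycle d d' := Quotient.eq

lemma PermCycle.of_apply {D : Type*} (p : Equiv.Perm D) (d : D) :
    PermCycle.of p (p d) = PermCycle.of p d :=
  of_eq_of_iff.2 (Equiv.Perm.sameCycle_apply_left.2 (Equiv.Perm.SameCycle.refl p d))

lemma PermCycle.of_surjective {D : Type*} (p : Equiv.Perm D) (c : PermCycle p) :
    ∃ d, PermCycle.of p d = c := Quotient.exists_rep c

namespace SurfaceGraph

variable {D : Type*} {M : SurfaceGraph D}

lemma start_rot (M : SurfaceGraph D) (d : D) : M.start (M.rot d) = M.start d :=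
  PermCycle.of_apply M.rot d

lemma start_rot_symm (M : SurfaceGraph D) (d : D) : M.start (M.rot.symm d) = M.start d := by
  rw [← M.start_rot, Equiv.apply_symm_apply]

lemma isLink_induce_iff {A : Set M.Vertex} {e : M.Edge} {u v : M.Vertex} :
    (M.graph.induce A).IsLink e u v ↔
      ∃ d, M.edge d = e ∧ M.start d = u ∧ M.start (M.rev d) = v ∧ u ∈ A ∧ v ∈ A := by
  constructor
  · rintro ⟨⟨d, h1, h2, h3⟩, hu, hv⟩
    exact ⟨d, h1, h2, h3, hu, hv⟩
  · rintro ⟨d, h1, h2, h3, hu, hv⟩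
    exact ⟨⟨d, h1, h2, h3⟩, hu, hv⟩

lemma edge_mem_induce_iff {A : Set M.Vertex} {d : D} :
    M.edge d ∈ (M.graph.induce A).edgeSet ↔ M.start d ∈ A ∧ M.start (M.rev d) ∈ A := by
  constructor
  · rintro h
    obtain ⟨u, v, hl⟩ := Graph.exists_isLink_of_mem_edgeSet h
    obtain ⟨d', hd', rfl, rfl, hu, hv⟩ := isLink_induce_iff.1 hl
    rcases (M.edge_eq_iff _ _).1 hd' with rfl | rfl
    · exact ⟨hu, hv⟩
    · rw [M.rev_rev]
      exact ⟨hv, hu⟩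
  · rintro ⟨hu, hv⟩
    exact (isLink_induce_iff.2 ⟨d, rfl, rfl, rfl, hu, hv⟩).edge_mem

/-- A dart representing an edge. -/
noncomputable def edgeDart (M : SurfaceGraph D) (e : M.Edge) : D := Quotient.out e

lemma edge_edgeDart (e : M.Edge) : M.edge (M.edgeDart e) = e := Quotient.out_eq e

lemma eq_edgeDart_or (d : D) : d = M.edgeDart (M.edge d) ∨ d = M.rev (M.edgeDart (M.edge d)) :=
  (M.edge_eq_iff _ _).1 (edge_edgeDart _)

lemma edge_rev (d : D) : M.edge (M.rev d) = M.edge d := PermCycle.of_apply M.rev d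

open Classical in
/-- The Laplacian matrix of a finite induced subgraph with vertices indexed by `V`, as a sum over
the darts `I` of the subgraph. -/
noncomputable def dartLaplacian (M : SurfaceGraph D) {V : Type*} (ι : V → M.Vertex)
    (I : Finset D) : Matrix V V ℤ :=
  Matrix.of fun u v => ∑ d ∈ I, (if M.start d = ι u then 1 else 0) *
    ((if M.start d = ι v then 1 else 0) - (if M.start (M.rev d) = ι v then 1 else 0))

/-- Orient each edge by its chosen dart. The terms of the two darts of an edge add up to the
rank-one term of that edge in `orientedLaplacian`; loops contribute zero to both. -/
theorem det_dartLaplacian_add_one {V : Type*} [Fintype V] [DecidableEq V] {A : Set M.Vertex}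
    {ι : V → M.Vertex} (hι : Function.Injective ι) (hιr : Set.range ι = A) {I : Finset D}
    (hI : ∀ d, d ∈ I ↔ M.start d ∈ A ∧ M.start (M.rev d) ∈ A)
    (hc : (M.graph.induce A).IsConn) :
    (M.dartLaplacian ι I + Matrix.of fun _ _ => 1).det =
      (Fintype.card V : ℤ) ^ 2 * (M.graph.induce A).numSpanningTrees := by
  classical
  let E := {e // e ∈ (M.graph.induce A).edgeSet}
  have hE : ∀ e : E, M.edgeDart e ∈ I := fun e => by
    rw [hI, ← edge_mem_induce_iff, edge_edgeDart]
    exact e.2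
  have hEr : ∀ e : E, M.rev (M.edgeDart e) ∈ I := fun e => by
    rw [hI, ← edge_mem_induce_iff, edge_rev, edge_edgeDart]
    exact e.2
  have : Finite E := by
    refine Finite.of_injective (fun e : E => (⟨M.edgeDart e, hE e⟩ : I)) fun e e' h => ?_
    have h1 : M.edgeDart e = M.edgeDart e' := congrArg Subtype.val h
    refine Subtype.ext ?_
    rw [← edge_edgeDart (e : M.Edge), h1, edge_edgeDart]
  have := Fintype.ofFinite E
  have hs : ∀ e : E, ∃ u, ι u = M.start (M.edgeDart e) := fun e =>
    (hιr ▸ ((hI _).1 (hE e)).1 : M.start (M.edgeDart e) ∈ Set.range ι)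
  have ht : ∀ e : E, ∃ u, ι u = M.start (M.rev (M.edgeDart e)) := fun e =>
    (hιr ▸ ((hI _).1 (hE e)).2 : M.start (M.rev (M.edgeDart e)) ∈ Set.range ι)
  choose s hs using hs
  choose t ht using ht
  -- Darts of the subgraph are edges with a direction. Loops are no exception, because a dart always
  -- differs from its reverse.
  have hbij : Function.Bijective (fun p : E × Bool =>
      if p.2 then (⟨M.edgeDart p.1, hE p.1⟩ : I) else ⟨M.rev (M.edgeDart p.1), hEr p.1⟩) := by
    constructor
    · rintro ⟨e, b⟩ ⟨e', b'⟩ h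
      have hed : e = e' := by
        have := congrArg (fun d : I => M.edge d) h
        refine Subtype.ext ?_
        rcases b <;> rcases b' <;> simpa [edge_rev, edge_edgeDart] using this
      subst hed
      have hne := M.rev_ne (M.edgeDart e)
      rcases b <;> rcases b'
      · rfl
      · exact absurd (congrArg Subtype.val h) hne
      · exact absurd (congrArg Subtype.val h).symm hne
      · rfl
    · rintro ⟨d, hd⟩
      have he : M.edge d ∈ (M.graph.induce A).edgeSet := edge_mem_induce_iff.2 ((hI d).1 hd)
      rcases eq_edgeDart_or (M := M) d with h | h
      · exact ⟨(⟨M.edge d, he⟩, true), Subtype.ext h.symm⟩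
      · exact ⟨(⟨M.edge d, he⟩, false), Subtype.ext h.symm⟩
  have hL : M.dartLaplacian ι I = Graph.orientedLaplacian s t := by
    ext u v
    rw [dartLaplacian, Graph.orientedLaplacian, Matrix.of_apply, Matrix.of_apply,
      ← Finset.sum_coe_sort, ← Fintype.sum_bijective _ hbij _ _ fun _ => rfl,
      Fintype.sum_prod_type]
    refine Finset.sum_congr rfl fun e _ => ?_
    simp only [Fintype.sum_bool, if_true, Bool.false_eq_true, if_false, M.rev_rev, ← hs, ← ht,
      hι.eq_iff]
    ring
  rw [hL]
  refine Graph.det_orientedLaplacian_add_one (ε := fun e : E => (e : M.Edge)) hι hιr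
    Subtype.val_injective Subtype.range_val (fun e => ?_) hc
  refine isLink_induce_iff.2 ⟨M.edgeDart e, edge_edgeDart _, (hs e).symm, (ht e).symm, ?_, ?_⟩
  · exact hιr ▸ ⟨_, rfl⟩
  · exact hιr ▸ ⟨_, rfl⟩

end SurfaceGraph

/-! ### The truncation -/

namespace BiperiodicGraph

variable {D : Type*} {P : BiperiodicGraph D}

/-- The vertex of the truncation that lies on a dart. -/
def truncVertex (P : BiperiodicGraph D) (d : D) : P.truncation.Vertex :=
  P.truncation.start (d, 0)

lemma truncation_rev_zero (d : D) : P.truncation.rev (d, 0) = (P.rev d, 0) := rfl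

lemma truncation_rev_one (d : D) : P.truncation.rev (d, 1) = (P.rot d, 2) := rfl

lemma truncation_rev_two (d : D) : P.truncation.rev (d, 2) = (P.rot.symm d, 1) := rfl

lemma truncation_start (d : D) (i : Fin 3) : P.truncation.start (d, i) = P.truncVertex d := by
  have h : ∀ i : Fin 3, P.truncation.start (d, i + 1) = P.truncation.start (d, i) := fun i =>
    P.truncation.start_rot (d, i)
  have h1 := h 0
  have h2 := h 1
  fin_cases i
  · rfl
  · exact h1
  · exact h2.trans h1

lemma truncVertex_injective : Function.Injective P.truncVertex := by
  intro d d' h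
  obtain ⟨k, hk⟩ := PermCycle.of_eq_of_iff.1 h
  have h2 : ∀ (x : D × Fin 3), ((P.truncation.rot ^ k) x).1 = x.1 := by
    have hn : ∀ (n : ℕ) (x : D × Fin 3), ((P.truncation.rot ^ n) x).1 = x.1 := by
      intro n
      induction n with
      | zero => exact fun x => rfl
      | succ n ih =>
        intro x
        rw [pow_succ, Equiv.Perm.mul_apply, ih]
        rfl
    intro x
    obtain ⟨n, rfl | rfl⟩ := k.eq_nat_or_neg
    · exact hn n x
    · have := hn n ((P.truncation.rot ^ (-(n : ℤ))) x)
      rw [← zpow_natCast, ← Equiv.Perm.mul_apply, ← zpow_add, add_neg_cancel, zpow_zero] at this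
      exact this.symm
  have h3 := h2 (d, 0)
  rw [hk] at h3
  exact h3.symm

lemma truncVertex_surjective : Function.Surjective P.truncVertex := by
  intro v
  obtain ⟨⟨d, i⟩, rfl⟩ := PermCycle.of_surjective _ v
  exact ⟨d, (truncation_start d i).symm⟩

lemma IsThreeRegular.rot_ne (h3 : P.IsThreeRegular) (d : D) : P.rot d ≠ d := by
  intro h
  have h1 := h3 (P.start d)
  have h2 : ∀ e : {e // PermCycle.of P.rot e = P.start d}, e = ⟨d, rfl⟩ := by
    rintro ⟨e, he⟩
    obtain ⟨k, hk⟩ := PermCycle.of_eq_of_iff.1 he.symm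
    exact Subtype.ext (hk.symm.trans (Equiv.Perm.zpow_apply_eq_self_of_apply_eq_self h k))
  have : Subsingleton {e // PermCycle.of P.rot e = P.start d} :=
    ⟨fun a b => (h2 a).trans (h2 b).symm⟩
  rw [PermCycle.length, Nat.card_of_subsingleton ⟨d, rfl⟩] at h1
  omega

/-- Regularity only counts the points of a cycle. If `rot` had period 1 or 2 at `d`, the cycle would
have at most two points; otherwise, if the third iterate did not return to `d`, there would be four
distinct points. -/
lemma IsThreeRegular.rot_cube (h3 : P.IsThreeRegular) (d : D) :
    P.rot (P.rot (P.rot d)) = d := by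
  have h1 := h3 (P.start d)
  rw [PermCycle.length] at h1
  have hfin : Finite {e // PermCycle.of P.rot e = P.start d} :=
    Nat.finite_of_card_ne_zero (by omega)
  have := Fintype.ofFinite {e // PermCycle.of P.rot e = P.start d}
  rw [Nat.card_eq_fintype_card] at h1
  have hs : ∀ e, PermCycle.of P.rot e = P.start d → PermCycle.of P.rot (P.rot e) = P.start d :=
    fun e he => (PermCycle.of_apply P.rot e).trans he
  by_contra hne
  have hd1 := h3.rot_ne d
  have hd2 : P.rot (P.rot d) ≠ d := by
    intro h2
    have hall : ∀ n : ℕ, (P.rot ^ n) d = d ∨ (P.rot ^ n) d = P.rot d := by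
      intro n
      induction n with
      | zero => exact Or.inl rfl
      | succ n ih =>
        rw [pow_succ', Equiv.Perm.mul_apply]
        rcases ih with h | h <;> rw [h]
        · exact Or.inr rfl
        · exact Or.inl h2
    have hcard : Fintype.card {e // PermCycle.of P.rot e = P.start d} ≤ 2 := by
      classical
      rw [← Finset.card_univ]
      refine (Finset.card_le_card (t := {⟨d, rfl⟩, ⟨P.rot d, hs d rfl⟩}) ?_).trans
        Finset.card_le_two
      rintro ⟨e, he⟩ -
      obtain ⟨n, hn⟩ : ∃ n : ℕ, (P.rot ^ n) d = e := by
        obtain ⟨k, hk⟩ := PermCycle.of_eq_of_iff.1 he.symm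
        obtain ⟨n, rfl | rfl⟩ := k.eq_nat_or_neg
        · exact ⟨n, hk⟩
        · refine ⟨n, ?_⟩
          rw [← hk]
          have h4 : (P.rot ^ (2 * n)) d = d := by
            rw [pow_mul]
            exact Equiv.Perm.pow_apply_eq_self_of_apply_eq_self (by rw [pow_two]; exact h2) n
          conv_rhs => rw [← h4, ← zpow_natCast, ← Equiv.Perm.mul_apply, ← zpow_add]
          rw [← zpow_natCast]
          congr 2
          push_cast
          ring
      rw [Finset.mem_insert, Finset.mem_singleton]
      rcases hall n with h | h
      · exact Or.inl (Subtype.ext (hn.symm.trans h))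
      · exact Or.inr (Subtype.ext (hn.symm.trans h))
    omega
  have hcard : 4 ≤ Fintype.card {e // PermCycle.of P.rot e = P.start d} := by
    classical
    have := Fintype.card_le_of_injective
      (α := Fin 4) (β := {e // PermCycle.of P.rot e = P.start d})
      (![⟨d, rfl⟩, ⟨P.rot d, hs _ rfl⟩, ⟨P.rot (P.rot d), hs _ (hs _ rfl)⟩,
        ⟨P.rot (P.rot (P.rot d)), hs _ (hs _ (hs _ rfl))⟩]) ?_
    · simpa using this
    · intro i j hij
      have hij' := congrArg Subtype.val hij
      fin_cases i <;> fin_cases j <;>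
        simp [hd1, hd2, hne, hd1.symm, hd2.symm, Ne.symm hne] at hij' ⊢
  omega

lemma IsThreeRegular.start_eq_iff (h3 : P.IsThreeRegular) (d d' : D) :
    P.start d = P.start d' ↔ d' = d ∨ d' = P.rot d ∨ d' = P.rot.symm d := by
  have hsymm : ∀ d, P.rot.symm d = P.rot (P.rot d) := fun d => by
    rw [Equiv.symm_apply_eq, h3.rot_cube]
  constructor
  · intro h
    obtain ⟨k, rfl⟩ := PermCycle.of_eq_of_iff.1 h
    have hc : ∀ k : ℤ, (P.rot ^ (3 * k)) d = d := fun k => by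
      rw [zpow_mul]
      exact Equiv.Perm.zpow_apply_eq_self_of_apply_eq_self (h3.rot_cube d) k
    obtain ⟨q, r, hr, rfl⟩ : ∃ q r : ℤ, (r = 0 ∨ r = 1 ∨ r = -1) ∧ k = r + 3 * q :=
      ⟨(k + 1) / 3, k - 3 * ((k + 1) / 3), by omega, by ring⟩
    rw [zpow_add, Equiv.Perm.mul_apply, hc]
    rcases hr with rfl | rfl | rfl
    · exact Or.inl rfl
    · exact Or.inr (Or.inl rfl)
    · exact Or.inr (Or.inr rfl)
  · rintro (rfl | rfl | rfl)
    · rfl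
    · exact (P.start_rot d).symm
    · exact (P.start_rot_symm d).symm

lemma IsThreeRegular.rot_ne_symm (h3 : P.IsThreeRegular) (d : D) : P.rot d ≠ P.rot.symm d := by
  rw [Ne, Equiv.eq_symm_apply]
  intro h
  have := h3.rot_cube d
  rw [h] at this
  exact h3.rot_ne d this

lemma IsThreeRegular.symm_ne (h3 : P.IsThreeRegular) (d : D) : P.rot.symm d ≠ d := by
  rw [Ne, Equiv.symm_apply_eq]
  exact fun h => h3.rot_ne d h.symm

lemma truncVertex_mem_image_iff {A : Set P.Vertex} {d : D} :
    P.truncVertex d ∈ P.truncVertex '' (P.start ⁻¹' A) ↔ P.start d ∈ A := by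
  rw [truncVertex_injective.mem_set_image]
  rfl

/-- Walks lift: old edges survive, and within a triangle any two darts at a vertex are adjacent. The
truncated piece contains the whole triangle of each of its vertices, even where an edge leaves `A`.
-/
lemma truncation_induce_isConn (h3 : P.IsThreeRegular) {A : Set P.Vertex}
    (hA : (P.graph.induce A).IsConn) :
    (P.truncation.graph.induce (P.truncVertex '' (P.start ⁻¹' A))).IsConn := by
  set A' := P.truncVertex '' (P.start ⁻¹' A)
  set H := P.truncation.graph.induce A'
  have hlink : ∀ d i, P.start d ∈ A → P.start (P.truncation.rev (d, i)).1 ∈ A →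
      H.IsLink (P.truncation.edge (d, i)) (P.truncVertex d)
        (P.truncVertex (P.truncation.rev (d, i)).1) := by
    intro d i hd hr
    refine SurfaceGraph.isLink_induce_iff.2 ⟨(d, i), rfl, truncation_start d i, ?_,
      truncVertex_mem_image_iff.2 hd, truncVertex_mem_image_iff.2 hr⟩
    exact truncation_start _ _
  have hrot : ∀ d, P.start d ∈ A → ∀ d', P.start d = P.start d' →
      H.Joined (P.truncVertex d) (P.truncVertex d') := by
    intro d hd d' h
    rcases (h3.start_eq_iff d d').1 h with rfl | h' | h'
    · exact .refl
    · refine Relation.ReflTransGen.single ⟨P.truncation.edge (d, 1), ?_⟩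
      have := hlink d 1 hd (by rw [truncation_rev_one, P.start_rot]; exact hd)
      rwa [truncation_rev_one, ← h'] at this
    · refine Relation.ReflTransGen.single ⟨P.truncation.edge (d, 2), ?_⟩
      have := hlink d 2 hd (by rw [truncation_rev_two, P.start_rot_symm]; exact hd)
      rwa [truncation_rev_two, ← h'] at this
  constructor
  · obtain ⟨v, hv⟩ := hA.1
    obtain ⟨d, rfl⟩ := PermCycle.of_surjective _ v
    exact ⟨P.truncVertex d, d, hv, rfl⟩
  · rintro _ ⟨d, hd, rfl⟩ _ ⟨d', hd', rfl⟩
    have key : ∀ v, (P.graph.induce A).Joined (P.start d) v → ∀ d', P.start d' = v →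
        H.Joined (P.truncVertex d) (P.truncVertex d') := by
      intro v hv
      induction hv with
      | refl => exact fun d' h => hrot d hd d' h.symm
      | tail _ hl ih =>
        intro d' hd'
        obtain ⟨e, hl⟩ := hl
        obtain ⟨x, hx, rfl, rfl, hxA, hyA⟩ := SurfaceGraph.isLink_induce_iff.1 hl
        have h1 := ih x rfl
        have h2 := hlink x 0 hxA hyA
        exact (h1.tail ⟨_, h2⟩).trans (hrot _ hyA d' hd'.symm)
    exact key _ (hA.2 _ hd _ hd') d' rfl

end BiperiodicGraph

/-! ### The determinant of the Laplacian of a truncation -/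

section TruncationDeterminant

open Matrix

variable {V X : Type*} [Fintype V] [DecidableEq V] [Fintype X] [DecidableEq X]

/-- With `J` the all-ones matrix, LJ = 0 and J² = nJ, hence L + cJ = (L + J)(1 + ((c - 1)/n) J), and
the second factor has determinant `c`. -/
lemma Matrix.det_add_smul_ones [Nonempty V] {L : Matrix V V ℝ} (h : ∀ u, ∑ v, L u v = 0) (c : ℝ) :
    (L + Matrix.of fun _ _ => c).det = c * (L + Matrix.of fun _ _ => 1).det := by
  have hn : (Fintype.card V : ℝ) ≠ 0 := by exact_mod_cast Fintype.card_ne_zero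
  have h1 : (L + Matrix.of fun _ _ => c) = (L + Matrix.of fun _ _ => 1) *
      (1 + Matrix.replicateCol Unit (fun _ : V => (c - 1) / Fintype.card V) *
        Matrix.replicateRow Unit (fun _ => (1 : ℝ))) := by
    ext u v
    rw [mul_add, mul_one, ← Matrix.mul_assoc, Matrix.add_apply, Matrix.add_apply]
    simp only [Matrix.add_apply, Matrix.of_apply, Matrix.mul_apply, Matrix.replicateCol_apply,
      Matrix.replicateRow_apply, Finset.univ_unique, Finset.sum_const, Finset.card_singleton,
      one_smul, mul_one, ← Finset.sum_mul, Finset.sum_add_distrib, h, Finset.card_univ,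
      nsmul_eq_mul]
    field_simp
    ring
  rw [h1, Matrix.det_mul, Matrix.det_one_add_replicateCol_mul_replicateRow]
  simp only [dotProduct, Finset.sum_const, Finset.card_univ, nsmul_eq_mul, one_mul]
  field_simp
  ring

variable (st : X → V) (R : X → X) (p : X → Prop) [DecidablePred p]

/-- Edge matrix: the part of the Laplacian of a truncation that does not couple the darts at a
vertex. -/
def edgeBlock (c : ℝ) : Matrix X X ℝ :=
  Matrix.diagonal (fun x => if p x then 4 else 3) +
    Matrix.of fun x y => if p x ∧ R x = y then c else 0

variable {st R p}

/-- On inner darts this is (4 - R)(4 + R) = 16 - R² = 15; on the remaining ones it is 3 · 3. -/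
lemma edgeBlock_mul (hR : ∀ x, p x → R (R x) = x) (hp : ∀ x, p x → p (R x)) :
    edgeBlock R p (-1) * edgeBlock R p 1 = Matrix.diagonal fun x => if p x then 15 else 9 := by
  ext x y
  rw [edgeBlock, edgeBlock, add_mul, Matrix.add_apply, Matrix.diagonal_mul, Matrix.add_apply,
    Matrix.mul_apply]
  by_cases hx : p x
  · have h1 : ∀ z, (Matrix.of fun x y => if p x ∧ R x = y then (-1 : ℝ) else 0) x z =
        if R x = z then -1 else 0 := fun z => by simp [hx]
    simp only [h1, ite_mul, zero_mul, Finset.sum_ite_eq, Finset.mem_univ, if_true]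
    simp only [Matrix.add_apply, Matrix.diagonal_apply, Matrix.of_apply, hx, hp x hx, hR x hx,
      true_and, if_true]
    by_cases hxy : x = y
    · subst hxy
      by_cases hRx : R x = x <;> simp [hRx] <;> norm_num
    · by_cases hRx : R x = y <;> simp [hRx, hxy]
  · by_cases hxy : x = y
    · subst hxy
      simp [hx]
      norm_num
    · simp [hx, hxy]

/-- Conjugating by the signs `ε`, which are opposite on reversed darts, changes the sign of the
off-diagonal part. The two factors in `edgeBlock_mul` therefore have equal determinants. -/
lemma det_edgeBlock_sq (hR : ∀ x, p x → R (R x) = x) (hp : ∀ x, p x → p (R x)) (ε : X → ℝ)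
    (hε : ∀ x, ε x * ε x = 1) (hεR : ∀ x, p x → ε (R x) = -ε x) :
    (edgeBlock R p (-1)).det ^ 2 = ∏ x, if p x then 15 else 9 := by
  have h1 : Matrix.diagonal ε * edgeBlock R p (-1) * Matrix.diagonal ε = edgeBlock R p 1 := by
    ext x y
    rw [Matrix.mul_diagonal, Matrix.diagonal_mul, edgeBlock, edgeBlock]
    simp only [Matrix.add_apply, Matrix.of_apply]
    have h2 : ε x * Matrix.diagonal (fun x => if p x then (4 : ℝ) else 3) x y * ε y =
        Matrix.diagonal (fun x => if p x then (4 : ℝ) else 3) x y := by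
      by_cases hxy : x = y
      · subst hxy
        linear_combination Matrix.diagonal (fun x => if p x then (4 : ℝ) else 3) x x * hε x
      · simp [Matrix.diagonal_apply_ne _ hxy]
    have h3 : ε x * (if p x ∧ R x = y then (-1 : ℝ) else 0) * ε y =
        if p x ∧ R x = y then 1 else 0 := by
      split_ifs with h
      · rw [← h.2, hεR x h.1]
        linear_combination hε x
      · ring
    rw [mul_add, add_mul, h2, h3]
  have h2 : (Matrix.diagonal ε).det * (Matrix.diagonal ε).det = 1 := by
    rw [← Matrix.det_mul, Matrix.diagonal_mul_diagonal]
    simp [hε]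
  have h3 := congrArg Matrix.det (edgeBlock_mul hR hp)
  rw [Matrix.det_mul, ← h1, Matrix.det_mul, Matrix.det_mul] at h3
  rw [← Matrix.det_diagonal, ← h3]
  linear_combination (-(edgeBlock R p (-1)).det ^ 2) * h2

/-- The determinant identity behind the effect of truncation on the number of spanning trees:
every triangle is exchanged for a star, and the three resistors that then lie on each edge are
replaced by a single one. -/
lemma det_edgeBlock_sub (hR : ∀ x, p x → R (R x) = x) (hp : ∀ x, p x → p (R x))
    (hst : ∀ u, ∑ x, (if st x = u then (1 : ℝ) else 0) = 3) {L : Matrix V V ℝ}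
    (hL : ∀ u v, L u v = ∑ x, (if st x = u then (1 : ℝ) else 0) * (if p x then
      (if st x = v then 1 else 0) - (if st (R x) = v then 1 else 0) else 0))
    (hL0 : ∀ v, ∑ u, L u v = 0) :
    (edgeBlock R p (-1) - (Matrix.of fun x y => if st x = st y then 1 else 0) +
      Matrix.of fun _ _ => 1).det =
      (edgeBlock R p (-1)).det * ((1 / 15 : ℝ) • L + Matrix.of fun _ _ => 1).det := by
  set K := edgeBlock R p (-1)
  let N : Matrix V X ℝ := Matrix.of fun v x => if st x = v then 1 else 0
  let J : Matrix V V ℝ := Matrix.of fun _ _ => 1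
  let Q : Matrix X X ℝ := edgeBlock R p 1 * Matrix.diagonal fun x => if p x then 15⁻¹ else 9⁻¹
  -- By `edgeBlock_mul`, `Q` is the inverse of `K`.
  have hKQ : K * Q = 1 := by
    rw [← Matrix.mul_assoc, edgeBlock_mul hR hp, Matrix.diagonal_mul_diagonal,
      ← Matrix.diagonal_one]
    congr 1
    ext x
    split_ifs <;> norm_num
  have hNN : (Matrix.of fun x y => if st x = st y then 1 else 0) = Nᵀ * N := by
    ext x y
    simp [N, Matrix.mul_apply, eq_comm]
  have hJ : (Matrix.of fun _ _ => 1 : Matrix X X ℝ) = Nᵀ * (J * N) := by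
    ext x y
    simp [N, J, Matrix.mul_apply]
  -- For an inner dart the row is 4/15 at its start and 1/15 at its end, that is, 1/3 at the start
  -- minus 1/15 of their difference. Without an inner edge it is 1/3 as well, so the boundary needs
  -- no correction here.
  have hQN : ∀ x v, (Q * Nᵀ) x v = (if st x = v then 1 else 0) / 3 - (1 / 15) * (if p x then
      (if st x = v then 1 else 0) - (if st (R x) = v then 1 else 0) else 0) := by
    intro x v
    rw [Matrix.mul_apply]
    have hQ : ∀ y, Q x y = (if p x then 4 / 15 else 1 / 3) * (if x = y then 1 else 0) +
        (if p x then 1 / 15 else 0) * (if R x = y then 1 else 0) := by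
      intro y
      simp only [Q, Matrix.mul_diagonal, edgeBlock, Matrix.add_apply, Matrix.diagonal_apply,
        Matrix.of_apply]
      by_cases hx : p x
      · by_cases hxy : x = y
        · subst hxy
          by_cases hRx : R x = x <;> simp [hx, hRx] <;> norm_num
        · by_cases hRx : R x = y
          · subst hRx
            simp [hx, hp x hx, hxy]
          · simp [hx, hxy, hRx]
      · by_cases hxy : x = y
        · subst hxy
          simp [hx]
          norm_num
        · simp [hx, hxy]
    have hsum : ∀ z, ∑ y, (if z = y then 1 else 0) * Nᵀ y v = if st z = v then 1 else 0 := by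
      intro z
      simp only [ite_mul, one_mul, zero_mul, Finset.sum_ite_eq, Finset.mem_univ, if_true]
      rfl
    simp only [hQ, add_mul, mul_assoc, Finset.sum_add_distrib, ← Finset.mul_sum, hsum]
    split_ifs <;> norm_num
  -- The three thirds at each vertex add up to the identity.
  have hNQN : N * (Q * Nᵀ) = 1 - (1 / 15 : ℝ) • L := by
    ext u v
    rw [Matrix.mul_apply, Matrix.sub_apply, Matrix.smul_apply, hL]
    simp only [hQN, mul_sub, Finset.sum_sub_distrib, smul_eq_mul, Finset.mul_sum]
    congr 1
    · have h1 : ∀ x, N u x * ((if st x = v then 1 else 0) / 3) =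
          (if st x = u then (1 : ℝ) else 0) * ((if u = v then 1 else 0) / 3) := fun x => by
        simp only [N, Matrix.of_apply]
        by_cases hx : st x = u
        · simp [hx]
        · simp [hx]
      rw [Finset.sum_congr rfl fun x _ => h1 x, ← Finset.sum_mul, hst, Matrix.one_apply]
      ring
    · refine Finset.sum_congr rfl fun x _ => ?_
      simp only [N, Matrix.of_apply]
      ring
  have hJL : J * L = 0 := by
    ext u v
    simp [J, Matrix.mul_apply, hL0]
  have hmain : K - Nᵀ * N + Nᵀ * (J * N) = K * (1 - (Q * Nᵀ) * ((1 - J) * N)) := by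
    have h1 : K * (Q * Nᵀ * ((1 - J) * N)) = Nᵀ * ((1 - J) * N) := by
      rw [Matrix.mul_assoc Q, ← Matrix.mul_assoc K, hKQ, Matrix.one_mul]
    rw [Matrix.mul_sub, Matrix.mul_one, h1, Matrix.sub_mul, Matrix.one_mul, Matrix.mul_sub]
    abel
  -- Sylvester's identity passes from a determinant over darts to one over vertices; the cross term
  -- then vanishes because JL = 0.
  rw [hNN, hJ, hmain, Matrix.det_mul, Matrix.det_one_sub_mul_comm, Matrix.mul_assoc, hNQN]
  congr 2
  rw [Matrix.sub_mul, Matrix.one_mul, Matrix.mul_sub, Matrix.mul_one, Matrix.mul_smul, hJL]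
  rw [smul_zero, sub_zero]
  change 1 - (1 - (1 / 15 : ℝ) • L - J) = (1 / 15 : ℝ) • L + J
  abel

end TruncationDeterminant

/-! ### Spanning trees of a finite piece and of its truncation -/

lemma SurfaceGraph.edgeSet_induce_subset {D : Type*} (M : SurfaceGraph D) (A : Set M.Vertex) :
    (M.graph.induce A).edgeSet ⊆ M.edge '' (M.start ⁻¹' A) := by
  intro e he
  rw [← edge_edgeDart (M := M) e, edge_mem_induce_iff] at he
  exact ⟨M.edgeDart e, he.1, edge_edgeDart e⟩

lemma SurfaceGraph.edge_surjective {D : Type*} (M : SurfaceGraph D) (e : M.Edge) :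
    ∃ d, M.edge d = e := ⟨M.edgeDart e, edge_edgeDart e⟩

lemma SurfaceGraph.induce_le {D : Type*} (M : SurfaceGraph D) (A : Set M.Vertex) :
    M.graph.induce A ≤ M.graph := Graph.induce_le (Set.subset_univ A)

namespace BiperiodicGraph

variable {D : Type*} {P : BiperiodicGraph D}

lemma IsThreeRegular.finite_fiber (h3 : P.IsThreeRegular) (v : P.Vertex) :
    (P.start ⁻¹' {v}).Finite :=
  Nat.finite_of_card_ne_zero (α := {d // PermCycle.of P.rot d = v}) (by
    have := h3 v
    rw [PermCycle.length] at this
    omega)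

lemma IsThreeRegular.ncard_fiber (h3 : P.IsThreeRegular) (v : P.Vertex) :
    (P.start ⁻¹' {v}).ncard = 3 := h3 v

lemma IsThreeRegular.finite_darts (h3 : P.IsThreeRegular) {A : Set P.Vertex} (hA : A.Finite) :
    (P.start ⁻¹' A).Finite := by
  rw [← Set.biUnion_preimage_singleton]
  exact hA.biUnion fun v _ => h3.finite_fiber v

lemma IsThreeRegular.ncard_darts (h3 : P.IsThreeRegular) {A : Set P.Vertex} (hA : A.Finite) :
    (P.start ⁻¹' A).ncard = 3 * A.ncard := by
  classical
  lift A to Finset P.Vertex using hA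
  have hfin := h3.finite_darts A.finite_toSet
  rw [Set.ncard_eq_toFinset_card _ hfin, Set.ncard_coe_finset, mul_comm,
    Finset.card_eq_sum_card_fiberwise (f := P.start) (t := A)]
  · rw [Finset.sum_const_nat]
    intro v hv
    rw [← h3.ncard_fiber v, ← Set.ncard_coe_finset]
    congr 1
    ext d
    simp only [Finset.coe_filter, Set.Finite.mem_toFinset, Set.mem_preimage, Set.mem_ofPred_eq,
      Set.mem_singleton_iff, and_iff_right_iff_imp]
    rintro rfl
    exact hv
  · intro d hd
    simpa using hd

lemma IsThreeRegular.finite_edgeSet (h3 : P.IsThreeRegular) {A : Set P.Vertex} (hA : A.Finite) :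
    (P.graph.induce A).edgeSet.Finite :=
  ((h3.finite_darts hA).image _).subset (P.edgeSet_induce_subset A)

lemma IsThreeRegular.one_le_numSpanningTrees (h3 : P.IsThreeRegular) {A : Set P.Vertex}
    (hA : A.Finite) (hc : (P.graph.induce A).IsConn) :
    1 ≤ (P.graph.induce A).numSpanningTrees := by
  rw [Graph.numSpanningTrees_eq (P.induce_le A) hc]
  exact Graph.one_le_numForests (h3.finite_edgeSet hA)

lemma truncation_isThreeRegular : P.truncation.IsThreeRegular := by
  intro v
  obtain ⟨d, rfl⟩ := truncVertex_surjective v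
  rw [PermCycle.length]
  have e : {x // PermCycle.of P.truncation.rot x = P.truncVertex d} ≃ Fin 3 :=
    { toFun := fun x => x.1.2
      invFun := fun i => ⟨(d, i), truncation_start d i⟩
      left_inv := by
        rintro ⟨⟨d', i⟩, h⟩
        have h1 : P.truncVertex d' = P.truncVertex d := (truncation_start d' i).symm.trans h
        exact Subtype.ext (Prod.ext (truncVertex_injective h1).symm rfl)
      right_inv := fun i => rfl }
  rw [Nat.card_congr e, Nat.card_eq_fintype_card, Fintype.card_fin]

/-- The number of darts that leave a set of vertices. -/
noncomputable def boundaryCount (P : BiperiodicGraph D) (A : Set P.Vertex) : ℕ :=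
  {d | P.start d ∈ A ∧ P.start (P.rev d) ∉ A}.ncard

section Indexed

variable {A : Set P.Vertex} {V X : Type*} [DecidableEq V] [Fintype X]
  {ιV : V → P.Vertex} {ιX : X → D} {st : X → V} {R : X → X} {p : X → Prop} [DecidablePred p]

lemma sum_fiber_eq_three (h3 : P.IsThreeRegular) (hX : Function.Injective ιX)
    (hXr : Set.range ιX = P.start ⁻¹' A) (hV : Function.Injective ιV) (hVr : Set.range ιV = A)
    (hst : ∀ x, ιV (st x) = P.start (ιX x)) (u : V) :
    ∑ x, (if st x = u then (1 : ℝ) else 0) = 3 := by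
  rw [Finset.sum_boole]
  have h1 : (Finset.univ.filter fun x => st x = u).card = 3 := by
    rw [← h3.ncard_fiber (ιV u), ← Set.ncard_coe_finset, ← Set.ncard_image_of_injective _ hX]
    congr 1
    ext d
    simp only [Finset.coe_filter, Finset.mem_univ, true_and, Set.mem_image, Set.mem_ofPred_eq,
      Set.mem_preimage, Set.mem_singleton_iff]
    constructor
    · rintro ⟨x, rfl, rfl⟩
      exact (hst x).symm
    · intro hd
      have hdA : d ∈ Set.range ιX := by
        rw [hXr, Set.mem_preimage, hd, ← hVr]
        exact ⟨u, rfl⟩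
      obtain ⟨x, rfl⟩ := hdA
      exact ⟨x, hV ((hst x).trans hd), rfl⟩
  rw [h1]
  norm_num

lemma dartLaplacian_eq_sum (hX : Function.Injective ιX)
    (hV : Function.Injective ιV)
    (hst : ∀ x, ιV (st x) = P.start (ιX x)) (hRval : ∀ x, p x → ιX (R x) = P.rev (ιX x))
    (u v : V) :
    ((P.dartLaplacian ιV ((Finset.univ.filter p).map ⟨ιX, hX⟩) u v : ℤ) : ℝ) =
      ∑ x, (if st x = u then (1 : ℝ) else 0) * (if p x then
        (if st x = v then 1 else 0) - (if st (R x) = v then 1 else 0) else 0) := by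
  rw [SurfaceGraph.dartLaplacian, Matrix.of_apply, Finset.sum_map, Finset.sum_filter]
  push_cast
  refine Finset.sum_congr rfl fun x _ => ?_
  by_cases hx : p x
  · simp only [hx, if_true, Function.Embedding.coeFn_mk, ← hst, ← hRval x hx, hV.eq_iff]
  · simp [hx]

lemma sum_row_eq_zero [Fintype V] (u : V) :
    ∑ v, ∑ x, (if st x = u then (1 : ℝ) else 0) * (if p x then
      (if st x = v then 1 else 0) - (if st (R x) = v then 1 else 0) else 0) = 0 := by
  rw [Finset.sum_comm]
  refine Finset.sum_eq_zero fun x _ => ?_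
  rw [← Finset.mul_sum]
  by_cases hx : p x <;> simp [hx]

/-- Reversal permutes the inner darts, so starts and ends are hit equally often. -/
lemma sum_col_eq_zero [Fintype V] (hR : Function.Involutive R) (hpR : ∀ x, p (R x) ↔ p x) (v : V) :
    ∑ u, ∑ x, (if st x = u then (1 : ℝ) else 0) * (if p x then
      (if st x = v then 1 else 0) - (if st (R x) = v then 1 else 0) else 0) = 0 := by
  rw [Finset.sum_comm]
  simp only [← Finset.sum_mul, Finset.sum_ite_eq, Finset.mem_univ, if_true, one_mul]
  have h1 : ∑ x, (if p x then (if st (R x) = v then (1 : ℝ) else 0) else 0) =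
      ∑ x, (if p x then (if st x = v then (1 : ℝ) else 0) else 0) :=
    Fintype.sum_equiv hR.toPerm _ _ fun x => by
      rw [Function.Involutive.coe_toPerm]
      exact if_congr (hpR x).symm rfl rfl
  calc ∑ x, (if p x then
      (if st x = v then (1 : ℝ) else 0) - (if st (R x) = v then 1 else 0) else 0)
      = ∑ x, ((if p x then (if st x = v then (1 : ℝ) else 0) else 0) -
          (if p x then (if st (R x) = v then (1 : ℝ) else 0) else 0)) := by
        refine Finset.sum_congr rfl fun x _ => ?_
        split_ifs <;> simp
    _ = 0 := by rw [Finset.sum_sub_distrib, h1, sub_self]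

/-- The embedding of darts of the truncation induced by an embedding of darts. -/
def truncDartEmbedding (hX : Function.Injective ιX) : X × Fin 3 ↪ D × Fin 3 where
  toFun y := (ιX y.1, y.2)
  inj' y z h := by
    simp only [Prod.mk.injEq] at h
    exact Prod.ext (hX h.1) h.2

/-- The darts of the truncation of a finite induced subgraph. -/
def truncDarts (p : X → Prop) [DecidablePred p] (hX : Function.Injective ιX) :
    Finset (D × Fin 3) :=
  ((Finset.univ : Finset (X × Fin 3)).filter fun y => y.2 = 0 → p y.1).map
    (truncDartEmbedding hX)

omit [Fintype X] in
lemma truncDartEmbedding_apply (hX : Function.Injective ιX) (x : X) (i : Fin 3) :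
    truncDartEmbedding hX (x, i) = (ιX x, i) := rfl

lemma mem_truncDarts_iff (hX : Function.Injective ιX) (hXr : Set.range ιX = P.start ⁻¹' A)
    (hp : ∀ x, p x ↔ P.start (P.rev (ιX x)) ∈ A) (y : D × Fin 3) :
    y ∈ truncDarts p hX ↔ P.truncation.start y ∈ P.truncVertex '' (P.start ⁻¹' A) ∧
      P.truncation.start (P.truncation.rev y) ∈ P.truncVertex '' (P.start ⁻¹' A) := by
  obtain ⟨d, i⟩ := y
  have h1 : P.truncation.start (P.truncation.rev (d, i)) =
    P.truncVertex (P.truncation.rev (d, i)).1 := truncation_start _ _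
  rw [h1, truncation_start, truncVertex_mem_image_iff, truncVertex_mem_image_iff]
  have hXA : ∀ x, P.start (ιX x) ∈ A := fun x => by
    have : ιX x ∈ P.start ⁻¹' A := hXr ▸ ⟨x, rfl⟩
    exact this
  simp only [truncDarts, Finset.mem_map, Finset.mem_filter, Finset.mem_univ, true_and,
    truncDartEmbedding_apply, Prod.mk.injEq, Prod.exists]
  constructor
  · rintro ⟨x, j, hj, rfl, rfl⟩
    refine ⟨hXA x, ?_⟩
    fin_cases j
    · exact (hp x).1 (hj rfl)
    · change P.start (P.rot (ιX x)) ∈ A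
      rw [P.start_rot]
      exact hXA x
    · change P.start (P.rot.symm (ιX x)) ∈ A
      rw [P.start_rot_symm]
      exact hXA x
  · rintro ⟨hd, hr⟩
    obtain ⟨x, rfl⟩ : d ∈ Set.range ιX := hXr ▸ hd
    refine ⟨x, i, ?_, rfl, rfl⟩
    rintro rfl
    exact (hp x).2 hr

/-- Adjacency inside the triangles is the relation of having the same start, minus the identity.
Moving that identity to the diagonal raises the degrees 3 (inner darts) and 2 (boundary darts) to
the entries 4 and 3 of `edgeBlock`. -/
lemma dartLaplacian_truncation [DecidableEq X] (h3 : P.IsThreeRegular) (hX : Function.Injective ιX)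
    (hV : Function.Injective ιV) (hst : ∀ x, ιV (st x) = P.start (ιX x))
    (hRval : ∀ x, p x → ιX (R x) = P.rev (ιX x)) :
    (P.truncation.dartLaplacian (fun x : X => P.truncVertex (ιX x)) (truncDarts p hX)).map
      (Int.cast : ℤ → ℝ) =
      edgeBlock R p (-1) - (Matrix.of fun x y => if st x = st y then 1 else 0) := by
  classical
  ext x y
  -- The three darts at a vertex are distinct, so at most one indicator on the right is nonzero.
  have hsplit : (if st x = st y then (1 : ℝ) else 0) = (if ιX x = ιX y then 1 else 0) +
      (if P.rot (ιX x) = ιX y then 1 else 0) + (if P.rot.symm (ιX x) = ιX y then 1 else 0) := by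
    have h1 : st x = st y ↔
        (ιX y = ιX x ∨ ιX y = P.rot (ιX x) ∨ ιX y = P.rot.symm (ιX x)) := by
      rw [← h3.start_eq_iff, ← hst, ← hst, hV.eq_iff]
    have h4 := h3.rot_ne (ιX x)
    have h5 := h3.rot_ne_symm (ιX x)
    have h6 := h3.symm_ne (ιX x)
    by_cases ha : ιX y = ιX x
    · rw [if_pos (h1.2 (Or.inl ha)), if_pos ha.symm, if_neg (ha ▸ h4), if_neg (ha ▸ h6)]
      norm_num
    · by_cases hb : ιX y = P.rot (ιX x)
      · rw [if_pos (h1.2 (Or.inr (Or.inl hb))), if_neg (Ne.symm ha), if_pos hb.symm,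
          if_neg (hb ▸ h5.symm)]
        norm_num
      · by_cases hd : ιX y = P.rot.symm (ιX x)
        · rw [if_pos (h1.2 (Or.inr (Or.inr hd))), if_neg (Ne.symm ha), if_neg (Ne.symm hb),
            if_pos hd.symm]
          norm_num
        · rw [if_neg (fun h => (h1.1 h).elim ha fun h => h.elim hb hd), if_neg (Ne.symm ha),
            if_neg (Ne.symm hb), if_neg (Ne.symm hd)]
          norm_num
  have hQL : P.truncation.dartLaplacian (fun x : X => P.truncVertex (ιX x))
      (truncDarts p hX) x y =
      (if p x then (if ιX x = ιX y then 1 else 0) -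
        (if P.rev (ιX x) = ιX y then 1 else 0) else 0) +
      ((if ιX x = ιX y then 1 else 0) - (if P.rot (ιX x) = ιX y then 1 else 0)) +
      ((if ιX x = ιX y then 1 else 0) - (if P.rot.symm (ιX x) = ιX y then 1 else 0)) := by
    have h1 : ∀ (d : D) (i : Fin 3), P.truncation.start (P.truncation.rev (d, i)) =
        P.truncVertex (P.truncation.rev (d, i)).1 := fun d i => truncation_start _ _
    simp only [SurfaceGraph.dartLaplacian, Matrix.of_apply, truncDarts, Finset.sum_map,
      truncDartEmbedding_apply, Finset.sum_filter, Fintype.sum_prod_type, h1,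
      truncation_start, truncVertex_injective.eq_iff, Fin.sum_univ_three,
      truncation_rev_zero, truncation_rev_one, truncation_rev_two, hX.eq_iff]
    rw [Finset.sum_eq_single x]
    · simp only [if_true, one_ne_zero, Fin.reduceEq, false_imp_iff, true_imp_iff,
        one_mul]
      congr!
    · intro z _ hz
      simp [hz]
    · exact fun h => absurd (Finset.mem_univ x) h
  rw [Matrix.map_apply, hQL, Matrix.sub_apply, Matrix.of_apply, hsplit, edgeBlock,
    Matrix.add_apply, Matrix.diagonal_apply, Matrix.of_apply]
  by_cases hx : p x
  · simp only [hx, if_true, true_and, ← hRval x hx, hX.eq_iff]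
    push_cast
    by_cases ha : x = y
    · simp only [ha, if_true]
      split_ifs <;> norm_num
    · simp only [ha, if_false]
      split_ifs <;> norm_num
  · simp only [hx, if_false, false_and, hX.eq_iff]
    push_cast
    by_cases ha : x = y
    · simp only [ha, if_true]
      ring
    · simp only [ha, if_false]
      ring

/-- The determinant identity relating the numbers of spanning trees of a finite induced subgraph
and of its truncation. -/
lemma numSpanningTrees_truncation_mul [Fintype V] [DecidableEq X] (h3 : P.IsThreeRegular)
    (hc : (P.graph.induce A).IsConn)
    (hX : Function.Injective ιX) (hXr : Set.range ιX = P.start ⁻¹' A)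
    (hV : Function.Injective ιV) (hVr : Set.range ιV = A)
    (hst : ∀ x, ιV (st x) = P.start (ιX x)) (hp : ∀ x, p x ↔ P.start (P.rev (ιX x)) ∈ A)
    (hRval : ∀ x, p x → ιX (R x) = P.rev (ιX x)) (hR : Function.Involutive R)
    (hpR : ∀ x, p (R x) ↔ p x) :
    (Fintype.card X : ℝ) ^ 2 *
      (P.truncation.graph.induce (P.truncVertex '' (P.start ⁻¹' A))).numSpanningTrees =
      (edgeBlock R p (-1)).det * ((1 / 15) ^ Fintype.card V *
        (15 * ((Fintype.card V : ℝ) ^ 2 * (P.graph.induce A).numSpanningTrees))) := by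
  have hXA : ∀ x, P.start (ιX x) ∈ A := fun x => by
    have : ιX x ∈ P.start ⁻¹' A := hXr ▸ ⟨x, rfl⟩
    exact this
  have hI : ∀ d, d ∈ (Finset.univ.filter p).map ⟨ιX, hX⟩ ↔
      P.start d ∈ A ∧ P.start (P.rev d) ∈ A := fun d => by
    simp only [Finset.mem_map, Finset.mem_filter, Finset.mem_univ, true_and,
      Function.Embedding.coeFn_mk]
    constructor
    · rintro ⟨x, hx, rfl⟩
      exact ⟨hXA x, (hp x).1 hx⟩
    · rintro ⟨hd, hr⟩
      obtain ⟨x, rfl⟩ : d ∈ Set.range ιX := hXr ▸ hd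
      exact ⟨x, (hp x).2 hr, rfl⟩
  have : Nonempty V := by
    obtain ⟨v, hv⟩ := hc.1
    have hv' : v ∈ Set.range ιV := hVr ▸ hv
    exact ⟨hv'.choose⟩
  set L : Matrix V V ℝ :=
    (P.dartLaplacian ιV ((Finset.univ.filter p).map ⟨ιX, hX⟩)).map (Int.cast)
  have hL := dartLaplacian_eq_sum (P := P) (p := p) hX hV hst hRval
  have hLrow : ∀ u, ∑ v, L u v = 0 := fun u => by
    simp only [L, Matrix.map_apply, hL]
    exact sum_row_eq_zero u
  have hLcol : ∀ v, ∑ u, L u v = 0 := fun v => by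
    simp only [L, Matrix.map_apply, hL]
    exact sum_col_eq_zero hR hpR v
  have hdetL : (L + Matrix.of fun _ _ => 1).det =
      (Fintype.card V : ℝ) ^ 2 * (P.graph.induce A).numSpanningTrees := by
    have h2 := congrArg (Int.cast : ℤ → ℝ)
      (SurfaceGraph.det_dartLaplacian_add_one (M := P.toSurfaceGraph) hV hVr hI hc)
    rw [Int.cast_det] at h2
    push_cast at h2
    rw [← h2]
    congr 1
    ext u v
    simp [L]
  have hιr : Set.range (fun x : X => P.truncVertex (ιX x)) =
      P.truncVertex '' (P.start ⁻¹' A) := by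
    rw [← hXr, ← Set.range_comp]
    rfl
  have hdetQ : (edgeBlock R p (-1) - (Matrix.of fun x y => if st x = st y then 1 else 0) +
      Matrix.of fun _ _ => 1).det = (Fintype.card X : ℝ) ^ 2 *
      (P.truncation.graph.induce (P.truncVertex '' (P.start ⁻¹' A))).numSpanningTrees := by
    have h2 := congrArg (Int.cast : ℤ → ℝ)
      (SurfaceGraph.det_dartLaplacian_add_one (M := P.truncation.toSurfaceGraph)
      (ι := fun x : X => P.truncVertex (ιX x)) (truncVertex_injective.comp hX) hιr
      (mem_truncDarts_iff hX hXr hp) (truncation_induce_isConn h3 hc))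
    rw [Int.cast_det] at h2
    push_cast at h2
    rw [← h2, ← dartLaplacian_truncation h3 hX hV hst hRval]
    congr 1
    ext x y
    simp
  have hmain := det_edgeBlock_sub (L := L) (fun x _ => hR x) (fun x => (hpR x).2)
    (sum_fiber_eq_three h3 hX hXr hV hVr hst) hL hLcol
  -- Factor L/15 + J as (L + 15 J)/15; `Matrix.det_add_smul_ones` with `c = 15` gives the extra
  -- factor 15.
  have hscale : ((1 / 15 : ℝ) • L + Matrix.of fun _ _ => 1).det = (1 / 15) ^ Fintype.card V *
      (15 * ((Fintype.card V : ℝ) ^ 2 * (P.graph.induce A).numSpanningTrees)) := by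
    rw [← hdetL, ← Matrix.det_add_smul_ones hLrow, ← Matrix.det_smul]
    congr 1
    ext u v
    simp only [Matrix.add_apply, Matrix.smul_apply, Matrix.of_apply, smul_eq_mul]
    ring
  rwa [hdetQ, hscale] at hmain

end Indexed

/-- For `n` vertices and `b` outgoing darts, (det K)² = 15^(3n - b) · 9^b, while rescaling `L`
contributes 15^(1 - n). The normalisations n² and (3n)² of the matrix tree theorem account for the
term `log 9`. -/
theorem log_numSpanningTrees_truncation (h3 : P.IsThreeRegular) {A : Set P.Vertex}
    (hA : A.Finite) (hc : (P.graph.induce A).IsConn) :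
    Real.log (P.truncation.graph.induce (P.truncVertex '' (P.start ⁻¹' A))).numSpanningTrees =
      Real.log (P.graph.induce A).numSpanningTrees + A.ncard * (Real.log 15 / 2) +
        (Real.log 15 - Real.log 9) +
        P.boundaryCount A * (Real.log 3 - Real.log 15 / 2) := by
  classical
  have hfinD := h3.finite_darts hA
  have : Finite A := hA
  have : Finite (P.start ⁻¹' A) := hfinD
  have := Fintype.ofFinite A
  have := Fintype.ofFinite (P.start ⁻¹' A)
  have hne : Nonempty A := hc.1.to_subtype
  let p : P.start ⁻¹' A → Prop := fun x => P.start (P.rev x) ∈ A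
  -- Darts leaving `A` are fixed, which makes reversal an involution of the finite set of darts.
  let R : P.start ⁻¹' A → P.start ⁻¹' A := fun x => if h : p x then ⟨P.rev x, h⟩ else x
  have hRval : ∀ x, p x → (R x : D) = P.rev x := fun x h => by simp only [R, dif_pos h]
  have hRneg : ∀ x, ¬ p x → R x = x := fun x h => by simp only [R, dif_neg h]
  have hp : ∀ x, p x → p (R x) := fun x h => by
    change P.start (P.rev (R x)) ∈ A
    rw [hRval x h, P.rev_rev]
    exact x.2
  have hR : Function.Involutive R := fun x => by
    by_cases h : p x
    · refine Subtype.ext ?_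
      rw [hRval _ (hp x h), hRval x h, P.rev_rev]
    · rw [hRneg x h, hRneg x h]
  have hpR : ∀ x, p (R x) ↔ p x := fun x =>
    ⟨fun h => by simpa only [hR x] using hp _ h, hp x⟩
  have hcardV : Fintype.card A = A.ncard := Nat.card_eq_fintype_card.symm
  have hcardX : Fintype.card (P.start ⁻¹' A) = 3 * A.ncard := by
    rw [← h3.ncard_darts hA]
    exact Nat.card_eq_fintype_card.symm
  have hmain := numSpanningTrees_truncation_mul (p := p) (R := R)
    (st := fun x : P.start ⁻¹' A => (⟨P.start x, x.2⟩ : A)) h3 hc Subtype.val_injective Subtype.range_val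
    Subtype.val_injective Subtype.range_val (fun x => rfl) (fun x => Iff.rfl) hRval hR hpR
  rw [hcardX, hcardV] at hmain
  have hsq := det_edgeBlock_sq (R := R) (p := p) (fun x _ => hR x) hp
    -- The signs come from orienting each edge by its representative dart.
    (fun x => if (x : D) = P.edgeDart (P.edge x) then 1 else -1)
    (fun x => by split_ifs <;> norm_num) (fun x hx => by
      simp only [hRval x hx, SurfaceGraph.edge_rev]
      have h1 := P.rev_ne (P.edgeDart (P.edge x))
      rcases SurfaceGraph.eq_edgeDart_or (M := P.toSurfaceGraph) (x : D) with h | h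
      · rw [if_pos h, if_neg]
        rw [← h] at h1 ⊢
        exact h1
      · have h2 : P.rev x = P.edgeDart (P.edge x) := by
          rw [← P.rev_rev (P.edgeDart (P.edge x)), ← h]
        rw [if_pos h2, if_neg, neg_neg]
        rw [← h] at h1
        exact h1)
  have hbc : (Finset.univ.filter fun x : P.start ⁻¹' A => ¬ p x).card = P.boundaryCount A := by
    rw [boundaryCount, ← Set.ncard_coe_finset,
      ← Set.ncard_image_of_injective _ Subtype.val_injective]
    congr 1
    ext d
    simp only [p, Finset.coe_filter, Finset.mem_univ, true_and, Set.mem_image, Set.mem_ofPred_eq,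
      Subtype.exists, exists_and_left, exists_prop, Set.mem_preimage]
    constructor
    · rintro ⟨x, hx, hxA, rfl⟩
      exact ⟨hxA, hx⟩
    · rintro ⟨h1, h2⟩
      exact ⟨d, h2, h1, rfl⟩
  have hpc : ((Finset.univ.filter p).card : ℝ) = 3 * A.ncard - P.boundaryCount A := by
    have h1 := Finset.card_filter_add_card_filter_not
      (s := (Finset.univ : Finset (P.start ⁻¹' A))) p
    rw [hbc, Finset.card_univ, hcardX] at h1
    have h2 : ((Finset.univ.filter p).card : ℝ) + P.boundaryCount A = 3 * A.ncard := by
      exact_mod_cast h1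
    linarith
  rw [Finset.prod_ite, Finset.prod_const, Finset.prod_const, hbc] at hsq
  set K := (edgeBlock R p (-1)).det
  have hK : K ≠ 0 := fun h => by
    rw [h, zero_pow two_ne_zero] at hsq
    exact absurd hsq.symm (by positivity)
  -- Only the square of `K` is known, but `Real.log` ignores the sign of its argument, so `K ≠ 0` is
  -- enough.
  have hlogK := congrArg Real.log hsq
  rw [Real.log_pow, Real.log_mul (by positivity) (by positivity), Real.log_pow, Real.log_pow,
    hpc] at hlogK
  have hτ : (0 : ℝ) < (P.graph.induce A).numSpanningTrees := by
    exact_mod_cast h3.one_le_numSpanningTrees hA hc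
  have hτ' : (0 : ℝ) < (P.truncation.graph.induce
      (P.truncVertex '' (P.start ⁻¹' A))).numSpanningTrees := by
    exact_mod_cast truncation_isThreeRegular.one_le_numSpanningTrees (hfinD.image _)
      (truncation_induce_isConn h3 hc)
  have hn : (0 : ℝ) < A.ncard := by
    rw [← hcardV]
    exact_mod_cast Fintype.card_pos
  push_cast at hmain
  have hlog := congrArg Real.log hmain
  rw [Real.log_mul (by positivity) hτ'.ne', Real.log_pow, Real.log_mul (by norm_num) hn.ne',
    Real.log_mul hK (by positivity), Real.log_mul (by positivity) (by positivity),
    Real.log_mul (by norm_num) (by positivity), Real.log_mul (by positivity) hτ.ne',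
    Real.log_pow, Real.log_pow, one_div, Real.log_inv] at hlog
  have h9 : Real.log 9 = 2 * Real.log 3 := by
    rw [show (9 : ℝ) = 3 ^ 2 by norm_num, Real.log_pow]
    norm_num
  push_cast at hlog hlogK
  rw [h9] at hlogK ⊢
  linarith

end BiperiodicGraph

/-! ### The lattice action -/

namespace BiperiodicGraph

variable {D : Type*} {P : BiperiodicGraph D}

lemma transVertex_start (x : ℤ × ℤ) (d : D) :
    P.transVertex x (P.start d) = P.start (P.trans x d) := rfl

lemma transVertex_add (x y : ℤ × ℤ) (v : P.Vertex) :
    P.transVertex (x + y) v = P.transVertex x (P.transVertex y v) := by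
  obtain ⟨d, rfl⟩ := PermCycle.of_surjective _ v
  exact congrArg P.start (P.trans_add x y d)

lemma transVertex_zero (v : P.Vertex) : P.transVertex 0 v = v := by
  obtain ⟨d, rfl⟩ := PermCycle.of_surjective _ v
  exact congrArg P.start (P.trans_zero d)

/-- The action of a lattice vector on the vertices, as a permutation. -/
def transVertexPerm (P : BiperiodicGraph D) (x : ℤ × ℤ) : Equiv.Perm P.Vertex where
  toFun := P.transVertex x
  invFun := P.transVertex (-x)
  left_inv v := by rw [← transVertex_add, neg_add_cancel, transVertex_zero]
  right_inv v := by rw [← transVertex_add, add_neg_cancel, transVertex_zero]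

/-- The action of a lattice vector on the edges. -/
def transEdge (P : BiperiodicGraph D) (x : ℤ × ℤ) : P.Edge → P.Edge :=
  Quotient.map (P.trans x) (by
    rintro d e ⟨k, rfl⟩
    have hc : Commute (P.trans x) P.rev := Equiv.ext fun d => P.trans_rev x d
    exact ⟨k, congrArg (fun q : Equiv.Perm D => q d) (hc.zpow_right k).eq.symm⟩)

lemma transEdge_edge (x : ℤ × ℤ) (d : D) : P.transEdge x (P.edge d) = P.edge (P.trans x d) := rfl

lemma transEdge_transEdge_neg (x y : ℤ × ℤ) (h : x + y = 0) (e : P.Edge) :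
    P.transEdge x (P.transEdge y e) = e := by
  obtain ⟨d, rfl⟩ := P.edge_surjective e
  rw [transEdge_edge, transEdge_edge, ← P.trans_add, h, P.trans_zero]

/-- The action of a lattice vector on the edges, as a permutation. -/
def transEdgePerm (P : BiperiodicGraph D) (x : ℤ × ℤ) : Equiv.Perm P.Edge where
  toFun := P.transEdge x
  invFun := P.transEdge (-x)
  left_inv := transEdge_transEdge_neg _ _ (neg_add_cancel x)
  right_inv := transEdge_transEdge_neg _ _ (add_neg_cancel x)

lemma isLink_transEdge (x : ℤ × ℤ) {e : P.Edge} {u v : P.Vertex} (h : P.graph.IsLink e u v) :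
    P.graph.IsLink (P.transEdge x e) (P.transVertex x u) (P.transVertex x v) := by
  obtain ⟨d, rfl, rfl, rfl⟩ := h
  refine ⟨P.trans x d, rfl, rfl, ?_⟩
  rw [transVertex_start, P.trans_rev]

lemma isLink_transEdgePerm_iff (x : ℤ × ℤ) (e : P.Edge) (u v : P.Vertex) :
    P.graph.IsLink (P.transEdgePerm x e) (P.transVertexPerm x u) (P.transVertexPerm x v) ↔
      P.graph.IsLink e u v := by
  refine ⟨fun h => ?_, isLink_transEdge x⟩
  have h1 := isLink_transEdge (-x) h
  change P.graph.IsLink ((P.transEdgePerm x).symm (P.transEdgePerm x e))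
    ((P.transVertexPerm x).symm (P.transVertexPerm x u))
    ((P.transVertexPerm x).symm (P.transVertexPerm x v)) at h1
  simpa only [Equiv.symm_apply_apply] using h1

lemma edgeSet_induce_image (x : ℤ × ℤ) (A : Set P.Vertex) :
    (P.graph.induce (P.transVertexPerm x '' A)).edgeSet =
      P.transEdgePerm x '' (P.graph.induce A).edgeSet := by
  ext e
  constructor
  · rintro ⟨_, _, hl, ⟨u, hu, rfl⟩, ⟨v, hv, rfl⟩⟩
    refine ⟨(P.transEdgePerm x).symm e, ⟨u, v, ?_, hu, hv⟩, Equiv.apply_symm_apply _ _⟩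
    rw [← isLink_transEdgePerm_iff x, Equiv.apply_symm_apply]
    exact hl
  · rintro ⟨e, ⟨u, v, hl, hu, hv⟩, rfl⟩
    exact ⟨_, _, (isLink_transEdgePerm_iff x e u v).2 hl, ⟨u, hu, rfl⟩, ⟨v, hv, rfl⟩⟩

lemma numForests_induce_image (x : ℤ × ℤ) (A : Set P.Vertex) :
    P.graph.numForests (P.graph.induce (P.transVertexPerm x '' A)).edgeSet =
      P.graph.numForests (P.graph.induce A).edgeSet := by
  rw [edgeSet_induce_image, Graph.numForests_image _ _ (isLink_transEdgePerm_iff x)]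

lemma boundaryCount_image (x : ℤ × ℤ) (A : Set P.Vertex) :
    P.boundaryCount (P.transVertexPerm x '' A) = P.boundaryCount A := by
  have hmem : ∀ d, P.start (P.trans x d) ∈ P.transVertexPerm x '' A ↔ P.start d ∈ A := fun d =>
    (P.transVertexPerm x).injective.mem_set_image (a := P.start d)
  rw [boundaryCount, boundaryCount, ← Set.ncard_image_of_injective
    {d | P.start d ∈ A ∧ P.start (P.rev d) ∉ A} (P.trans x).injective]
  congr 1
  ext d
  obtain ⟨d, rfl⟩ := (P.trans x).surjective d
  rw [(P.trans x).injective.mem_set_image]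
  simp only [Set.mem_ofPred_eq, ← P.trans_rev, hmem]

/-- A lattice vector both of whose coordinates are at most `R` in absolute value. -/
def IsShort (R : ℕ) (x : ℤ × ℤ) : Prop := |x.1| ≤ R ∧ |x.2| ≤ R

lemma IsShort.add {R R' : ℕ} {x y : ℤ × ℤ} (hx : IsShort R x) (hy : IsShort R' y) :
    IsShort (R + R') (x + y) := by
  constructor
  · push_cast
    exact (abs_add_le _ _).trans (add_le_add hx.1 hy.1)
  · push_cast
    exact (abs_add_le _ _).trans (add_le_add hx.2 hy.2)

lemma IsShort.neg {R : ℕ} {x : ℤ × ℤ} (hx : IsShort R x) : IsShort R (-x) := by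
  rw [IsShort, Prod.fst_neg, Prod.snd_neg, abs_neg, abs_neg]
  exact hx

lemma exists_isShort {s : Set (ℤ × ℤ)} (hs : s.Finite) : ∃ R, ∀ x ∈ s, IsShort R x := by
  induction s, hs using Set.Finite.induction_on with
  | empty => exact ⟨0, fun x hx => absurd hx (Set.notMem_empty x)⟩
  | @insert a s _ _ ih =>
    obtain ⟨R, hR⟩ := ih
    refine ⟨max R (max a.1.natAbs a.2.natAbs), ?_⟩
    rintro x (rfl | hx)
    · constructor <;> simp
    · obtain ⟨h1, h2⟩ := hR x hx
      constructor
      · refine h1.trans ?_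
        exact_mod_cast le_max_left _ _
      · refine h2.trans ?_
        exact_mod_cast le_max_left _ _

/-- An invariant function factors through the finite quotient, so it takes finitely many values. -/
lemma exists_isShort_of_invariant (hq : Finite P.QuotDart) (g : D → ℤ × ℤ)
    (hg : ∀ x d, g (P.trans x d) = g d) : ∃ R, ∀ d, IsShort R (g d) := by
  let g' : P.QuotDart → ℤ × ℤ := Quotient.lift g (by
    rintro d e ⟨x, rfl⟩
    exact (hg x d).symm)
  obtain ⟨R, hR⟩ := exists_isShort (Set.finite_range g')
  exact ⟨R, fun d => hR _ ⟨Quotient.mk _ d, rfl⟩⟩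

/-! ### Boxes in the lattice -/

/-- The interval of length `n` used for the blocks of a fundamental domain. -/
noncomputable def boxInterval (n : ℕ) : Finset ℤ := Finset.Ico (-(n / 2 : ℕ) : ℤ) (n - (n / 2 : ℕ))

/-- The square of side `n` used for the blocks of a fundamental domain. -/
noncomputable def latticeBox (n : ℕ) : Finset (ℤ × ℤ) := boxInterval n ×ˢ boxInterval n

lemma mem_boxInterval {n : ℕ} {i : ℤ} :
    i ∈ boxInterval n ↔ -(n / 2 : ℕ) ≤ i ∧ i < n - (n / 2 : ℕ) := Finset.mem_Ico

lemma card_boxInterval (n : ℕ) : (boxInterval n).card = n := by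
  rw [boxInterval, Int.card_Ico]
  omega

lemma card_latticeBox (n : ℕ) : (latticeBox n).card = n ^ 2 := by
  rw [latticeBox, Finset.card_product, card_boxInterval, pow_two]

open Classical in
/-- The elements of the box of side `n` that are at distance at most `R` from its complement. -/
noncomputable def boxLayer (n R : ℕ) : Finset (ℤ × ℤ) :=
  (latticeBox n).filter fun y => ∃ z, IsShort R (z - y) ∧ z ∉ latticeBox n

lemma mem_boxLayer {n R : ℕ} {y : ℤ × ℤ} :
    y ∈ boxLayer n R ↔ y ∈ latticeBox n ∧ ∃ z, IsShort R (z - y) ∧ z ∉ latticeBox n := by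
  classical
  rw [boxLayer, Finset.mem_filter]

/-- The layer is covered by four strips of width `R` along the sides of the box. -/
lemma card_boxLayer_le (n R : ℕ) : (boxLayer n R).card ≤ 4 * R * n := by
  classical
  let E : Finset ℤ := Finset.Ico (-(n / 2 : ℕ) : ℤ) (-(n / 2 : ℕ) + R) ∪
    Finset.Ico (n - (n / 2 : ℕ) - R : ℤ) (n - (n / 2 : ℕ))
  have hE : E.card ≤ 2 * R := by
    refine (Finset.card_union_le _ _).trans ?_
    rw [Int.card_Ico, Int.card_Ico]
    omega
  have hsub : boxLayer n R ⊆ E ×ˢ boxInterval n ∪ boxInterval n ×ˢ E := by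
    intro y hy
    rw [mem_boxLayer, latticeBox, Finset.mem_product] at hy
    obtain ⟨⟨hy1, hy2⟩, z, ⟨hz1, hz2⟩, hz⟩ := hy
    rw [Finset.mem_product, not_and_or] at hz
    rw [Prod.fst_sub, abs_le] at hz1
    rw [Prod.snd_sub, abs_le] at hz2
    rw [Finset.mem_union, Finset.mem_product, Finset.mem_product]
    rcases hz with hz | hz
    · refine Or.inl ⟨?_, hy2⟩
      rw [mem_boxInterval] at hz hy1
      rw [Finset.mem_union, Finset.mem_Ico, Finset.mem_Ico]
      omega
    · refine Or.inr ⟨hy1, ?_⟩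
      rw [mem_boxInterval] at hz hy2
      rw [Finset.mem_union, Finset.mem_Ico, Finset.mem_Ico]
      omega
  refine (Finset.card_le_card hsub).trans ((Finset.card_union_le _ _).trans ?_)
  rw [Finset.card_product, Finset.card_product, card_boxInterval]
  calc E.card * n + n * E.card = 2 * E.card * n := by ring
    _ ≤ 2 * (2 * R) * n := by gcongr
    _ = 4 * R * n := by ring

lemma isShort_sub_of_mem_latticeBox {m : ℕ} {x y : ℤ × ℤ} (hx : x ∈ latticeBox m)
    (hy : y ∈ latticeBox m) : IsShort m (x - y) := by
  rw [latticeBox, Finset.mem_product, mem_boxInterval, mem_boxInterval] at hx hy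
  constructor
  · rw [Prod.fst_sub, abs_le]
    omega
  · rw [Prod.snd_sub, abs_le]
    omega

/-- The position of the square of side `m` that contains a given lattice point, in the tiling of
the lattice by translates of the box of side `m`. -/
def tileIndex (m : ℕ) (y : ℤ × ℤ) : ℤ × ℤ :=
  ((y.1 + (m / 2 : ℕ)) / m, (y.2 + (m / 2 : ℕ)) / m)

lemma tileIndex_eq_iff {m : ℕ} (hm : 1 ≤ m) (x y : ℤ × ℤ) :
    tileIndex m y = x ↔ y - m • x ∈ latticeBox m := by
  have hm' : (0 : ℤ) < m := by exact_mod_cast hm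
  have key : ∀ a b : ℤ, (a + (m / 2 : ℕ)) / m = b ↔ a - m * b ∈ boxInterval m := fun a b => by
    rw [Int.ediv_eq_iff_of_pos hm', mem_boxInterval]
    constructor
    · rintro ⟨h1, h2⟩
      constructor <;> nlinarith
    · rintro ⟨h1, h2⟩
      constructor <;> nlinarith
  rw [latticeBox, Finset.mem_product, tileIndex, Prod.ext_iff, key, key]
  simp

/-! ### Coordinates, perimeters and tiles of a fundamental domain -/

namespace FundamentalDomain

variable (F : P.FundamentalDomain)

/-- The position of a vertex with respect to a fundamental domain. -/
noncomputable def coord (v : P.Vertex) : ℤ × ℤ :=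
  -- The chosen vector carries `v` back into the domain, so the position of `v` is its negative.
  -F.basis.symm (F.existsUnique_trans v).choose

lemma transVertex_neg_basis_coord_mem (v : P.Vertex) :
    P.transVertex (-F.basis (F.coord v)) v ∈ F.verts := by
  rw [coord, map_neg, neg_neg, AddEquiv.apply_symm_apply]
  exact (F.existsUnique_trans v).choose_spec.1

lemma coord_eq_of_mem {v : P.Vertex} {c : ℤ × ℤ} (h : P.transVertex (-F.basis c) v ∈ F.verts) :
    F.coord v = c := by
  have h1 := (F.existsUnique_trans v).unique (F.transVertex_neg_basis_coord_mem v) h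
  exact F.basis.injective (neg_injective h1)

lemma coord_transVertex (x : ℤ × ℤ) (v : P.Vertex) :
    F.coord (P.transVertex x v) = F.basis.symm x + F.coord v := by
  apply F.coord_eq_of_mem
  rw [← transVertex_add, map_add, AddEquiv.apply_symm_apply, neg_add, add_assoc, add_comm,
    add_assoc, add_neg_cancel, add_zero]
  exact F.transVertex_neg_basis_coord_mem v

lemma coord_of_mem {v : P.Vertex} (hv : v ∈ F.verts) : F.coord v = 0 :=
  F.coord_eq_of_mem (by rwa [map_zero, neg_zero, transVertex_zero])

lemma boxVerts_eq (n : ℕ) : F.boxVerts n = F.coord ⁻¹' latticeBox n := by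
  ext v
  simp only [Set.mem_preimage, latticeBox, Finset.coe_product, Set.mem_prod, Finset.mem_coe,
    boxInterval]
  constructor
  · rintro ⟨i, hi, j, hj, w, hw, rfl⟩
    rw [coord_transVertex, F.coord_of_mem hw, AddEquiv.symm_apply_apply, add_zero]
    exact ⟨Finset.mem_Ico.2 hi, Finset.mem_Ico.2 hj⟩
  · rintro ⟨h1, h2⟩
    refine ⟨_, Finset.mem_Ico.1 h1, _, Finset.mem_Ico.1 h2, _,
      F.transVertex_neg_basis_coord_mem v, ?_⟩
    rw [← transVertex_add, Prod.mk.eta, add_neg_cancel, transVertex_zero]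

lemma finite_verts (hq : Finite P.QuotDart) : F.verts.Finite := by
  choose d hd using fun v : P.Vertex => PermCycle.of_surjective P.rot v
  refine Set.Finite.of_finite_image (f := fun v => Quotient.mk P.dartSetoid (d v))
    (Set.toFinite _) ?_
  intro v hv w hw h
  obtain ⟨x, hx⟩ : ∃ x, P.trans x (d v) = d w := Quotient.exact h
  have h1 : P.transVertex x v = w := by
    rw [← hd v, ← hd w, ← hx]
    rfl
  have h2 := F.coord_transVertex x v
  rw [h1, F.coord_of_mem hv, F.coord_of_mem hw, add_zero] at h2
  have h3 : x = 0 := F.basis.symm.injective (by rw [← h2, map_zero])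
  rw [← h1, h3, transVertex_zero]

lemma preimage_coord_eq_image (X : Set (ℤ × ℤ)) : F.coord ⁻¹' X =
    (fun p : (ℤ × ℤ) × P.Vertex => P.transVertex (F.basis p.1) p.2) '' (X ×ˢ F.verts) := by
  ext v
  constructor
  · intro hv
    refine ⟨(F.coord v, P.transVertex (-F.basis (F.coord v)) v),
      ⟨hv, F.transVertex_neg_basis_coord_mem v⟩, ?_⟩
    change P.transVertex _ (P.transVertex _ v) = v
    rw [← transVertex_add, add_neg_cancel, transVertex_zero]
  · rintro ⟨⟨x, w⟩, ⟨hx, hw⟩, rfl⟩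
    rw [Set.mem_preimage, coord_transVertex, F.coord_of_mem hw, AddEquiv.symm_apply_apply,
      add_zero]
    exact hx

lemma ncard_preimage_coord (X : Set (ℤ × ℤ)) :
    (F.coord ⁻¹' X).ncard = F.verts.ncard * X.ncard := by
  rw [preimage_coord_eq_image, Set.InjOn.ncard_image, Set.ncard_prod, mul_comm]
  rintro ⟨x, v⟩ ⟨-, hv⟩ ⟨y, w⟩ ⟨-, hw⟩ h
  dsimp only at hv hw h
  have h1 := congrArg F.coord h
  rw [coord_transVertex, coord_transVertex, F.coord_of_mem hv, F.coord_of_mem hw, add_zero,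
    add_zero, AddEquiv.symm_apply_apply, AddEquiv.symm_apply_apply] at h1
  subst h1
  exact Prod.ext rfl ((P.transVertexPerm _).injective h)

lemma finite_preimage_coord (hq : Finite P.QuotDart) {X : Set (ℤ × ℤ)} (hX : X.Finite) :
    (F.coord ⁻¹' X).Finite := by
  rw [preimage_coord_eq_image]
  exact (hX.prod (F.finite_verts hq)).image _

lemma finite_boxVerts (hq : Finite P.QuotDart) (n : ℕ) : (F.boxVerts n).Finite := by
  rw [boxVerts_eq]
  exact F.finite_preimage_coord hq (Finset.finite_toSet _)

lemma ncard_boxVerts (n : ℕ) : (F.boxVerts n).ncard = F.verts.ncard * n ^ 2 := by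
  rw [boxVerts_eq, ncard_preimage_coord, Set.ncard_coe_finset, card_latticeBox]

lemma exists_isShort_coord_sub (hq : Finite P.QuotDart) :
    ∃ R, ∀ d, IsShort R (F.coord (P.start (P.rev d)) - F.coord (P.start d)) := by
  refine exists_isShort_of_invariant hq _ fun x d => ?_
  rw [← P.trans_rev, ← transVertex_start, ← transVertex_start, coord_transVertex,
    coord_transVertex, add_sub_add_left_eq_sub]

/-- After the change of basis both coordinates shift equally under translations, so their difference
is invariant, hence bounded. -/
lemma exists_isShort_coord_sub_coord (hq : Finite P.QuotDart) (F' : P.FundamentalDomain) :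
    ∃ R, ∀ v, IsShort R (F'.coord v - F'.basis.symm (F.basis (F.coord v))) := by
  obtain ⟨R, hR⟩ := exists_isShort_of_invariant (P := P) hq
    (fun d => F'.coord (P.start d) - F'.basis.symm (F.basis (F.coord (P.start d))))
    (fun x d => by
      rw [← transVertex_start, coord_transVertex, coord_transVertex, map_add, map_add,
        AddEquiv.apply_symm_apply, add_sub_add_left_eq_sub])
  refine ⟨R, fun v => ?_⟩
  obtain ⟨d, rfl⟩ := PermCycle.of_surjective _ v
  exact hR d

/-- Edges have bounded displacement, so a dart leaving the block starts in a boundary layer of fixed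
width. -/
lemma exists_boundaryCount_le (hq : Finite P.QuotDart) (h3 : P.IsThreeRegular) :
    ∃ C : ℕ, ∀ n, P.boundaryCount (F.boxVerts n) ≤ C * n := by
  obtain ⟨R, hR⟩ := F.exists_isShort_coord_sub hq
  refine ⟨3 * (F.verts.ncard * (4 * R)), fun n => ?_⟩
  have hfin := F.finite_preimage_coord hq (boxLayer n R).finite_toSet
  calc P.boundaryCount (F.boxVerts n)
      ≤ (P.start ⁻¹' (F.coord ⁻¹' boxLayer n R)).ncard := by
        refine Set.ncard_le_ncard ?_ (h3.finite_darts hfin)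
        rintro d ⟨h1, h2⟩
        rw [boxVerts_eq] at h1 h2
        exact mem_boxLayer.2 ⟨h1, _, hR d, h2⟩
    _ = 3 * (F.verts.ncard * (boxLayer n R).card) := by
        rw [h3.ncard_darts hfin, ncard_preimage_coord, Set.ncard_coe_finset]
    _ ≤ 3 * (F.verts.ncard * (4 * R * n)) := by
        gcongr
        exact card_boxLayer_le n R
    _ = _ := by ring

/-- The translate of the block of side `m` with position `x` in the tiling by such blocks. -/
def tile (m : ℕ) (x : ℤ × ℤ) : Set P.Vertex := {v | tileIndex m (F.coord v) = x}

lemma tile_eq_image {m : ℕ} (hm : 1 ≤ m) (x : ℤ × ℤ) :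
    F.tile m x = P.transVertexPerm (F.basis (m • x)) '' F.boxVerts m := by
  ext v
  rw [Equiv.image_eq_preimage_symm, boxVerts_eq]
  change tileIndex m (F.coord v) = x ↔
    F.coord (P.transVertex (-F.basis (m • x)) v) ∈ (latticeBox m : Set (ℤ × ℤ))
  rw [tileIndex_eq_iff hm, coord_transVertex, map_neg, AddEquiv.symm_apply_apply,
    neg_add_eq_sub, Finset.mem_coe]

lemma isShort_coord_sub_of_mem_tile {m : ℕ} (hm : 1 ≤ m) {x : ℤ × ℤ} {u v : P.Vertex}
    (hu : u ∈ F.tile m x) (hv : v ∈ F.tile m x) : IsShort m (F.coord u - F.coord v) := by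
  have h := isShort_sub_of_mem_latticeBox ((tileIndex_eq_iff hm _ _).1 hu)
    ((tileIndex_eq_iff hm _ _).1 hv)
  rwa [sub_sub_sub_cancel_right] at h

lemma pairwise_disjoint_tile (m : ℕ) : Pairwise fun x y => Disjoint (F.tile m x) (F.tile m y) := by
  intro x y hxy
  rw [Set.disjoint_left]
  rintro v hx hy
  exact hxy (hx.symm.trans hy)

end FundamentalDomain

end BiperiodicGraph

/-! ### Independence of the spanning tree entropy of the fundamental domain -/

/-- Choose `t` first, then the tile size `m` depending on `t`, and finally the block size `n`
depending on both; four errors of at most `ε / 4` result, one being `|u m - z|`. -/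
lemma tendsto_of_abs_sub_le {u w : ℕ → ℝ} {z : ℝ} (hu : Tendsto u atTop (𝓝 z)) (A : ℕ → ℝ → ℝ)
    (B : ℝ → ℝ) (h : ∀ t, 0 < t → t ≤ 1 → ∀ m, 1 ≤ m → ∀ n, 1 ≤ n →
      |w n - u m| ≤ A m t / n + B t / m + 3 * t) : Tendsto w atTop (𝓝 z) := by
  rw [Metric.tendsto_atTop]
  intro ε hε
  have h1 : 0 < min 1 (ε / 12) := lt_min one_pos (by positivity)
  set t := min 1 (ε / 12)
  have ht : 3 * t ≤ ε / 4 := by linarith [min_le_right 1 (ε / 12)]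
  have hm := ((tendsto_const_div_atTop_nhds_zero_nat (B t)).eventually_lt_const
    (show (0 : ℝ) < ε / 4 by positivity)).and
    ((Metric.tendsto_nhds.1 hu (ε / 4) (by positivity)).and (eventually_ge_atTop 1))
  obtain ⟨m, hmB, hmu, hm1⟩ := hm.exists
  have hn := ((tendsto_const_div_atTop_nhds_zero_nat (A m t)).eventually_lt_const
    (show (0 : ℝ) < ε / 4 by positivity)).and (eventually_ge_atTop 1)
  obtain ⟨N, hN⟩ := eventually_atTop.1 hn
  refine ⟨N, fun n hnN => ?_⟩
  obtain ⟨hnA, hn1⟩ := hN n hnN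
  have h2 := h t h1 (min_le_left _ _) m hm1 n hn1
  rw [Real.dist_eq] at hmu ⊢
  calc |w n - z| ≤ |w n - u m| + |u m - z| := abs_sub_le _ _ _
    _ < ε := by linarith

namespace BiperiodicGraph

variable {D : Type*} {P : BiperiodicGraph D}

namespace FundamentalDomain

/-- Tiles of one domain have uniformly bounded diameter in the coordinates of the other. -/
lemma exists_isShort_coord_sub_of_mem_tile (hq : Finite P.QuotDart) (F F' : P.FundamentalDomain)
    {m : ℕ} (hm : 1 ≤ m) : ∃ R, ∀ x, ∀ u ∈ F.tile m x, ∀ v ∈ F.tile m x,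
      IsShort R (F'.coord u - F'.coord v) := by
  obtain ⟨R, hR⟩ := F.exists_isShort_coord_sub_coord hq F'
  have hfin : {y : ℤ × ℤ | IsShort m y}.Finite := by
    refine (Set.finite_Icc ((-m, -m) : ℤ × ℤ) (m, m)).subset ?_
    rintro y ⟨h1, h2⟩
    rw [abs_le] at h1 h2
    exact ⟨⟨h1.1, h2.1⟩, ⟨h1.2, h2.2⟩⟩
  obtain ⟨R', hR'⟩ := exists_isShort (hfin.image fun y => F'.basis.symm (F.basis y))
  refine ⟨R + R' + R, fun x u hu v hv => ?_⟩
  have h1 := hR' _ ⟨_, F.isShort_coord_sub_of_mem_tile hm hu hv, rfl⟩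
  have h2 := ((hR u).add h1).add (hR v).neg
  dsimp only at h2
  rw [map_sub, map_sub] at h2
  convert h2 using 1
  abel

open Classical in
/-- The tiles of side `m` that are contained in a finite set of vertices. -/
noncomputable def tilesIn (F : P.FundamentalDomain) (m : ℕ) {W : Set P.Vertex} (hW : W.Finite) :
    Finset (ℤ × ℤ) :=
  (hW.toFinset.image fun v => tileIndex m (F.coord v)).filter fun x => F.tile m x ⊆ W

lemma mem_tilesIn {F : P.FundamentalDomain} {m : ℕ} {W : Set P.Vertex} {hW : W.Finite}
    {x : ℤ × ℤ} : x ∈ F.tilesIn m hW ↔ (∃ v ∈ W, v ∈ F.tile m x) ∧ F.tile m x ⊆ W := by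
  classical
  rw [tilesIn, Finset.mem_filter, Finset.mem_image]
  simp only [Set.Finite.mem_toFinset, tile, Set.mem_ofPred_eq]

lemma finite_tile (hq : Finite P.QuotDart) (F : P.FundamentalDomain) {m : ℕ} (hm : 1 ≤ m)
    (x : ℤ × ℤ) : (F.tile m x).Finite := by
  rw [F.tile_eq_image hm]
  exact (F.finite_boxVerts hq m).image _

lemma ncard_tile (F : P.FundamentalDomain) {m : ℕ} (hm : 1 ≤ m) (x : ℤ × ℤ) :
    (F.tile m x).ncard = F.verts.ncard * m ^ 2 := by
  rw [F.tile_eq_image hm, Set.ncard_image_of_injective _ (Equiv.injective _), ncard_boxVerts]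

lemma ncard_biUnion_tile (hq : Finite P.QuotDart) (F : P.FundamentalDomain) {m : ℕ} (hm : 1 ≤ m)
    (I : Finset (ℤ × ℤ)) :
    (⋃ x ∈ I, F.tile m x).ncard = I.card * (F.verts.ncard * m ^ 2) := by
  have h := I.finite_toSet.ncard_biUnion (s := F.tile m) (fun x _ => F.finite_tile hq hm x)
    (fun x _ y _ hxy => F.pairwise_disjoint_tile m hxy)
  rw [finsum_mem_coe_finset] at h
  simp only [Finset.mem_coe] at h
  rw [h, Finset.sum_congr rfl fun x _ => F.ncard_tile hm x, Finset.sum_const, smul_eq_mul]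

/-- An uncovered vertex lies in a tile that sticks out of the block, hence within bounded distance
of the complement. -/
lemma exists_ncard_diff_tiles_le (hq : Finite P.QuotDart) (F F' : P.FundamentalDomain) {m : ℕ}
    (hm : 1 ≤ m) : ∃ K, ∀ n,
      (F'.boxVerts n \ ⋃ x ∈ F.tilesIn m (F'.finite_boxVerts hq n), F.tile m x).ncard ≤ K * n := by
  obtain ⟨R, hR⟩ := exists_isShort_coord_sub_of_mem_tile hq F F' hm
  refine ⟨F'.verts.ncard * (4 * R), fun n => ?_⟩
  calc _ ≤ (F'.coord ⁻¹' boxLayer n R).ncard := by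
        refine Set.ncard_le_ncard ?_ (F'.finite_preimage_coord hq (boxLayer n R).finite_toSet)
        rintro v ⟨hv, hv'⟩
        rw [Set.mem_iUnion₂] at hv'
        have h1 : ¬ F.tile m (tileIndex m (F.coord v)) ⊆ F'.boxVerts n := fun h =>
          hv' ⟨_, mem_tilesIn.2 ⟨⟨v, hv, rfl⟩, h⟩, rfl⟩
        obtain ⟨u, hu, hu'⟩ := Set.not_subset.1 h1
        rw [boxVerts_eq] at hv hu'
        exact mem_boxLayer.2 ⟨hv, _, hR _ u hu v rfl, hu'⟩
    _ = F'.verts.ncard * (boxLayer n R).card := by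
        rw [ncard_preimage_coord, Set.ncard_coe_finset]
    _ ≤ F'.verts.ncard * (4 * R * n) := by
        gcongr
        exact card_boxLayer_le n R
    _ = _ := by ring

lemma biUnion_edgeSet_tile_subset (F : P.FundamentalDomain) (m : ℕ) {W : Set P.Vertex}
    (hW : W.Finite) : ⋃ x ∈ F.tilesIn m hW, (P.graph.induce (F.tile m x)).edgeSet ⊆
      (P.graph.induce W).edgeSet := by
  refine Set.iUnion₂_subset fun x hx => ?_
  rintro _ ⟨u, v, hl, hu, hv⟩
  exact ⟨u, v, hl, (mem_tilesIn.1 hx).2 hu, (mem_tilesIn.1 hx).2 hv⟩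

lemma numForests_biUnion_tile (F : P.FundamentalDomain) {m : ℕ} (hm : 1 ≤ m)
    (I : Finset (ℤ × ℤ)) :
    P.graph.numForests (⋃ x ∈ I, (P.graph.induce (F.tile m x)).edgeSet) =
      P.graph.numForests (F.box m).edgeSet ^ I.card := by
  rw [Graph.numForests_biUnion I _ fun x _ y _ hxy => F.pairwise_disjoint_tile m hxy,
    Finset.prod_congr rfl fun x _ => by rw [F.tile_eq_image hm, numForests_induce_image],
    Finset.prod_const]
  rfl

/-- An edge inside no tile has a dart that starts at an uncovered vertex, where there are three
darts, or that leaves its tile. -/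
lemma ncard_edgeSet_diff_le (hq : Finite P.QuotDart) (h3 : P.IsThreeRegular)
    (F : P.FundamentalDomain) {m : ℕ} (hm : 1 ≤ m) {W : Set P.Vertex} (hW : W.Finite) :
    ((P.graph.induce W).edgeSet \
        ⋃ x ∈ F.tilesIn m hW, (P.graph.induce (F.tile m x)).edgeSet).ncard ≤
      3 * (W \ ⋃ x ∈ F.tilesIn m hW, F.tile m x).ncard +
        (F.tilesIn m hW).card * P.boundaryCount (F.boxVerts m) := by
  set I := F.tilesIn m hW
  have hfin : (W \ ⋃ x ∈ I, F.tile m x).Finite := hW.sdiff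
  let L : ℤ × ℤ → Set D := fun x => {d | P.start d ∈ F.tile m x ∧ P.start (P.rev d) ∉ F.tile m x}
  have hL : ∀ x, (L x).Finite := fun x =>
    (h3.finite_darts (F.finite_tile hq hm x)).subset fun d hd => hd.1
  have hUfin : (P.start ⁻¹' (W \ ⋃ x ∈ I, F.tile m x) ∪ ⋃ x ∈ I, L x).Finite :=
    (h3.finite_darts hfin).union (I.finite_toSet.biUnion fun x _ => hL x)
  have hsub : (P.graph.induce W).edgeSet \ (⋃ x ∈ I, (P.graph.induce (F.tile m x)).edgeSet) ⊆
      P.edge '' (P.start ⁻¹' (W \ ⋃ x ∈ I, F.tile m x) ∪ ⋃ x ∈ I, L x) := by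
    rintro e ⟨he, he'⟩
    obtain ⟨d, rfl⟩ := P.edge_surjective e
    refine ⟨d, ?_, rfl⟩
    rw [SurfaceGraph.edge_mem_induce_iff] at he
    by_cases hd : P.start d ∈ ⋃ x ∈ I, F.tile m x
    · obtain ⟨x, hx, hdx⟩ := Set.mem_iUnion₂.1 hd
      refine Or.inr (Set.mem_iUnion₂.2 ⟨x, hx, hdx, fun h => he' ?_⟩)
      exact Set.mem_iUnion₂.2 ⟨x, hx, SurfaceGraph.edge_mem_induce_iff.2 ⟨hdx, h⟩⟩
    · exact Or.inl ⟨he.1, hd⟩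
  refine (Set.ncard_le_ncard hsub (hUfin.image _)).trans ((Set.ncard_image_le hUfin).trans
    ((Set.ncard_union_le _ _).trans ?_))
  rw [h3.ncard_darts hfin]
  gcongr
  refine (Finset.set_ncard_biUnion_le _ _).trans (le_of_eq ?_)
  rw [← smul_eq_mul, ← Finset.sum_const]
  refine Finset.sum_congr rfl fun x _ => ?_
  rw [← boundaryCount_image (F.basis (m • x)), ← F.tile_eq_image hm]
  rfl

lemma ncard_edgeSet_induce_le (h3 : P.IsThreeRegular) {W : Set P.Vertex} (hW : W.Finite) :
    (P.graph.induce W).edgeSet.ncard ≤ 3 * W.ncard := by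
  rw [← h3.ncard_darts hW]
  exact (Set.ncard_le_ncard (P.edgeSet_induce_subset W) ((h3.finite_darts hW).image _)).trans
    (Set.ncard_image_le (h3.finite_darts hW))

/-- Here `k` is the number of tiles inside the block of side `n`. Monotonicity of `numForests` gives
the lower bound, `log_numForests_le` the upper one; the lost edges number O(n) near the rim, plus
the perimeters of the tiles. -/
lemma exists_tiling (hq : Finite P.QuotDart) (h3 : P.IsThreeRegular) (F F' : P.FundamentalDomain)
    {m : ℕ} (hm : 1 ≤ m) : ∃ K : ℕ, ∀ n, ∃ k : ℕ,
      k * (F.verts.ncard * m ^ 2) ≤ F'.verts.ncard * n ^ 2 ∧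
      F'.verts.ncard * n ^ 2 ≤ k * (F.verts.ncard * m ^ 2) + K * n ∧
      k * Real.log (P.graph.numForests (F.box m).edgeSet) ≤
        Real.log (P.graph.numForests (F'.box n).edgeSet) ∧
      ∀ t : ℝ, 0 < t → t ≤ 1 → Real.log (P.graph.numForests (F'.box n).edgeSet) ≤
        k * Real.log (P.graph.numForests (F.box m).edgeSet) +
          (3 * (K * n) + k * P.boundaryCount (F.boxVerts m)) * (Real.log 2 - Real.log t) +
          3 * (F'.verts.ncard * n ^ 2) * t := by
  obtain ⟨K, hK⟩ := exists_ncard_diff_tiles_le hq F F' hm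
  refine ⟨K, fun n => ?_⟩
  have hW := F'.finite_boxVerts hq n
  have hKn := hK n
  set I := F.tilesIn m hW
  have hsub : ⋃ x ∈ I, F.tile m x ⊆ F'.boxVerts n :=
    Set.iUnion₂_subset fun x hx => (mem_tilesIn.1 hx).2
  have hsplit := Set.ncard_sdiff_add_ncard_of_subset hsub hW
  rw [ncard_biUnion_tile hq F hm, ncard_boxVerts] at hsplit
  have hNS := F.biUnion_edgeSet_tile_subset m hW
  have hS := h3.finite_edgeSet hW
  have hN : Real.log (P.graph.numForests
      (⋃ x ∈ I, (P.graph.induce (F.tile m x)).edgeSet)) =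
      I.card * Real.log (P.graph.numForests (F.box m).edgeSet) := by
    rw [F.numForests_biUnion_tile hm, Nat.cast_pow, Real.log_pow]
  refine ⟨I.card, by omega, by omega, ?_, fun t ht ht1 => ?_⟩
  · rw [← hN]
    refine Real.log_le_log ?_ ?_
    · exact_mod_cast Graph.one_le_numForests (hS.subset hNS)
    · exact_mod_cast Graph.numForests_mono hNS hS
  · rw [← hN]
    refine (Graph.log_numForests_le hNS hS ht ht1).trans ?_
    have hlog : 0 ≤ Real.log 2 - Real.log t :=
      sub_nonneg.2 (Real.log_le_log ht (ht1.trans one_le_two))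
    have h1 := ncard_edgeSet_diff_le hq h3 F hm hW
    have h2 := ncard_edgeSet_induce_le h3 hW
    rw [ncard_boxVerts] at h2
    gcongr
    · have h4 := h1.trans (Nat.add_le_add_right (Nat.mul_le_mul_left 3 hKn) _)
      exact_mod_cast h4
    · exact_mod_cast h2

lemma one_le_ncard_verts (hq : Finite P.QuotDart) [Nonempty D] (F : P.FundamentalDomain) :
    1 ≤ F.verts.ncard := by
  obtain ⟨d⟩ := ‹Nonempty D›
  obtain ⟨x, hx, -⟩ := F.existsUnique_trans (P.start d)
  exact (Set.ncard_pos (F.finite_verts hq)).2 ⟨_, hx⟩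

/-- Stated for maximal forests, the comparison needs no connectedness of the blocks. The rim of the
block gives an error of order 1/n, the perimeters of the tiles one of order 1/m, and `t` is
arbitrary. -/
lemma tendsto_of_tendsto (hq : Finite P.QuotDart) [Nonempty D] (h3 : P.IsThreeRegular)
    (F F' : P.FundamentalDomain) {z : ℝ}
    (h : Tendsto (fun n : ℕ => Real.log (P.graph.numForests (F.box n).edgeSet) /
      (F.verts.ncard * n ^ 2 : ℝ)) atTop (𝓝 z)) :
    Tendsto (fun n : ℕ => Real.log (P.graph.numForests (F'.box n).edgeSet) /
      (F'.verts.ncard * n ^ 2 : ℝ)) atTop (𝓝 z) := by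
  obtain ⟨C, hC⟩ := F.exists_boundaryCount_le hq h3
  choose! K hK using fun m (hm : 1 ≤ m) => exists_tiling hq h3 F F' hm
  have hp : (1 : ℝ) ≤ F.verts.ncard := by exact_mod_cast F.one_le_ncard_verts hq
  have hp' : (1 : ℝ) ≤ F'.verts.ncard := by exact_mod_cast F'.one_le_ncard_verts hq
  set p : ℝ := (F.verts.ncard : ℝ) with hpdef
  set p' : ℝ := (F'.verts.ncard : ℝ) with hpdef'
  refine tendsto_of_abs_sub_le h
    (fun m t => (K m * (Real.log (P.graph.numForests (F.box m).edgeSet) / (p * m ^ 2)) +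
      3 * K m * (Real.log 2 - Real.log t)) / p')
    (fun t => C * (Real.log 2 - Real.log t) / p) fun t ht ht1 m hm n hn => ?_
  obtain ⟨k, h1, h2, h4, h5⟩ := hK m hm n
  replace h5 := h5 t ht ht1
  have hlog : 0 ≤ Real.log 2 - Real.log t :=
    sub_nonneg.2 (Real.log_le_log ht (ht1.trans one_le_two))
  have hm' : (1 : ℝ) ≤ m := by exact_mod_cast hm
  have hn' : (1 : ℝ) ≤ n := by exact_mod_cast hn
  have h1' : k * (p * m ^ 2) ≤ p' * n ^ 2 := by rw [hpdef, hpdef']; exact_mod_cast h1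
  have h2' : p' * n ^ 2 ≤ k * (p * m ^ 2) + K m * n := by rw [hpdef, hpdef']; exact_mod_cast h2
  have hb : (P.boundaryCount (F.boxVerts m) : ℝ) ≤ C * m := by exact_mod_cast hC m
  have ha : 0 ≤ Real.log (P.graph.numForests (F.box m).edgeSet) := Real.log_natCast_nonneg _
  set a := Real.log (P.graph.numForests (F.box m).edgeSet)
  set β := Real.log (P.graph.numForests (F'.box n).edgeSet)
  set c := Real.log 2 - Real.log t
  set b : ℝ := (P.boundaryCount (F.boxVerts m) : ℝ)
  have hpm : 0 < p * m ^ 2 := by positivity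
  have hpn : 0 < p' * n ^ 2 := by positivity
  set u := a / (p * m ^ 2) with hu
  have hau : a = u * (p * m ^ 2) := by rw [hu]; field_simp
  have hu0 : 0 ≤ u := by positivity
  -- A tile has perimeter at most `C * m` and `p * m ^ 2` vertices, so tile boundaries take up a
  -- proportion of order 1/m.
  have hkb : k * b ≤ p' * n ^ 2 * (C / (p * m)) := by
    calc k * b ≤ k * (C * m) := by gcongr
      _ = k * (p * m ^ 2) * (C / (p * m)) := by field_simp
      _ ≤ _ := by gcongr
  have hK0 : (0 : ℝ) ≤ K m := Nat.cast_nonneg _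
  have hrhs : (K m * u + 3 * K m * c) / p' / n + C * c / p / m + 3 * t =
      (K m * n * u + 3 * (K m * n) * c + p' * n ^ 2 * (C / (p * m)) * c +
        3 * (p' * n ^ 2) * t) / (p' * n ^ 2) := by
    field_simp
  have hlhs : β / (p' * n ^ 2) - u = (β - u * (p' * n ^ 2)) / (p' * n ^ 2) := by
    field_simp
  rw [hrhs, hlhs, abs_div, abs_of_pos hpn]
  gcongr
  have h6 := mul_le_mul_of_nonneg_left h1' hu0
  have h7 := mul_le_mul_of_nonneg_left h2' hu0
  have h8 := mul_le_mul_of_nonneg_right hkb hlog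
  have h9 : 0 ≤ K m * n * u := by positivity
  have h10 : 0 ≤ K m * n * c := by positivity
  have h11 : 0 ≤ p' * n ^ 2 * (C / (p * m)) * c := by positivity
  have h12 : 0 ≤ p' * n ^ 2 * t := by positivity
  have h13 : k * a = u * (k * (p * m ^ 2)) := by rw [hau]; ring
  rw [h13] at h4 h5
  rw [abs_le]
  constructor <;> linarith

lemma admissible_ratio (F : P.FundamentalDomain) (hF : F.Admissible) (n : ℕ) (hn : 1 ≤ n) :
    Real.log (F.box n).numSpanningTrees / ((F.box n).vertexSet.ncard : ℝ) =
      Real.log (P.graph.numForests (F.box n).edgeSet) / (F.verts.ncard * n ^ 2 : ℝ) := by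
  have h1 : (F.box n).numSpanningTrees = P.graph.numForests (F.box n).edgeSet :=
    Graph.numSpanningTrees_eq (P.induce_le _) (hF n hn)
  rw [h1]
  congr 1
  exact_mod_cast F.ncard_boxVerts n

end FundamentalDomain

/-- The limit that defines the spanning tree entropy does not depend on the choice of the
fundamental domain. -/
theorem isSpanningTreeEntropy_of_tendsto (hq : Finite P.QuotDart) [Nonempty D]
    (h3 : P.IsThreeRegular) {F : P.FundamentalDomain} (hF : F.Admissible) {z : ℝ}
    (h : Tendsto (fun n => Real.log (F.box n).numSpanningTrees /
      ((F.box n).vertexSet.ncard : ℝ)) atTop (𝓝 z)) : P.IsSpanningTreeEntropy z := by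
  refine ⟨⟨F, hF⟩, fun F' hF' => ?_⟩
  have h1 := h.congr' ((eventually_ge_atTop 1).mono fun n hn => F.admissible_ratio hF n hn)
  exact (F.tendsto_of_tendsto hq h3 F' h1).congr'
    ((eventually_ge_atTop 1).mono fun n hn => (F'.admissible_ratio hF' n hn).symm)

end BiperiodicGraph

/-! ### The spanning tree entropy of the truncation -/

namespace BiperiodicGraph

variable {D : Type*} {P : BiperiodicGraph D}

/-- The darts of the quotient of the truncation. -/
def truncQuotEquiv (P : BiperiodicGraph D) : P.truncation.QuotDart ≃ P.QuotDart × Fin 3 where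
  toFun := Quotient.lift (fun x => (Quotient.mk P.dartSetoid x.1, x.2)) (by
    rintro ⟨d, i⟩ _ ⟨x, rfl⟩
    exact Prod.ext (Quotient.sound (s := P.dartSetoid) ⟨x, rfl⟩) rfl)
  invFun x := Quotient.lift (fun d => Quotient.mk P.truncation.dartSetoid (d, x.2)) (by
    rintro d _ ⟨y, rfl⟩
    exact Quotient.sound (s := P.truncation.dartSetoid) ⟨y, rfl⟩) x.1
  left_inv := by
    rintro ⟨d, i⟩
    rfl
  right_inv := by
    rintro ⟨⟨d⟩, i⟩
    rfl

lemma truncation_finite_quot (hq : Finite P.QuotDart) : Finite P.truncation.QuotDart :=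
  Finite.of_equiv _ P.truncQuotEquiv.symm

lemma transVertex_truncVertex (x : ℤ × ℤ) (d : D) :
    P.truncation.transVertex x (P.truncVertex d) = P.truncVertex (P.trans x d) := rfl

namespace FundamentalDomain

/-- The fundamental domain of the truncation that corresponds to one of the original graph. -/
def truncation (F : P.FundamentalDomain) : P.truncation.FundamentalDomain where
  basis := F.basis
  verts := P.truncVertex '' (P.start ⁻¹' F.verts)
  existsUnique_trans v := by
    obtain ⟨d, rfl⟩ := truncVertex_surjective v
    simp only [transVertex_truncVertex, truncVertex_mem_image_iff, ← transVertex_start]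
    exact F.existsUnique_trans (P.start d)

variable (F : P.FundamentalDomain)

lemma coord_truncation (d : D) : F.truncation.coord (P.truncVertex d) = F.coord (P.start d) := by
  refine coord_eq_of_mem _ ?_
  rw [transVertex_truncVertex]
  exact truncVertex_mem_image_iff.2 (F.transVertex_neg_basis_coord_mem (P.start d))

lemma boxVerts_truncation (n : ℕ) :
    F.truncation.boxVerts n = P.truncVertex '' (P.start ⁻¹' F.boxVerts n) := by
  ext v
  obtain ⟨d, rfl⟩ := truncVertex_surjective v
  rw [truncVertex_mem_image_iff, boxVerts_eq, boxVerts_eq, Set.mem_preimage, Set.mem_preimage,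
    coord_truncation]

lemma admissible_truncation (h3 : P.IsThreeRegular) (hF : F.Admissible) :
    F.truncation.Admissible := by
  intro n hn
  have h := truncation_induce_isConn h3 (hF n hn)
  rwa [← boxVerts_truncation] at h

lemma log_numSpanningTrees_box_truncation (hq : Finite P.QuotDart) (h3 : P.IsThreeRegular)
    (hF : F.Admissible) {n : ℕ} (hn : 1 ≤ n) :
    Real.log (F.truncation.box n).numSpanningTrees =
      Real.log (F.box n).numSpanningTrees + F.verts.ncard * n ^ 2 * (Real.log 15 / 2) +
        (Real.log 15 - Real.log 9) +
        P.boundaryCount (F.boxVerts n) * (Real.log 3 - Real.log 15 / 2) := by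
  have h := log_numSpanningTrees_truncation h3 (F.finite_boxVerts hq n) (hF n hn)
  rw [← boxVerts_truncation, ncard_boxVerts, Nat.cast_mul, Nat.cast_pow] at h
  exact h

lemma ncard_vertexSet_box_truncation (hq : Finite P.QuotDart) (h3 : P.IsThreeRegular) (n : ℕ) :
    ((F.truncation.box n).vertexSet.ncard : ℝ) = 3 * (F.verts.ncard * n ^ 2) := by
  have h : (F.truncation.boxVerts n).ncard = 3 * (F.verts.ncard * n ^ 2) := by
    rw [boxVerts_truncation, Set.ncard_image_of_injective _ truncVertex_injective,
      h3.ncard_darts (F.finite_boxVerts hq n), ncard_boxVerts]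
  exact_mod_cast h

/-- Divide the exact formula by the number of vertices, which is three times that of the original
block; the constant and the perimeter term are negligible against n². -/
lemma tendsto_truncation (hq : Finite P.QuotDart) [Nonempty D] (h3 : P.IsThreeRegular)
    (hF : F.Admissible) {z : ℝ}
    (h : Tendsto (fun n => Real.log (F.box n).numSpanningTrees /
      ((F.box n).vertexSet.ncard : ℝ)) atTop (𝓝 z)) :
    Tendsto (fun n => Real.log (F.truncation.box n).numSpanningTrees /
      ((F.truncation.box n).vertexSet.ncard : ℝ)) atTop (𝓝 ((z + Real.log 15 / 2) / 3)) := by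
  obtain ⟨C, hC⟩ := F.exists_boundaryCount_le hq h3
  have hp : (1 : ℝ) ≤ F.verts.ncard := by exact_mod_cast F.one_le_ncard_verts hq
  have hlim : Tendsto (fun n : ℕ => (F.verts.ncard * n ^ 2 : ℝ)) atTop atTop :=
    (((tendsto_pow_atTop two_ne_zero).comp tendsto_natCast_atTop_atTop).const_mul_atTop
      (by positivity))
  have h1 : Tendsto (fun n : ℕ => (Real.log 15 - Real.log 9) / (F.verts.ncard * n ^ 2 : ℝ))
      atTop (𝓝 0) := hlim.const_div_atTop _
  have h2 : Tendsto (fun n : ℕ => (P.boundaryCount (F.boxVerts n) : ℝ) /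
      (F.verts.ncard * n ^ 2)) atTop (𝓝 0) := by
    refine squeeze_zero' (Eventually.of_forall fun n => by positivity) ?_
      (tendsto_const_div_atTop_nhds_zero_nat (C : ℝ))
    filter_upwards [eventually_ge_atTop 1] with n hn
    have hn' : (1 : ℝ) ≤ n := by exact_mod_cast hn
    have hb : (P.boundaryCount (F.boxVerts n) : ℝ) ≤ C * n := by exact_mod_cast hC n
    rw [div_le_div_iff₀ (by positivity) (by positivity)]
    calc (P.boundaryCount (F.boxVerts n) : ℝ) * n ≤ C * n * n := by gcongr
      _ = C * (1 * n ^ 2) := by ring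
      _ ≤ C * (F.verts.ncard * n ^ 2) := by gcongr
  have h3' := (((h.add_const (Real.log 15 / 2)).add h1).add
    (h2.mul_const (Real.log 3 - Real.log 15 / 2))).div_const 3
  rw [zero_mul, add_zero, add_zero] at h3'
  refine h3'.congr' ?_
  filter_upwards [eventually_ge_atTop 1] with n hn
  have hn' : (1 : ℝ) ≤ n := by exact_mod_cast hn
  have hcard : ((F.box n).vertexSet.ncard : ℝ) = F.verts.ncard * n ^ 2 := by
    exact_mod_cast F.ncard_boxVerts n
  rw [F.log_numSpanningTrees_box_truncation hq h3 hF hn,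
    F.ncard_vertexSet_box_truncation hq h3 n, hcard]
  field_simp

end FundamentalDomain

/-- The spanning tree entropy of the truncation. -/
theorem IsSpanningTreeEntropy.truncation (hq : Finite P.QuotDart) [Nonempty D]
    (h3 : P.IsThreeRegular) {z : ℝ} (hz : P.IsSpanningTreeEntropy z) :
    P.truncation.IsSpanningTreeEntropy ((z + Real.log 15 / 2) / 3) := by
  obtain ⟨⟨F, hF⟩, hlim⟩ := hz
  have : Nonempty (D × Fin 3) := inferInstance
  exact isSpanningTreeEntropy_of_tendsto (truncation_finite_quot hq) truncation_isThreeRegular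
    (F.admissible_truncation h3 hF) (F.tendsto_truncation hq h3 hF (hlim F hF))

end BiperiodicGraph

/-! ### Estimates of bipyramid volumes -/

section Lobachevsky

lemma intervalIntegrable_log_sin_apply (a b : ℝ) :
    IntervalIntegrable (fun t => Real.log (Real.sin t)) MeasureTheory.volume a b :=
  intervalIntegrable_log_sin

lemma intervalIntegrable_log_cos_apply (a b : ℝ) :
    IntervalIntegrable (fun t => Real.log (Real.cos t)) MeasureTheory.volume a b :=
  intervalIntegrable_log_cos

open Real in
lemma lobachevsky_eq {θ : ℝ} (h0 : 0 ≤ θ) (hπ : θ ≤ π) :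
    lobachevsky θ = -(θ * log 2) - ∫ t in (0 : ℝ)..θ, log (sin t) := by
  have h1 : ∫ t in (0 : ℝ)..θ, log |2 * sin t| = ∫ t in (0 : ℝ)..θ, (log 2 + log (sin t)) := by
    refine intervalIntegral.integral_congr_Ioo_of_le h0 fun t ht => ?_
    have hs : sin t ≠ 0 := (sin_pos_of_pos_of_lt_pi ht.1 (ht.2.trans_le hπ)).ne'
    exact (log_abs _).trans (log_mul two_ne_zero hs)
  rw [lobachevsky, h1, intervalIntegral.integral_add intervalIntegrable_const
    (intervalIntegrable_log_sin_apply _ _), intervalIntegral.integral_const, sub_zero, smul_eq_mul]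
  ring

open Real in
-- Substitute `2 * t` and use sin 2t = 2 sin t cos t.
lemma integral_log_sin_two_mul {θ : ℝ} (h0 : 0 ≤ θ) (hπ : θ ≤ π / 2) :
    ∫ t in (0 : ℝ)..2 * θ, log (sin t) = 2 * θ * log 2 +
      2 * (∫ t in (0 : ℝ)..θ, log (sin t)) + 2 * ∫ t in (0 : ℝ)..θ, log (cos t) := by
  have h1 := intervalIntegral.integral_comp_mul_left (a := 0) (b := θ) (fun t => log (sin t))
    (two_ne_zero (α := ℝ))
  have h2 : ∫ t in (0 : ℝ)..θ, log (sin (2 * t)) =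
      ∫ t in (0 : ℝ)..θ, (log 2 + log (sin t) + log (cos t)) := by
    refine intervalIntegral.integral_congr_Ioo_of_le h0 fun t ht => ?_
    have hs : 0 < sin t := sin_pos_of_pos_of_lt_pi ht.1 (by linarith [ht.2, pi_pos])
    have hc : 0 < cos t := cos_pos_of_mem_Ioo ⟨by linarith [ht.1, pi_pos], ht.2.trans_le hπ⟩
    rw [sin_two_mul, log_mul (by positivity) hc.ne', log_mul two_ne_zero hs.ne']
  rw [intervalIntegral.integral_add (intervalIntegrable_const.add
    (intervalIntegrable_log_sin_apply _ _)) (intervalIntegrable_log_cos_apply _ _),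
    intervalIntegral.integral_add intervalIntegrable_const (intervalIntegrable_log_sin_apply _ _),
    intervalIntegral.integral_const, sub_zero, smul_eq_mul] at h2
  rw [mul_zero, h2, smul_eq_mul] at h1
  linarith

lemma integral_log_cos_nonpos {θ : ℝ} (h0 : 0 ≤ θ) :
    ∫ t in (0 : ℝ)..θ, Real.log (Real.cos t) ≤ 0 := by
  have h := intervalIntegral.integral_nonneg (μ := MeasureTheory.volume)
    (f := fun t => -Real.log (Real.cos t)) h0
    fun t _ => by
      rw [neg_nonneg, ← Real.log_abs]
      exact Real.log_nonpos (abs_nonneg _) (Real.abs_cos_le_one t)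
  rw [intervalIntegral.integral_neg] at h
  linarith

open Real in
-- By the duplication formula the two sides differ by -2 ∫ log cos, which is nonnegative.
lemma lobachevsky_le_lobachevsky_two_mul {θ : ℝ} (h0 : 0 ≤ θ) (hπ : θ ≤ π / 2) :
    2 * lobachevsky θ ≤ lobachevsky (2 * θ) + 2 * θ * log 2 := by
  rw [lobachevsky_eq h0 (by linarith [pi_pos]), lobachevsky_eq (by linarith) (by linarith),
    integral_log_sin_two_mul h0 hπ]
  linarith [integral_log_cos_nonpos h0]

/-- Doubling the number of sides of a regular ideal bipyramid. -/
lemma volB_two_mul_le {k : ℕ} (hk : 1 ≤ k) :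
    volB (2 * k) ≤ volB k + 2 * Real.pi * Real.log 2 := by
  have hk' : (1 : ℝ) ≤ k := by exact_mod_cast hk
  have hpi := Real.pi_pos
  have h := lobachevsky_le_lobachevsky_two_mul (θ := Real.pi / (2 * k)) (by positivity)
    (by gcongr; linarith)
  have h2 : 2 * (Real.pi / (2 * k)) = Real.pi / k := by field_simp
  rw [h2] at h
  rw [volB, volB, Nat.cast_mul, Nat.cast_ofNat]
  calc 2 * (2 * (k : ℝ)) * lobachevsky (Real.pi / (2 * k))
      = 2 * k * (2 * lobachevsky (Real.pi / (2 * k))) := by ring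
    _ ≤ 2 * k * (lobachevsky (Real.pi / k) + Real.pi / k * Real.log 2) := by gcongr
    _ = _ := by field_simp

open Real in
-- The reflection t ↦ π/2 - t carries the integral to that of log sin over [π/3, π/2], and the
-- integral over [0, π/2] is known.
lemma integral_log_cos_pi_div_six :
    ∫ t in (0 : ℝ)..(π / 6), log (cos t) =
      -log 2 * π / 2 - ∫ t in (0 : ℝ)..(π / 3), log (sin t) := by
  have h1 := intervalIntegral.integral_comp_sub_left (a := 0) (b := π / 6)
    (fun t => log (sin t)) (π / 2)
  simp only [sin_pi_div_two_sub] at h1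
  have h2 : π / 2 - π / 6 = π / 3 := by ring
  rw [h1, h2, sub_zero, ← integral_log_sin_zero_pi_div_two, eq_sub_iff_add_eq, add_comm]
  exact intervalIntegral.integral_add_adjacent_intervals intervalIntegrable_log_sin
    intervalIntegrable_log_sin

open Real in
lemma lobachevsky_pi_div_three : lobachevsky (π / 3) = 2 / 3 * lobachevsky (π / 6) := by
  have hpi := pi_pos
  have h := integral_log_sin_two_mul (θ := π / 6) (by positivity) (by linarith)
  have h2 : 2 * (π / 6) = π / 3 := by ring
  rw [h2, integral_log_cos_pi_div_six] at h
  rw [lobachevsky_eq (by positivity) (by linarith), lobachevsky_eq (by positivity) (by linarith)]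
  linarith

open Real in
-- By concavity sin t ≥ 3t/π on [0, π/6]. Integrating the logarithm of this chord gives exactly π/6,
-- because 3/π · π/6 = 1/2 cancels the term log 2.
lemma lobachevsky_pi_div_six_le : lobachevsky (π / 6) ≤ π / 6 := by
  have hpi := pi_pos
  rw [lobachevsky_eq (by positivity) (by linarith)]
  have hle : ∫ t in (0 : ℝ)..(π / 6), (log (3 / π) + log t) ≤
      ∫ t in (0 : ℝ)..(π / 6), log (sin t) := by
    refine intervalIntegral.integral_mono_on_of_le_Ioo (by positivity)
      (intervalIntegrable_const.add intervalIntegral.intervalIntegrable_log')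
      intervalIntegrable_log_sin fun t ht => ?_
    have ht0 := ht.1
    have ht1 : 6 / π * t ≤ 1 := by
      have h4 : 6 / π * t ≤ 6 / π * (π / 6) := by gcongr; exact ht.2.le
      have h5 : 6 / π * (π / 6) = 1 := by field_simp
      linarith
    have hc := strictConcaveOn_sin_Icc.concaveOn.2
      (show (0 : ℝ) ∈ Set.Icc 0 π from ⟨le_rfl, hpi.le⟩)
      (show π / 6 ∈ Set.Icc 0 π from ⟨by positivity, by linarith⟩) (sub_nonneg.2 ht1)
      (show 0 ≤ 6 / π * t by positivity) (sub_add_cancel _ _)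
    rw [sin_zero, sin_pi_div_six] at hc
    simp only [smul_eq_mul, mul_zero, zero_add] at hc
    have h3 : 6 / π * t * (π / 6) = t := by field_simp
    rw [h3] at hc
    rw [← log_mul (by positivity) ht0.ne']
    refine log_le_log (by positivity) (le_trans (le_of_eq ?_) hc)
    ring
  have h1 : log (3 / π) + log (π / 6) = -log 2 := by
    rw [← log_mul (by positivity) (by positivity), ← log_inv]
    congr 1
    field_simp
    norm_num
  rw [intervalIntegral.integral_add intervalIntegrable_const
    intervalIntegral.intervalIntegrable_log', intervalIntegral.integral_const, integral_log,
    smul_eq_mul] at hle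
  have h2 : π / 6 * log (3 / π) + π / 6 * log (π / 6) = -(π / 6 * log 2) := by
    rw [← mul_add, h1, mul_neg]
  linarith

open Real in
-- Integrate the logarithm of the bound sin t ≤ t.
lemma le_lobachevsky_pi_div_four : π / 4 * (1 - log (π / 2)) ≤ lobachevsky (π / 4) := by
  have hpi := pi_pos
  rw [lobachevsky_eq (by positivity) (by linarith)]
  have hle : ∫ t in (0 : ℝ)..(π / 4), log (sin t) ≤ ∫ t in (0 : ℝ)..(π / 4), log t := by
    refine intervalIntegral.integral_mono_on_of_le_Ioo (by positivity)
      intervalIntegrable_log_sin intervalIntegral.intervalIntegrable_log' fun t ht => ?_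
    exact log_le_log (sin_pos_of_pos_of_lt_pi ht.1 (by linarith [ht.2])) (sin_le ht.1.le)
  have h2 : log (π / 2) = log (π / 4) + log 2 := by
    rw [← log_mul (by positivity) two_ne_zero]
    congr 1
    ring
  rw [integral_log] at hle
  rw [h2]
  linarith

open Real in
-- Since vol(B_3) = 4 Λ(π/6) ≤ 2π/3, it is enough that 2 < log (15/2), that is, e² < 7.5.
lemma three_mul_volB_three_lt : 3 * volB 3 + π * log 2 < π * log 15 := by
  have hpi := pi_pos
  have h1 := lobachevsky_pi_div_six_le
  have h2 : 2 < log 15 - log 2 := by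
    rw [← log_div (by norm_num) (by norm_num), lt_log_iff_exp_lt (by norm_num),
      ← one_add_one_eq_two, exp_add]
    nlinarith [exp_one_lt_d9, exp_pos 1]
  rw [volB, Nat.cast_ofNat, lobachevsky_pi_div_three]
  nlinarith

open Real in
-- Since 3 v_oct = 24 Λ(π/4) ≥ 6π (1 - log (π/2)), it is enough that 15 (π/2)⁶ < e⁶, which follows
-- from π/2 < 1.6 and 2.7 < e.
lemma pi_mul_log_fifteen_lt : π * log 15 < 3 * vOct := by
  have hpi := pi_pos
  have h1 := le_lobachevsky_pi_div_four
  have h2 : log 15 + 6 * log (π / 2) < 6 := by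
    have h3 : π / 2 < 1.6 := by linarith [pi_lt_d2]
    have h4 : log (π / 2) < log 1.6 := log_lt_log (by positivity) h3
    have h5 : log 15 + 6 * log 1.6 < 6 := by
      have h6 : log (15 * 1.6 ^ 6) = log 15 + 6 * log 1.6 := by
        rw [log_mul (by norm_num) (by norm_num), log_pow, Nat.cast_ofNat]
      rw [← h6, log_lt_iff_lt_exp (by norm_num)]
      have h7 : exp 6 = exp 1 ^ 6 := by rw [← exp_nat_mul]; norm_num
      rw [h7]
      calc (15 * 1.6 ^ 6 : ℝ) < 2.7 ^ 6 := by norm_num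
        _ ≤ exp 1 ^ 6 := by
          gcongr
          linarith [exp_one_gt_d9]
    linarith
  rw [vOct, volB, Nat.cast_ofNat]
  nlinarith

end Lobachevsky

/-! ### Counting cycles of permutations -/

namespace PermCycle

lemma minimalPeriod_eq_three {p : X → X} {d : X} (h : p (p (p d)) = d) (h1 : p d ≠ d) :
    Function.minimalPeriod p d = 3 := Function.minimalPeriod_eq_prime (p := 3) h h1

variable {X : Type*} [Finite X] (p : Equiv.Perm X)

lemma length_of (d : X) : (PermCycle.of p d).length = Function.minimalPeriod p d := by
  have : Fintype (MulAction.orbit (Subgroup.zpowers p) d) := Fintype.ofFinite _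
  have h := MulAction.minimalPeriod_eq_card (a := p) (b := d)
  change Function.minimalPeriod p d = _ at h
  rw [h, ← Nat.card_eq_fintype_card, PermCycle.length]
  refine Nat.card_congr (Equiv.subtypeEquivRight fun d' => ?_)
  rw [eq_comm, of_eq_of_iff, MulAction.mem_orbit_iff]
  constructor
  · rintro ⟨k, hk⟩
    exact ⟨⟨p ^ k, k, rfl⟩, hk⟩
  · rintro ⟨⟨_, k, rfl⟩, hk⟩
    exact ⟨k, hk⟩

lemma minimalPeriod_pos (d : X) : 0 < Function.minimalPeriod p d :=
  Function.minimalPeriod_pos_of_mem_periodicPts (p.injective.mem_periodicPts d)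

/-- Each cycle is spread evenly over its points. Sums over faces or vertices thus become sums over
darts, which are easy to compare under truncation. -/
lemma finsum_length {X : Type*} [Fintype X] (p : Equiv.Perm X) (g : ℕ → ℝ) :
    ∑ᶠ c : PermCycle p, g c.length =
      ∑ d, g (Function.minimalPeriod p d) / Function.minimalPeriod p d := by
  classical
  have : Finite (PermCycle p) := Finite.of_surjective _ (of_surjective p)
  have : Fintype (PermCycle p) := Fintype.ofFinite _
  rw [finsum_eq_sum_of_fintype, ← Finset.sum_fiberwise Finset.univ (PermCycle.of p)]
  refine Finset.sum_congr rfl fun c _ => ?_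
  obtain ⟨d, rfl⟩ := of_surjective p c
  have h : ∀ d' ∈ Finset.univ.filter (fun d' => PermCycle.of p d' = PermCycle.of p d),
      g (Function.minimalPeriod p d') / Function.minimalPeriod p d' =
        g (PermCycle.of p d).length / (PermCycle.of p d).length := fun d' hd' => by
    rw [← length_of, (Finset.mem_filter.1 hd').2]
  have hcard : (Finset.univ.filter (fun d' => PermCycle.of p d' = PermCycle.of p d)).card =
      (PermCycle.of p d).length := by
    rw [PermCycle.length, Nat.card_eq_fintype_card, Fintype.card_subtype]
  have hpos : ((PermCycle.of p d).length : ℝ) ≠ 0 := by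
    rw [length_of]
    exact_mod_cast (minimalPeriod_pos p d).ne'
  rw [Finset.sum_congr rfl h, Finset.sum_const, hcard, nsmul_eq_mul, mul_div_cancel₀ _ hpos]

lemma card_eq_sum {X : Type*} [Fintype X] (p : Equiv.Perm X) :
    (Nat.card (PermCycle p) : ℝ) = ∑ d, 1 / (Function.minimalPeriod p d : ℝ) := by
  have : Finite (PermCycle p) := Finite.of_surjective _ (of_surjective p)
  have : Fintype (PermCycle p) := Fintype.ofFinite _
  rw [← finsum_length p fun _ => 1, finsum_eq_sum_of_fintype, Finset.sum_const,
    Nat.card_eq_fintype_card, nsmul_eq_mul, mul_one, Finset.card_univ]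

lemma card_eq_div {X : Type*} [Fintype X] {p : Equiv.Perm X} {k : ℕ}
    (hp : ∀ d, Function.minimalPeriod p d = k) :
    (Nat.card (PermCycle p) : ℝ) = Fintype.card X / k := by
  simp only [card_eq_sum, hp, Finset.sum_const, Finset.card_univ, nsmul_eq_mul, mul_one_div]

end PermCycle

namespace SurfaceGraph

lemma dual_facePerm {X : Type*} (M : SurfaceGraph X) : M.dual.facePerm = M.rot :=
  Equiv.ext fun d => congrArg M.rot (M.rev_rev d)

variable {X : Type*} [Fintype X] (M : SurfaceGraph X)

lemma bipyramidVolume_eq : M.bipyramidVolume =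
    ∑ d, volB (Function.minimalPeriod M.facePerm d) / Function.minimalPeriod M.facePerm d :=
  PermCycle.finsum_length M.facePerm volB

lemma dual_bipyramidVolume_eq {k : ℕ} (hk : ∀ d, Function.minimalPeriod M.rot d = k) :
    M.dual.bipyramidVolume = Fintype.card X * (volB k / k) := by
  simp only [bipyramidVolume_eq, dual_facePerm, hk, Finset.sum_const, Finset.card_univ,
    nsmul_eq_mul]

lemma card_edge : (Nat.card M.Edge : ℝ) = Fintype.card X / 2 :=
  PermCycle.card_eq_div (k := 2) fun d =>
    Function.minimalPeriod_eq_prime (p := 2) (M.rev_rev d) (M.rev_ne d)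

end SurfaceGraph

/-! ### Bipyramid volumes of the quotient of the truncation -/

namespace BiperiodicGraph

variable {D : Type*} {P : BiperiodicGraph D}

lemma quot_rot_mk (d : D) :
    P.quot.rot (Quotient.mk P.dartSetoid d) = Quotient.mk P.dartSetoid (P.rot d) := rfl

lemma IsThreeRegular.quot_rot_cube (h3 : P.IsThreeRegular) (q : P.QuotDart) :
    P.quot.rot (P.quot.rot (P.quot.rot q)) = q := by
  obtain ⟨d, rfl⟩ := Quotient.exists_rep q
  rw [quot_rot_mk, quot_rot_mk, quot_rot_mk, h3.rot_cube]

/-- If a translation `x` carried `rot d` to `d`, then `3x` would fix `d`; the action is free and the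
lattice has no torsion, so `x = 0`. -/
lemma IsThreeRegular.quot_rot_ne (h3 : P.IsThreeRegular) (q : P.QuotDart) : P.quot.rot q ≠ q := by
  obtain ⟨d, rfl⟩ := Quotient.exists_rep q
  rw [quot_rot_mk]
  intro h
  obtain ⟨x, hx⟩ : ∃ x, P.trans x (P.rot d) = d := Quotient.exact h
  have h1 : P.trans (x + x + x) d = d := by
    conv_lhs => rw [← h3.rot_cube d]
    rw [P.trans_add, P.trans_add, P.trans_rot x (P.rot (P.rot d)), P.trans_rot x (P.rot d), hx,
      P.trans_rot x (P.rot d), hx, hx]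
  have h2 := P.trans_free _ _ h1
  have h4 := congrArg Prod.fst h2
  have h5 := congrArg Prod.snd h2
  simp only [Prod.fst_add, Prod.snd_add, Prod.fst_zero, Prod.snd_zero] at h4 h5
  have h6 : x = 0 := Prod.ext (by change x.1 = 0; omega) (by change x.2 = 0; omega)
  rw [h6, P.trans_zero] at hx
  exact h3.rot_ne d hx

lemma IsThreeRegular.minimalPeriod_quot_rot (h3 : P.IsThreeRegular) [Finite P.QuotDart]
    (q : P.QuotDart) : Function.minimalPeriod P.quot.rot q = 3 :=
  PermCycle.minimalPeriod_eq_three (h3.quot_rot_cube q) (h3.quot_rot_ne q)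

lemma truncation_quot_facePerm_zero (q : P.QuotDart) :
    P.truncation.quot.facePerm (P.truncQuotEquiv.symm (q, 0)) =
      P.truncQuotEquiv.symm (P.quot.rev q, 1) := by
  obtain ⟨d, rfl⟩ := Quotient.exists_rep q
  rfl

lemma truncation_quot_facePerm_one (q : P.QuotDart) :
    P.truncation.quot.facePerm (P.truncQuotEquiv.symm (q, 1)) =
      P.truncQuotEquiv.symm (P.quot.rot q, 0) := by
  obtain ⟨d, rfl⟩ := Quotient.exists_rep q
  have h : P.truncation.facePerm (d, 1) = (P.rot d, 0) :=
    Prod.ext rfl (by decide : (2 : Fin 3) + 1 = 0)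
  exact congrArg (Quotient.mk P.truncation.dartSetoid) h

lemma truncation_quot_facePerm_two (q : P.QuotDart) :
    P.truncation.quot.facePerm (P.truncQuotEquiv.symm (q, 2)) =
      P.truncQuotEquiv.symm (P.quot.rot.symm q, 2) := by
  obtain ⟨d, rfl⟩ := Quotient.exists_rep q
  rfl

/-- Along an old face the truncation alternates between old edges and triangle edges, so two steps
upstairs make one step on the original face. -/
lemma truncation_quot_facePerm_iterate (q : P.QuotDart) (k : ℕ) :
    P.truncation.quot.facePerm^[2 * k] (P.truncQuotEquiv.symm (q, 0)) =
      P.truncQuotEquiv.symm (P.quot.facePerm^[k] q, 0) := by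
  induction k with
  | zero => rfl
  | succ k ih =>
    rw [mul_add, mul_one, add_comm, Function.iterate_add_apply, ih,
      Function.iterate_succ_apply']
    change P.truncation.quot.facePerm (P.truncation.quot.facePerm _) = _
    rw [truncation_quot_facePerm_zero, truncation_quot_facePerm_one,
      Function.iterate_succ_apply']
    rfl

/-- An odd number of steps ends on a triangle edge, so the period is even, and even iterates are
those of the original face. -/
lemma minimalPeriod_truncation_quot_facePerm_zero (q : P.QuotDart) :
    Function.minimalPeriod P.truncation.quot.facePerm (P.truncQuotEquiv.symm (q, 0)) =
      2 * Function.minimalPeriod P.quot.facePerm q := by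
  refine Nat.dvd_antisymm ?_ ?_
  · rw [← Function.isPeriodicPt_iff_minimalPeriod_dvd, Function.IsPeriodicPt, Function.IsFixedPt,
      truncation_quot_facePerm_iterate, Function.iterate_minimalPeriod]
  · have h := Function.iterate_minimalPeriod (f := P.truncation.quot.facePerm)
      (x := P.truncQuotEquiv.symm (q, 0))
    obtain ⟨k, hk | hk⟩ := Nat.even_or_odd'
      (Function.minimalPeriod P.truncation.quot.facePerm (P.truncQuotEquiv.symm (q, 0)))
    · rw [hk, truncation_quot_facePerm_iterate] at h
      rw [hk]
      refine mul_dvd_mul_left 2 (Function.isPeriodicPt_iff_minimalPeriod_dvd.1 ?_)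
      exact congrArg Prod.fst (P.truncQuotEquiv.symm.injective h)
    · rw [hk, Function.iterate_succ_apply', truncation_quot_facePerm_iterate,
        truncation_quot_facePerm_zero] at h
      exact absurd (congrArg Prod.snd (P.truncQuotEquiv.symm.injective h))
        (by decide : ¬ (1 : Fin 3) = 0)

lemma minimalPeriod_truncation_quot_facePerm_one (hq : Finite P.QuotDart) (q : P.QuotDart) :
    Function.minimalPeriod P.truncation.quot.facePerm (P.truncQuotEquiv.symm (q, 1)) =
      2 * Function.minimalPeriod P.quot.facePerm (P.quot.rot q) := by
  have := truncation_finite_quot hq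
  rw [← Function.minimalPeriod_apply (P.truncation.quot.facePerm.injective.mem_periodicPts _),
    truncation_quot_facePerm_one, minimalPeriod_truncation_quot_facePerm_zero]

lemma IsThreeRegular.minimalPeriod_truncation_quot_facePerm_two (h3 : P.IsThreeRegular)
    (hq : Finite P.QuotDart) (q : P.QuotDart) :
    Function.minimalPeriod P.truncation.quot.facePerm (P.truncQuotEquiv.symm (q, 2)) = 3 := by
  have := truncation_finite_quot hq
  refine PermCycle.minimalPeriod_eq_three ?_ ?_
  · simp only [truncation_quot_facePerm_two]
    congr 2
    rw [Equiv.symm_apply_eq, Equiv.symm_apply_eq, Equiv.symm_apply_eq, h3.quot_rot_cube]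
  · rw [truncation_quot_facePerm_two]
    intro h
    have h1 := congrArg Prod.fst (P.truncQuotEquiv.symm.injective h)
    exact h3.quot_rot_ne q ((Equiv.symm_apply_eq _).1 h1).symm

/-- Darts of types 0 and 1 lie on the old faces, now of doubled degree; darts of type 2 trace the
new triangles. The two types sharing a face cancel the factor 2 in the denominator. -/
lemma IsThreeRegular.truncation_quot_bipyramidVolume (h3 : P.IsThreeRegular)
    [Fintype P.QuotDart] : P.truncation.quot.bipyramidVolume =
      ∑ q, volB (2 * Function.minimalPeriod P.quot.facePerm q) /
        Function.minimalPeriod P.quot.facePerm q + Fintype.card P.QuotDart * (volB 3 / 3) := by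
  have hq : Finite P.QuotDart := inferInstance
  have : Fintype P.truncation.QuotDart := Fintype.ofEquiv _ P.truncQuotEquiv.symm
  rw [SurfaceGraph.bipyramidVolume_eq, ← Equiv.sum_comp P.truncQuotEquiv.symm,
    Fintype.sum_prod_type]
  simp only [Fin.sum_univ_three, minimalPeriod_truncation_quot_facePerm_zero,
    minimalPeriod_truncation_quot_facePerm_one hq,
    h3.minimalPeriod_truncation_quot_facePerm_two hq, Finset.sum_add_distrib]
  rw [Equiv.sum_comp P.quot.rot fun q => volB (2 * Function.minimalPeriod P.quot.facePerm q) /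
      ((2 * Function.minimalPeriod P.quot.facePerm q : ℕ) : ℝ), ← Finset.sum_add_distrib,
    Finset.sum_const, Finset.card_univ, nsmul_eq_mul, Nat.cast_ofNat]
  congr 1
  refine Finset.sum_congr rfl fun q _ => ?_
  rw [Nat.cast_mul, Nat.cast_ofNat]
  have := (PermCycle.minimalPeriod_pos P.quot.facePerm q).ne'
  field_simp
  norm_num

lemma IsThreeRegular.nuLozenge_eq (h3 : P.IsThreeRegular) [Fintype P.QuotDart] :
    P.nuLozenge = (∑ q, volB (Function.minimalPeriod P.quot.facePerm q) /
      Function.minimalPeriod P.quot.facePerm q + Fintype.card P.QuotDart * (volB 3 / 3)) /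
        (Fintype.card P.QuotDart / 3) := by
  rw [nuLozenge, SurfaceGraph.dual_bipyramidVolume_eq _ h3.minimalPeriod_quot_rot,
    SurfaceGraph.bipyramidVolume_eq, PermCycle.card_eq_div h3.minimalPeriod_quot_rot,
    Nat.cast_ofNat]

lemma IsThreeRegular.nuBar_eq (h3 : P.IsThreeRegular) (hq : Finite P.QuotDart) [Nonempty D] :
    P.nuBar = 3 / 2 * vOct := by
  have : Fintype P.QuotDart := Fintype.ofFinite _
  obtain ⟨d⟩ := ‹Nonempty D›
  have : Nonempty P.QuotDart := ⟨Quotient.mk _ d⟩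
  have h : (Fintype.card P.QuotDart : ℝ) ≠ 0 := by exact_mod_cast Fintype.card_ne_zero
  rw [nuBar, SurfaceGraph.card_edge, PermCycle.card_eq_div h3.minimalPeriod_quot_rot,
    Nat.cast_ofNat]
  field_simp

lemma IsThreeRegular.nuLozenge_truncation_eq (h3 : P.IsThreeRegular) [Fintype P.QuotDart] :
    P.truncation.nuLozenge = (∑ q, volB (2 * Function.minimalPeriod P.quot.facePerm q) /
      Function.minimalPeriod P.quot.facePerm q + 4 * Fintype.card P.QuotDart * (volB 3 / 3)) /
        Fintype.card P.QuotDart := by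
  have : Fintype P.truncation.QuotDart := Fintype.ofEquiv _ P.truncQuotEquiv.symm
  have hcard : (Fintype.card P.truncation.QuotDart : ℝ) = Fintype.card P.QuotDart * 3 := by
    rw [Fintype.card_congr P.truncQuotEquiv, Fintype.card_prod, Fintype.card_fin, Nat.cast_mul,
      Nat.cast_ofNat]
  rw [nuLozenge, SurfaceGraph.dual_bipyramidVolume_eq _
      truncation_isThreeRegular.minimalPeriod_quot_rot, h3.truncation_quot_bipyramidVolume,
    PermCycle.card_eq_div truncation_isThreeRegular.minimalPeriod_quot_rot, hcard, Nat.cast_ofNat,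
    mul_div_cancel_right₀ _ three_ne_zero]
  congr 1
  ring

/-- The number of faces of the quotient, computed from the Euler characteristic. -/
lemma IsThreeRegular.sum_one_div_minimalPeriod (h3 : P.IsThreeRegular) [Fintype P.QuotDart]
    (he : (Nat.card P.quot.Vertex : ℤ) - Nat.card P.quot.Edge + Nat.card P.quot.Face = 0) :
    ∑ q, 1 / (Function.minimalPeriod P.quot.facePerm q : ℝ) = Fintype.card P.QuotDart / 6 := by
  have he' : (Nat.card P.quot.Vertex : ℝ) - Nat.card P.quot.Edge + Nat.card P.quot.Face = 0 := by
    exact_mod_cast he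
  rw [PermCycle.card_eq_div h3.minimalPeriod_quot_rot, SurfaceGraph.card_edge,
    PermCycle.card_eq_sum, Nat.cast_ofNat] at he'
  linarith

/-- With |V|/2 faces, doubling costs at most π log 2 per old vertex. Each old vertex also yields
four copies of vol(B_3), from its triangle and its three new vertices, in place of one. The excess 3
vol(B_3) + π log 2 is below π log 15, and the number of vertices triples. -/
lemma IsThreeRegular.nuLozenge_truncation_lt (h3 : P.IsThreeRegular)
    (hP : P.IsPlanarLatticeGraph) :
    P.truncation.nuLozenge < (P.nuLozenge + Real.pi * Real.log 15) / 3 := by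
  have := hP.finite_quot
  have : Fintype P.QuotDart := Fintype.ofFinite _
  obtain ⟨d⟩ := hP.nonempty
  have : Nonempty P.QuotDart := ⟨Quotient.mk _ d⟩
  have hN : (0 : ℝ) < Fintype.card P.QuotDart := by exact_mod_cast Fintype.card_pos
  have hsum : ∑ q, volB (2 * Function.minimalPeriod P.quot.facePerm q) /
      (Function.minimalPeriod P.quot.facePerm q : ℝ) ≤
      ∑ q, volB (Function.minimalPeriod P.quot.facePerm q) /
        (Function.minimalPeriod P.quot.facePerm q : ℝ) +
      2 * Real.pi * Real.log 2 * (Fintype.card P.QuotDart / 6) := by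
    rw [← h3.sum_one_div_minimalPeriod hP.euler, Finset.mul_sum, ← Finset.sum_add_distrib]
    refine Finset.sum_le_sum fun q _ => ?_
    rw [mul_one_div, ← add_div]
    gcongr
    exact volB_two_mul_le (PermCycle.minimalPeriod_pos _ q)
  rw [h3.nuLozenge_truncation_eq, h3.nuLozenge_eq, div_lt_iff₀ hN]
  set S := ∑ q, volB (Function.minimalPeriod P.quot.facePerm q) /
    (Function.minimalPeriod P.quot.facePerm q : ℝ)
  set N : ℝ := (Fintype.card P.QuotDart : ℝ)
  have h1 : ((S + N * (volB 3 / 3)) / (N / 3) + Real.pi * Real.log 15) / 3 * N =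
      S + N * (volB 3 / 3) + N * (Real.pi * Real.log 15) / 3 := by
    field_simp
  rw [h1]
  have h2 := mul_lt_mul_of_pos_left three_mul_volB_three_lt hN
  linarith

end BiperiodicGraph

theorem mainTheorem2 {D : Type*} (𝒢 : BiperiodicGraph D) (h𝒢 : 𝒢.IsPlanarLatticeGraph)
    (h3 : 𝒢.IsThreeRegular) (z : ℝ) (hz : 𝒢.IsSpanningTreeEntropy z)
    (hlower : 𝒢.nuLozenge ≤ 2 * Real.pi * z) (hupper : 2 * Real.pi * z ≤ 𝒢.nuBar) :
    ∃ z' : ℝ, 𝒢.truncation.IsSpanningTreeEntropy z' ∧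
      𝒢.truncation.nuLozenge < 2 * Real.pi * z' ∧ 2 * Real.pi * z' < 𝒢.truncation.nuBar := by
  have hq := h𝒢.finite_quot
  have := h𝒢.nonempty
  have hz' : 2 * Real.pi * ((z + Real.log 15 / 2) / 3) =
      (2 * Real.pi * z + Real.pi * Real.log 15) / 3 := by ring
  refine ⟨(z + Real.log 15 / 2) / 3, hz.truncation hq h3, ?_, ?_⟩
  · rw [hz']
    linarith [h3.nuLozenge_truncation_lt h𝒢]
  · rw [BiperiodicGraph.truncation_isThreeRegular.nuBar_eq
      (BiperiodicGraph.truncation_finite_quot hq), hz']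
    rw [h3.nuBar_eq hq] at hupper
    linarith [pi_mul_log_fifteen_lt]
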